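/- Let $F$ be a global function field, i.e. the function field of a proper nonsingular (equivalently, smooth projective) integral curve $\mathcal C$ over a finite field. Identify the places $\mathfrak p$ of $F$ with the closed points of $\mathcal C$; let $F_{\mathfrak p}$ be the completion of $F$ at $\mathfrak p$, $\mathcal O_{\mathfrak p}$ its valuation ring, $\mathbf F_{\mathfrak p}$ the residue field, $|x|_{\mathfrak p}=(\#\mathbf F_{\mathfrak p})^{-v_{\mathfrak p}(x)}$, and $dx_{\mathfrak p}$ the Haar measure on $F_{\mathfrak p}$ with $\int_{\mathcal O_{\mathfrak p}}dx_{\mathfrak p}=1$. Let $V$ be a smooth, proper (for instance projective), geometrically integral variety over $F$ of dimension $n$, and let $\omega_V^{-1}=(\Lambda^n\Omega^1_{V/F})^\vee$. A $\mathfrak p$-adic metric on $\omega_V^{-1}$ is a family of norms $\|\cdot\|_{\mathfrak p}$ on the fibres $\omega_V^{-1}(x)$, $x\in V(F_{\mathfrak p})$, such that $x\mapsto\|s(x)\|_{\mathfrak p}$ is continuous for every local section $s$. A family $(\|\cdot\|_{\mathfrak p})_{\mathfrak p}$ of such metrics is an adelic metric if there are a finite set $S'$ of places, a smooth proper model $\mathcal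 V'$ of $V$ over $\mathcal C-S'$ and an invertible sheaf $\mathcal L$ on $\mathcal V'$ extending $\omega_V^{-1}$ such that for all $\mathfrak p\notin S'$ one has $\|y\|_{\mathfrak p}=|y/y_0|_{\mathfrak p}$ for $y \in\omega_V^{-1}(x)$, where $y_0$ is a generator of $\tilde x^*\mathcal L$ and $\tilde x\in\mathcal V'(\mathcal O_{\mathfrak p})$ is the point extending $x\in V(F_{\mathfrak p})$. Given an adelic metric on $\omega_V^{-1}$, let $\omega_{\mathfrak p}$ be the Borel measure on $V(F_{\mathfrak p})$ obtained by gluing the measures $$\left\|\frac{\partial}{\partial x_1}\wedge\dots\wedge\frac{\partial}{\partial x_n}\right\|_{\mathfrak p}dx_{1,\mathfrak p}\cdots dx_{n,\mathfrak p}$$ on open sets $W\subset V(F_{\mathfrak p})$ on which local coordinates $x_1,\dots,x_n$ (regular functions on a Zariski open subset of $V$ whose differentials form a basis of $\Omega^1_{V/F}$ there) identify $W$ with an open subset of $F_{\mathfrak p}^n$. Let $S$ be a finite set of places of $F$ and $\mathcal V$ a smooth proper model of $V$ over $\mathcal C-S$. Then for all but finitely many places $\mathfrak p\notin S$, $$\omega_{\mathfrak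 p}(V(F_{\mathfrak p}))=\frac{\#\mathcal V(\mathbf F_{\mathfrak p})}{(\#\mathbf F_{\mathfrak p})^{n}} .$$ -/

import Mathlib

open AlgebraicGeometry CategoryTheory IsDedekindDomain MeasureTheory
open scoped ENNReal

universe u

noncomputable section

namespace Tamagawa

/-! ### The base curve, its places and their completions -/

/-- An integral scheme whose local rings at closed points are discrete valuation rings, i.e. a
nonsingular curve. For a scheme proper over a finite (hence perfect) field, this means a smooth
projective curve. -/
class IsNonsingularCurve (C : Scheme.{u}) [IsIntegral C] : Prop where
  isDVR : ∀ p : C, IsClosed ({p} : Set C) → IsDiscreteValuationRing (C.presheaf.stalk p)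

/-- The places of the function field of a complete nonsingular curve are its closed points. -/
abbrev Place (C : Scheme.{u}) : Type u := {p : C // IsClosed ({p} : Set C)}

section Place

variable {C : Scheme.{u}} [IsIntegral C] [IsNonsingularCurve C]

instance (p : Place C) : IsDiscreteValuationRing (C.presheaf.stalk p.1) :=
  IsNonsingularCurve.isDVR p.1 p.2

/-- The maximal ideal of the local ring at `p`, as a prime of that Dedekind domain. -/
abbrev Place.prime (p : Place C) : HeightOneSpectrum (C.presheaf.stalk p.1) :=
  IsDiscreteValuationRing.maximalIdeal (C.presheaf.stalk p.1)

/-- The completion `F_p` of the function field at `p`. -/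
abbrev Place.completion (p : Place C) : Type u :=
  p.prime.adicCompletion C.functionField

/-- The valuation ring `O_p` of `F_p`. -/
abbrev Place.integers (p : Place C) : ValuationSubring p.completion :=
  p.prime.adicCompletionIntegers C.functionField

/-- The cardinality of the residue field at `p`. -/
def Place.card (p : Place C) : ℕ := Nat.card (C.residueField p.1)

open Classical in
/-- The normalized absolute value `|x|_p = (#κ(p)) ^ (-v_p(x))`; here `Valued.v x` is
`v_p` written multiplicatively, so that `WithZero.log (Valued.v x) = -v_p(x)` for `x ≠ 0`. -/
def Place.abs (p : Place C) (x : p.completion) : ℝ :=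
  if x = 0 then 0 else (p.card : ℝ) ^ (WithZero.log (Valued.v x))

instance (p : Place C) : MeasurableSpace p.completion := borel _

instance (p : Place C) : BorelSpace p.completion := ⟨rfl⟩

open Classical in
/-- The Haar measure on `F_p` giving mass one to `O_p` (it exists and is unique as `F_p` is
locally compact with compact open subring `O_p`). -/
def Place.haar (p : Place C) : Measure p.completion :=
  if h : ∃ μ : Measure p.completion,
      μ.IsAddHaarMeasure ∧ μ (p.integers : Set p.completion) = 1
  then h.choose else 0

/-- The canonical morphism `Spec O_p ⟶ C`. -/
def Place.specIntegers (p : Place C) : Spec (.of p.integers) ⟶ C :=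
  Spec.map (CommRingCat.ofHom (algebraMap (C.presheaf.stalk p.1) p.integers)) ≫
    C.fromSpecStalk p.1

/-- The morphism `Spec F_p ⟶ Spec O_p`. -/
def Place.specCompletion (p : Place C) : Spec (.of p.completion) ⟶ Spec (.of p.integers) :=
  Spec.map (CommRingCat.ofHom (algebraMap p.integers p.completion))

end Place

/-! ### Points of a scheme with values in a topological field -/

instance stalkAlgebra {R : CommRingCat.{u}} (X : Scheme.{u}) [X.Over (Spec R)] (v : X) :
    Algebra R (X.presheaf.stalk v) :=
  ((Scheme.ΓSpecIso R).inv ≫ (X ↘ Spec R).appTop ≫ X.presheaf.germ ⊤ v trivial).hom.toAlgebra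

section Points

variable {R : CommRingCat.{u}} (X : Scheme.{u}) [X.Over (Spec R)]
  (K : Type u) [Field K] [Algebra R K]

/-- The set `X(K)` of `K`-points of an `R`-scheme `X`. -/
def Points : Type u :=
  {x : Spec (.of K) ⟶ X // x ≫ (X ↘ Spec R) = Spec.map (CommRingCat.ofHom (algebraMap R K))}

variable {X K}

/-- The point of the scheme `X` underlying a `K`-point. -/
def Points.pt (x : Points (R := R) X K) : X := x.1 (IsLocalRing.closedPoint K)

/-- The ring homomorphism from the local ring of `X` at a `K`-point to `K`. -/
def Points.hom (x : Points (R := R) X K) : X.presheaf.stalk x.pt →+* K :=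
  (Scheme.stalkClosedPointTo x.1).hom

/-- The value at a `K`-point of a function defined on a neighbourhood. -/
def Points.eval (x : Points (R := R) X K) {U : X.Opens} (hx : x.pt ∈ U) (f : Γ(X, U)) : K :=
  x.hom (X.presheaf.germ U x.pt hx f)

/-- The topology of `X(K)` induced by that of `K`: it is generated by the sets
`{x ∈ U(K) | f(x) ∈ O}` with `U` open in `X`, `f` a function on `U` and `O` open in `K`. -/
instance [TopologicalSpace K] : TopologicalSpace (Points (R := R) X K) :=
  TopologicalSpace.generateFrom
    {A | ∃ (U : X.Opens) (f : Γ(X, U)) (O : Set K), IsOpen O ∧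
      A = {x | ∃ hx : x.pt ∈ U, x.eval hx f ∈ O}}

instance [TopologicalSpace K] : MeasurableSpace (Points (R := R) X K) := borel _

instance [TopologicalSpace K] : BorelSpace (Points (R := R) X K) := ⟨rfl⟩

/-- The field `K`, regarded as an algebra over the local ring of `X` at `x`. -/
def Points.ValueField (_ : Points (R := R) X K) : Type u := K

instance (x : Points (R := R) X K) : Field x.ValueField := inferInstanceAs (Field K)

instance (x : Points (R := R) X K) : Algebra (X.presheaf.stalk x.pt) x.ValueField :=
  x.hom.toAlgebra

/-! ### The anticanonical sheaf

For `X` smooth of dimension `n` over a field, the anticanonical sheaf is the dual of the `n`-th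
exterior power of the sheaf of differentials; its stalk at `v` (resp. its fibre at a `K`-point `x`)
is the module of alternating `n`-linear maps from `Ω` of the local ring to that local ring
(resp. to `K`). -/

variable (n : ℕ)

/-- The stalk at `v` of the anticanonical sheaf. -/
abbrev AnticanStalk (R : CommRingCat.{u}) (X : Scheme.{u}) [X.Over (Spec R)] (n : ℕ) (v : X) :
    Type u :=
  AlternatingMap (X.presheaf.stalk v) (KaehlerDifferential R (X.presheaf.stalk v))
    (X.presheaf.stalk v) (Fin n)

/-- The fibre at the `K`-point `x` of the anticanonical sheaf, a vector space over `K`. -/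
abbrev AnticanFibre (x : Points (R := R) X K) : Type u :=
  AlternatingMap (X.presheaf.stalk x.pt) (KaehlerDifferential R (X.presheaf.stalk x.pt))
    x.ValueField (Fin n)

/-- The image in the fibre at `x` of an element of the stalk. -/
def AnticanStalk.toFibre {n : ℕ} (x : Points (R := R) X K) (s : AnticanStalk R X n x.pt) :
    AnticanFibre n x :=
  (Algebra.linearMap (X.presheaf.stalk x.pt) x.ValueField).compAlternatingMap s

/-- A section of the anticanonical sheaf over the open set `W`: a family of elements of the stalks
that maps differentials of functions to functions. -/
structure AnticanSection (R : CommRingCat.{u}) (X : Scheme.{u}) [X.Over (Spec R)] (n : ℕ)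
    (W : X.Opens) where
  /-- The germs of the section. -/
  germ : ∀ v ∈ W, AnticanStalk R X n v
  isRegular : ∀ (W' : X.Opens) (hW : W' ≤ W) (a : Fin n → Γ(X, W')), ∃ b : Γ(X, W'),
    ∀ (v : X) (hv : v ∈ W'),
      germ v (hW hv) (fun i => KaehlerDifferential.D R (X.presheaf.stalk v)
        (X.presheaf.germ W' v hv (a i))) = X.presheaf.germ W' v hv b

/-- The value of a section of the anticanonical sheaf at a `K`-point. -/
def AnticanSection.value {n : ℕ} {W : X.Opens} (s : AnticanSection R X n W)
    (x : Points (R := R) X K) (hx : x.pt ∈ W) : AnticanFibre n x :=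
  (s.germ x.pt hx).toFibre x

end Points

/-! ### Models, adelic metrics -/

section Metric

variable {C : Scheme.{u}} [IsIntegral C] [IsNonsingularCurve C]
  (V : Scheme.{u}) [V.Over (Spec C.functionField)]

/-- The set `V(F_p)`. -/
abbrev LocalPoints (p : Place C) : Type u := Points (R := C.functionField) V p.completion

/-- A smooth proper model of `V` over a nonempty open subset of `C` (the complement of a finite
set of places). -/
structure Model (C : Scheme.{u}) [IsIntegral C] (V : Scheme.{u})
    [V.Over (Spec C.functionField)] where
  /-- The open subset of `C` over which the model lives. -/
  base : C.Opens
  nonempty : (base : Set C).Nonempty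
  /-- The total space. -/
  space : Scheme.{u}
  /-- The structure morphism. -/
  proj : space ⟶ base
  isProper : IsProper proj
  smooth : Smooth proj
  /-- The inclusion of the generic fibre. -/
  incl : V ⟶ space
  /-- The generic fibre is identified with `V`. -/
  isPullback : IsPullback incl (V ↘ Spec C.functionField) (proj ≫ base.ι)
    (C.fromSpecStalk (genericPoint C))

variable {V}

/-- The points of the model with values in the residue field at `p`. -/
def Model.ResiduePoints (M : Model C V) (p : Place C) : Type u :=
  {y : Spec (C.residueField p.1) ⟶ M.space //
    y ≫ M.proj ≫ M.base.ι = C.fromSpecResidueField p.1}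

/-- The local density `#M(κ(p)) / (#κ(p)) ^ n` of a model of an `n`-dimensional variety. -/
def Model.density (M : Model C V) (n : ℕ) (p : Place C) : ℝ≥0∞ :=
  (Nat.card (M.ResiduePoints p) : ℝ≥0∞) / (p.card : ℝ≥0∞) ^ n

/-- `xt` is the `O_p`-point of the model extending the `F_p`-point `x` of `V`. -/
def Model.Extends (M : Model C V) {p : Place C} (x : LocalPoints V p)
    (xt : Spec (.of p.integers) ⟶ M.space) : Prop :=
  xt ≫ M.proj ≫ M.base.ι = p.specIntegers ∧ p.specCompletion ≫ xt = x.1 ≫ M.incl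

/-- A model of the anticanonical sheaf of `V` on a model `M` of `V`, i.e. an invertible sheaf on `M`
with an identification of its restriction to `V` with the anticanonical sheaf. It is given by
generators on the members of an open cover of `M`: their restrictions to `V` are generators
`frame i` of the anticanonical sheaf, and the transition functions are invertible functions
on the intersections of the members of the cover (they satisfy the cocycle condition since functions
on `M` are determined by their restriction to `V`). -/
structure AnticanModel (M : Model C V) (n : ℕ) where
  /-- The index set of the cover. -/
  ι : Type u
  /-- The open cover of `M`. -/
  cover : ι → M.space.Opens
  iSup_cover : ⨆ i, cover i = ⊤
  /-- The generators. -/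
  frame : ∀ i, AnticanSection C.functionField V n (M.incl ⁻¹ᵁ cover i)
  generates : ∀ i (v : V) (hv : v ∈ M.incl ⁻¹ᵁ cover i) (y : AnticanStalk C.functionField V n v),
    ∃ a : V.presheaf.stalk v, y = a • (frame i).germ v hv
  transition : ∀ i j, ∃ g : Γ(M.space, cover i ⊓ cover j), IsUnit g ∧
    ∀ (v : V) (hv : v ∈ M.incl ⁻¹ᵁ (cover i ⊓ cover j)),
      (frame i).germ v hv.1 =
        (V.presheaf.germ _ v hv (M.incl.app (cover i ⊓ cover j) g)) • (frame j).germ v hv.2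

variable (V)

/-- A `p`-adic metric on the anticanonical sheaf of `V`: a norm on each fibre at a point of
`V(F_p)`, such that the norm of a section is continuous. -/
structure PadicMetric (n : ℕ) (p : Place C) where
  /-- The norm on the fibre at `x`. -/
  norm : ∀ x : LocalPoints V p, AnticanFibre n x → ℝ
  norm_nonneg : ∀ x y, 0 ≤ norm x y
  norm_eq_zero : ∀ x y, norm x y = 0 ↔ y = 0
  norm_add_le : ∀ x y z, norm x (y + z) ≤ norm x y + norm x z
  norm_smul : ∀ (x : LocalPoints V p) (a : x.ValueField) (y : AnticanFibre n x),
    norm x (a • y) = p.abs a * norm x y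
  continuous : ∀ (W : V.Opens) (s : AnticanSection C.functionField V n W),
    Continuous fun x : {x : LocalPoints V p // x.pt ∈ W} => norm x.1 (s.value x.1 x.2)

variable {V}

/-- The metric is defined by the given model of the anticanonical sheaf: `‖y‖ = |y / y₀|_p`
for a generator `y₀` of the pull-back of the model of the sheaf to the `O_p`-point extending `x`
(a morphism from the spectrum of a local ring factors through an open set as soon as it maps the
closed point into it). -/
def PadicMetric.IsDefinedBy {n : ℕ} {p : Place C} (m : PadicMetric V n p) {M : Model C V}
    (L : AnticanModel M n) : Prop :=
  ∀ (x : LocalPoints V p) (xt : Spec (.of p.integers) ⟶ M.space), M.Extends x xt →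
    ∀ (i : L.ι), xt (IsLocalRing.closedPoint p.integers) ∈ L.cover i →
      ∀ (hx : x.pt ∈ M.incl ⁻¹ᵁ L.cover i) (a : x.ValueField),
        m.norm x (a • (L.frame i).value x hx) = p.abs a

/-- An adelic metric: a family of `p`-adic metrics which are defined by one model outside a finite
set of places. -/
def IsAdelicMetric {n : ℕ} (m : ∀ p : Place C, PadicMetric V n p) : Prop :=
  ∃ (M : Model C V) (L : AnticanModel M n), ∀ p : Place C, p.1 ∈ M.base → (m p).IsDefinedBy L

/-! ### The local measures -/

variable (V)

/-- Local coordinates on an open subset of `V(F_p)`. -/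
structure Chart (n : ℕ) (p : Place C) where
  /-- The open subset of `V` where the coordinates are regular. -/
  dom : V.Opens
  /-- The coordinates `x₁, …, x_n`. -/
  coord : Fin n → Γ(V, dom)
  /-- The differentials `dx₁, …, dx_n` are linearly independent at each point, and ... -/
  linearIndependent : ∀ (v : V) (hv : v ∈ dom), LinearIndependent (V.presheaf.stalk v)
    fun i => KaehlerDifferential.D C.functionField (V.presheaf.stalk v)
      (V.presheaf.germ dom v hv (coord i))
  /-- ... they generate the module of differentials at each point. -/
  span_eq_top : ∀ (v : V) (hv : v ∈ dom), ⊤ ≤ Submodule.span (V.presheaf.stalk v)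
    (Set.range fun i => KaehlerDifferential.D C.functionField (V.presheaf.stalk v)
      (V.presheaf.germ dom v hv (coord i)))
  /-- The open subset of `V(F_p)`. -/
  source : Set (LocalPoints V p)
  isOpen_source : IsOpen source
  pt_mem : ∀ x ∈ source, x.pt ∈ dom
  /-- The coordinates identify `source` with an open subset of `F_p ^ n`. -/
  isOpenEmbedding : Topology.IsOpenEmbedding fun (x : source) (i : Fin n) =>
    x.1.eval (pt_mem x.1 x.2) (coord i)

variable {V} {n : ℕ} {p : Place C}

/-- The map from the source of the chart to `F_p ^ n`. -/
def Chart.toFun (c : Chart V n p) (x : c.source) (i : Fin n) : p.completion :=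
  x.1.eval (c.pt_mem x.1 x.2) (c.coord i)

/-- The element `∂/∂x₁ ∧ … ∧ ∂/∂x_n` of the stalk of the anticanonical sheaf: the alternating form
with value `1` on `(dx₁, …, dx_n)`. -/
def Chart.partials (c : Chart V n p) (v : V) (hv : v ∈ c.dom) :
    AnticanStalk C.functionField V n v :=
  (Module.Basis.mk (c.linearIndependent v hv) (c.span_eq_top v hv)).det

/-- The measure `‖∂/∂x₁ ∧ … ∧ ∂/∂x_n‖_p dx₁ … dx_n` on the source of the chart, extended by zero
to a Borel measure on `V(F_p)`. -/
def Chart.measure (c : Chart V n p) (m : PadicMetric V n p) : Measure (LocalPoints V p) :=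
  (((Measure.pi fun _ : Fin n => p.haar).comap c.toFun).withDensity fun x =>
    ENNReal.ofReal (m.norm x.1 ((c.partials x.1.pt (c.pt_mem x.1 x.2)).toFibre x.1))).map
      Subtype.val

/-- The Borel measure `ω_p` on `V(F_p)` obtained by gluing the measures of the charts. As these
agree on the intersections of the sources, the glued measure is the least measure that
dominates all of them. -/
def localMeasure (m : PadicMetric V n p) : Measure (LocalPoints V p) :=
  ⨆ c : Chart V n p, c.measure m

end Metric

end Tamagawa

end

/-! Write q for the cardinality of the residue field at p. For almost every p the reduction map
splits V(F_p) into residue disks, one for each point of the model over the residue field, and each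
disk has volume q^(-n).

By the valuative criterion every point of V(F_p) extends uniquely to an O_p-point of the model,
which can be reduced; the disks `Model.disk` are the fibres of this map. Étale coordinates near a
residue point identify its disk with a coset of the n-th power of the maximal ideal of O_p: points
lift with prescribed coordinates because O_p is complete (`exists_lift_of_etale`), and two points of
a disk are as close as their coordinates (`sub_mem_pow_of_etale`). Such a coset has Haar measure
q^(-n), so this is the mass of the disk as soon as the metric takes the value 1 on the dual of the
differentials of the coordinates.

The metric is defined on another model M'. The local rings of both models along the generic fibre
are those of V, so near each point of the generic fibre the identity of V extends to a morphism from
an open subset of M to M' (`Model.exists_spread`). There the given generator of the sheaf, evaluated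
on the differentials of étale coordinates, is a quotient of functions that become invertible after
shrinking (`CoordSystem.exists_adapted`). Finitely many such neighbourhoods cover V, which is
quasi-compact. What they omit in M is closed and misses the generic fibre; since M is proper over
its base, its image lies in a closed subset of C without the generic point, and that contains only
finitely many places.

As `localMeasure` is a supremum over all charts, the disjoint disks give the lower bound at once.
The upper bound requires that no chart gives more mass than the disk charts, which is one half of
the change of variables formula. A relation between Kähler differentials yields a strict Jacobian
(`sub_sum_mem_smallAt`). Once corrected by the inverse Jacobian at a point, the other coordinates do
not expand distances near that point, hence do not increase volume
(`measure_image_le_of_nonexpanding`); the linear correction scales volume by the absolute value of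
its determinant (`measure_image_mulVec`). -/

noncomputable section

namespace Tamagawa

/-! ### Haar measure on powers of a discretely valued field -/

section Lattice

open WithZero Filter Topology
open scoped WithZero

variable {K : Type*} [Field K] [Valued K ℤᵐ⁰]

/-- The lattice of vectors all of whose coordinates have valuation at least `k`. -/
def lattice (K : Type*) [Field K] [Valued K ℤᵐ⁰] (n : ℕ) (k : ℤ) : AddSubgroup (Fin n → K) where
  carrier := {w | ∀ i, Valued.v (w i) ≤ exp (-k)}
  zero_mem' i := by simp
  add_mem' ha hb i := (Valued.v.map_add _ _).trans (max_le (ha i) (hb i))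
  neg_mem' ha i := by simpa using ha i

variable {n : ℕ}

lemma mem_lattice {k : ℤ} {w : Fin n → K} :
    w ∈ lattice K n k ↔ ∀ i, Valued.v (w i) ≤ exp (-k) := Iff.rfl

lemma lattice_antitone : Antitone (lattice K n) := fun _ _ h _ hw i =>
  (hw i).trans (exp_le_exp.2 (neg_le_neg h))

/-- The value group is discrete, so open balls are closed balls of the next smaller radius.
Surjectivity makes every `exp (-k)` an admissible radius. -/
lemma mem_nhds_iff_valued (hv : Function.Surjective (Valued.v : K → ℤᵐ⁰)) {s : Set K} {x : K} :
    s ∈ 𝓝 x ↔ ∃ k : ℤ, {y | Valued.v (y - x) ≤ exp (-k)} ⊆ s := by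
  rw [Valued.mem_nhds]
  constructor
  · rintro ⟨γ, hγ⟩
    have h0 : MonoidWithZeroHom.ValueGroup₀.embedding γ.1 ≠ 0 := by simp
    refine ⟨-(log (MonoidWithZeroHom.ValueGroup₀.embedding γ.1) - 1), fun y hy => hγ ?_⟩
    simp only [Set.mem_ofPred_eq, Valuation.restrict_lt_iff_lt_embedding, neg_neg] at hy ⊢
    refine hy.trans_lt ?_
    rw [← lt_log_iff_exp_lt h0]
    lia
  · rintro ⟨k, hk⟩
    obtain ⟨c, hc⟩ := hv (exp (-k))
    have hc0 : Valued.v c ≠ 0 := by simp [hc]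
    refine ⟨Units.mk0 (Valued.v.restrict c) (by simpa using hc0), fun y hy => hk ?_⟩
    simp only [Set.mem_ofPred_eq, Units.val_mk0, Valuation.restrict_lt_iff, hc] at hy ⊢
    exact hy.le

lemma mem_nhds_iff_lattice (hv : Function.Surjective (Valued.v : K → ℤᵐ⁰))
    {s : Set (Fin n → K)} {x : Fin n → K} :
    s ∈ 𝓝 x ↔ ∃ k : ℤ, ∀ y, y - x ∈ lattice K n k → y ∈ s := by
  rw [nhds_pi, Filter.mem_pi']
  constructor
  · rintro ⟨I, t, ht, hs⟩
    choose k hk using fun i => (mem_nhds_iff_valued hv).1 (ht i)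
    obtain ⟨N, hN⟩ := Finset.exists_le (Finset.univ.image k)
    refine ⟨N, fun y hy => hs fun i _ => hk i ((hy i).trans ?_)⟩
    exact exp_le_exp.2 (neg_le_neg (hN _ (by simp)))
  · rintro ⟨k, hk⟩
    exact ⟨Finset.univ, fun i => {y | Valued.v (y - x i) ≤ exp (-k)},
      fun i => (mem_nhds_iff_valued hv).2 ⟨k, subset_rfl⟩, fun y hy => hk y fun i => hy i (by simp)⟩

lemma isOpen_lattice (hv : Function.Surjective (Valued.v : K → ℤᵐ⁰)) (k : ℤ) :
    IsOpen (lattice K n k : Set (Fin n → K)) := by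
  rw [isOpen_iff_mem_nhds]
  refine fun x hx => (mem_nhds_iff_lattice hv).2 ⟨k, fun y hy => ?_⟩
  simpa using add_mem hy hx

end Lattice

/-! ### Maps that do not expand distances do not increase Haar measure -/

section Nonexpanding

open WithZero Filter Topology
open scoped WithZero

variable {K : Type*} [Field K] [Valued K ℤᵐ⁰] {n : ℕ} [SecondCountableTopology K]

/-- The lattice is open, so the quotient is discrete; being also separable, it is countable. -/
lemma countable_quotient_lattice (hv : Function.Surjective (Valued.v : K → ℤᵐ⁰)) (k : ℤ) :
    Countable ((Fin n → K) ⧸ lattice K n k) := by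
  have := QuotientAddGroup.discreteTopology (isOpen_lattice (n := n) hv k)
  exact TopologicalSpace.separableSpace_iff_countable.1 inferInstance

variable [MeasurableSpace K] [BorelSpace K]

/-- A family of vectors whose mutual distances are at most those of another family
sweeps out at most the same volume. -/
lemma measure_image_le_of_nonexpanding [LocallyCompactSpace K]
    (hv : Function.Surjective (Valued.v : K → ℤᵐ⁰))
    (ν : Measure (Fin n → K)) [ν.IsAddHaarMeasure] {X : Type*} (f g : X → Fin n → K) (A : Set X)
    (h : ∀ P ∈ A, ∀ Q ∈ A, ∀ k : ℤ, f P - f Q ∈ lattice K n k → g P - g Q ∈ lattice K n k) :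
    ν (g '' A) ≤ ν (f '' A) := by
  refine ENNReal.le_of_forall_pos_le_add fun ε hε _ => ?_
  obtain ⟨O, hO, hOo, hνO⟩ := (f '' A).exists_isOpen_le_add ν (ε := ε) (by simpa using hε.ne')
  refine le_trans ?_ hνO
  -- `B k` consists of the points whose whole coset modulo the k-th lattice lies in the open set
  -- `O`. These sets exhaust `A`. The images under `g` need not be measurable, but continuity from
  -- below holds for increasing unions of arbitrary sets.
  let B : ℕ → Set X := fun k => {P ∈ A | ∀ w, w - f P ∈ lattice K n k → w ∈ O}
  have hB : Monotone B := fun k l hkl P hP =>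
    ⟨hP.1, fun w hw => hP.2 w (lattice_antitone (by exact_mod_cast hkl) hw)⟩
  have hBA : g '' A = ⋃ k, g '' B k := by
    rw [← Set.image_iUnion]
    congr 1
    refine subset_antisymm (fun P hP => ?_) (Set.iUnion_subset fun k P hP => hP.1)
    obtain ⟨k, hk⟩ := (mem_nhds_iff_lattice hv).1 (hOo.mem_nhds (hO ⟨P, hP, rfl⟩))
    exact Set.mem_iUnion.2 ⟨k.toNat, hP, fun w hw => hk w (lattice_antitone (Int.self_le_toNat k) hw)⟩
  rw [hBA, Monotone.measure_iUnion fun k l hkl => Set.image_mono (hB hkl)]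
  refine iSup_le fun k => ?_
  have := countable_quotient_lattice (n := n) hv k
  let q : (Fin n → K) → (Fin n → K) ⧸ lattice K n k := QuotientAddGroup.mk
  let S : Set ((Fin n → K) ⧸ lattice K n k) := (q ∘ f) '' B k
  have hpre (w : Fin n → K) : q ⁻¹' {q w} = (fun u => -w + u) ⁻¹' (lattice K n k) := by
    ext u
    simp only [Set.mem_preimage, Set.mem_singleton_iff, SetLike.mem_coe, q]
    rw [eq_comm, QuotientAddGroup.eq]
  have hcoset (w : Fin n → K) : ν (q ⁻¹' {q w}) = ν (lattice K n k) := by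
    rw [hpre, measure_preimage_add]
  have hmeas (s) : MeasurableSet (q ⁻¹' {s}) := by
    obtain ⟨w, rfl⟩ := QuotientAddGroup.mk_surjective s
    exact hpre w ▸ ((isOpen_lattice hv _).preimage (by fun_prop)).measurableSet
  -- Points whose images under `f` share a coset have images under `g` in a single coset too. All
  -- cosets have the same measure, and the distinct cosets met by `f` on `B k` are disjoint subsets
  -- of `O`.
  calc ν (g '' B k) ≤ ν (⋃ s : S, g '' {P ∈ B k | q (f P) = s}) := by
        refine measure_mono ?_
        rintro _ ⟨P, hP, rfl⟩
        exact Set.mem_iUnion.2 ⟨⟨q (f P), P, hP, rfl⟩, P, ⟨hP, rfl⟩, rfl⟩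
    _ ≤ ∑' s : S, ν (g '' {P ∈ B k | q (f P) = s}) := measure_iUnion_le _
    _ ≤ ∑' s : S, ν (q ⁻¹' {s.1}) := by
        refine ENNReal.tsum_le_tsum ?_
        rintro ⟨_, P, hP, rfl⟩
        refine le_trans (measure_mono ?_) (((hcoset (g P)).trans (hcoset (f P)).symm).le)
        rintro _ ⟨Q, ⟨hQ, hPQ⟩, rfl⟩
        have h1 : f P - f Q ∈ lattice K n k := by
          have := QuotientAddGroup.eq.1 hPQ
          simpa [sub_eq_add_neg, add_comm] using this
        have h2 := h P hP.1 Q hQ.1 k h1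
        refine QuotientAddGroup.eq.2 ?_
        simpa [sub_eq_add_neg, add_comm] using h2
    _ = ν (⋃ s : S, q ⁻¹' {s.1}) := by
        refine (measure_iUnion (f := fun s : S => q ⁻¹' {s.1}) (fun s t hst => ?_) fun s => hmeas s.1).symm
        exact (Set.disjoint_singleton.2 (Subtype.coe_injective.ne hst)).preimage q
    _ ≤ ν O := by
        refine measure_mono (Set.iUnion_subset ?_)
        rintro ⟨_, P, hP, rfl⟩ w hw
        refine hP.2 w ?_
        have := QuotientAddGroup.eq.1 (show q (f P) = q w from (by simpa using hw.symm))
        simpa [sub_eq_add_neg, add_comm] using this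

end Nonexpanding


/-! ### Scaling of Haar measure by invertible matrices -/

section Scaling

open WithZero Filter Topology
open scoped WithZero

/-- An additive homeomorphism multiplies a Haar measure by a constant. -/
lemma exists_measure_image_eq_mul {G : Type*} [AddGroup G] [TopologicalSpace G]
    [IsTopologicalAddGroup G] [LocallyCompactSpace G] [SecondCountableTopology G]
    [MeasurableSpace G] [BorelSpace G] (ν : Measure G) [ν.IsAddHaarMeasure] (e : G ≃ₜ+ G) :
    ∃ c : ℝ≥0∞, ∀ A : Set G, ν (e '' A) = c * ν A := by
  have hH : (ν.map e.symm).IsAddHaarMeasure := e.symm.isAddHaarMeasure_map ν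
  refine ⟨(ν.map e.symm).addHaarScalarFactor ν, fun A => ?_⟩
  have h1 : (ν.map e.symm) A = ν (e '' A) := by
    rw [show (e.symm : G → G) = e.symm.toHomeomorph.toMeasurableEquiv from rfl,
      MeasurableEquiv.map_apply]
    congr 1
    exact (e.toEquiv.image_eq_preimage_symm A).symm
  rw [← h1]
  exact congrArg (fun ρ : Measure G => ρ A) (Measure.isAddLeftInvariant_eq_smul (ν.map e.symm) ν)

variable {K : Type*} [Field K] [Valued K ℤᵐ⁰]

/-- Representatives for the residue field of a valued field. -/
structure IsResidueSystem {κ : Type*} (s : κ → K) : Prop where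
  le_one : ∀ r, Valued.v (s r) ≤ 1
  existsUnique : ∀ x : K, Valued.v x ≤ 1 → ∃! r, Valued.v (x - s r) < 1

/-- Multiplication by a nonzero scalar as an additive homeomorphism. -/
def mulHomeo (a : K) (ha : a ≠ 0) : K ≃ₜ+ K where
  toFun x := a * x
  invFun x := a⁻¹ * x
  left_inv x := by simp [ha]
  right_inv x := by simp [ha]
  map_add' x y := mul_add a x y
  continuous_toFun := by fun_prop
  continuous_invFun := by fun_prop

lemma image_mulHomeo (a : K) (ha : a ≠ 0) (c : ℤᵐ⁰) :
    mulHomeo a ha '' {x | Valued.v x ≤ c} = {x | Valued.v x ≤ Valued.v a * c} := by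
  have hva : 0 < Valued.v a := by simpa [zero_lt_iff] using ha
  ext x
  constructor
  · rintro ⟨y, hy, rfl⟩
    change Valued.v (a * y) ≤ _
    rw [map_mul]
    exact mul_le_mul_right hy _
  · refine fun hx => ⟨a⁻¹ * x, ?_, by simp [mulHomeo, ha]⟩
    change Valued.v (a⁻¹ * x) ≤ c
    rw [map_mul, map_inv₀]
    exact (inv_mul_le_iff₀ hva).2 hx

lemma lt_one_iff_le_exp {c : ℤᵐ⁰} : c < 1 ↔ c ≤ exp (-1) := by
  rcases eq_or_ne c 0 with rfl | hc
  · simp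
  · rw [← exp_zero, ← log_lt_iff_lt_exp hc, ← log_le_iff_le_exp hc]
    lia

/-- The unit ball is the disjoint union of the translates of the maximal ideal by the
representatives of the residue field. -/
lemma card_mul_measure_lt_one [MeasurableSpace K] [BorelSpace K] [SecondCountableTopology K]
    (hv : Function.Surjective (Valued.v : K → ℤᵐ⁰)) {κ : Type*} [Finite κ] {s : κ → K}
    (hs : IsResidueSystem s) (μ : Measure K) [μ.IsAddLeftInvariant] :
    (Nat.card κ : ℝ≥0∞) * μ {x | Valued.v x ≤ exp (-1)} = μ {x | Valued.v x ≤ 1} := by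
  have : Fintype κ := Fintype.ofFinite κ
  have hO : IsOpen {x : K | Valued.v x ≤ exp (-1)} := by
    refine isOpen_iff_mem_nhds.2 fun x hx => (mem_nhds_iff_valued hv).2 ⟨1, fun y hy => ?_⟩
    have := (Valued.v.map_add (y - x) x).trans (max_le hy hx)
    simpa using this
  have hdec : {x : K | Valued.v x ≤ 1} =
      ⋃ r, (fun x => -s r + x) ⁻¹' {x | Valued.v x ≤ exp (-1)} := by
    ext x
    simp only [Set.mem_ofPred_eq, Set.mem_iUnion, Set.mem_preimage, ← lt_one_iff_le_exp]
    constructor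
    · intro hx
      obtain ⟨r, hr, -⟩ := hs.existsUnique x hx
      exact ⟨r, by rwa [neg_add_eq_sub]⟩
    · rintro ⟨r, hr⟩
      have := (Valued.v.map_add (-s r + x) (s r)).trans (max_le hr.le (hs.le_one r))
      simpa using this
  rw [hdec, measure_iUnion]
  · simp_rw [measure_preimage_add]
    simp [Nat.card_eq_fintype_card]
  · intro r r' hrr
    refine Set.disjoint_left.2 fun x hx hx' => hrr ?_
    simp only [Set.mem_preimage, Set.mem_ofPred_eq, neg_add_eq_sub, ← lt_one_iff_le_exp] at hx hx'
    have hx1 : Valued.v x ≤ 1 := by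
      have := (Valued.v.map_add (x - s r) (s r)).trans (max_le hx.le (hs.le_one r))
      simpa using this
    exact (hs.existsUnique x hx1).unique hx hx'
  · exact fun r => (hO.preimage (by fun_prop)).measurableSet

variable {n : ℕ}

/-- Multiplication by an invertible matrix as an additive homeomorphism. -/
def mulVecHomeo (M : Matrix (Fin n) (Fin n) K) (hM : M.det ≠ 0) : (Fin n → K) ≃ₜ+ (Fin n → K) where
  toFun x := M.mulVec x
  invFun x := M⁻¹.mulVec x
  left_inv x := by
    beta_reduce
    rw [Matrix.mulVec_mulVec, Matrix.nonsing_inv_mul _ (isUnit_iff_ne_zero.2 hM), Matrix.one_mulVec]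
  right_inv x := by
    beta_reduce
    rw [Matrix.mulVec_mulVec, Matrix.mul_nonsing_inv _ (isUnit_iff_ne_zero.2 hM), Matrix.one_mulVec]
  map_add' x y := M.mulVec_add x y
  continuous_toFun := by fun_prop
  continuous_invFun := by fun_prop

lemma mulVec_mem_lattice {M : Matrix (Fin n) (Fin n) K} (hM : ∀ i j, Valued.v (M i j) ≤ 1)
    {k : ℤ} {w : Fin n → K} (hw : w ∈ lattice K n k) : M.mulVec w ∈ lattice K n k := by
  intro i
  rw [Matrix.mulVec_apply_eq_sum]
  refine Valued.v.map_sum_le fun j _ => ?_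
  rw [map_mul]
  exact (mul_le_mul' (hM i j) (hw j)).trans (one_mul _).le

lemma lattice_eq_pi (k : ℤ) :
    (lattice K n k : Set (Fin n → K)) = Set.univ.pi fun _ => {x | Valued.v x ≤ exp (-k)} := by
  ext; simp [mem_lattice]

lemma card_ne_zero_of_isResidueSystem {κ : Type*} [Finite κ] {s : κ → K} (hs : IsResidueSystem s) :
    (Nat.card κ : ℝ≥0∞) ≠ 0 := by
  obtain ⟨r, -⟩ := hs.existsUnique 0 (by simp)
  have : Nonempty κ := ⟨r⟩
  simp [Nat.card_eq_zero, Finite.not_infinite]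

variable [SecondCountableTopology K] [LocallyCompactSpace K] [MeasurableSpace K] [BorelSpace K]

/-- Multiplication by an element of value `exp (k + 1)` carries the balls of radii `1` and `exp
(-1)` to those of radii `exp (k + 1)` and `exp k`, scaling both measures by one constant. Hence
consecutive balls always have ratio `Nat.card κ`, and the normalization of the unit ball fixes all
values. -/
lemma measure_le_exp (hv : Function.Surjective (Valued.v : K → ℤᵐ⁰)) {κ : Type*} [Finite κ]
    {s : κ → K} (hs : IsResidueSystem s) (μ : Measure K) [μ.IsAddHaarMeasure]
    (hμ : μ {x | Valued.v x ≤ 1} = 1) (k : ℤ) :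
    μ {x | Valued.v x ≤ exp k} = (Nat.card κ : ℝ≥0∞) ^ k := by
  have hq : (Nat.card κ : ℝ≥0∞) ≠ 0 := by
    intro h0
    have := card_mul_measure_lt_one hv hs μ
    rw [h0, hμ] at this
    simp at this
  have hrec (k : ℤ) : μ {x | Valued.v x ≤ exp (k + 1)} =
      Nat.card κ * μ {x | Valued.v x ≤ exp k} := by
    obtain ⟨a, ha⟩ := hv (exp (k + 1))
    have ha0 : a ≠ 0 := by rintro rfl; simp at ha
    obtain ⟨c, hc⟩ := exists_measure_image_eq_mul μ (mulHomeo a ha0)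
    have h1 := hc {x | Valued.v x ≤ exp 0}
    have h2 := hc {x | Valued.v x ≤ exp (-1)}
    rw [image_mulHomeo, ha, ← exp_add] at h1 h2
    rw [add_zero] at h1
    rw [add_neg_cancel_right] at h2
    rw [h1, h2, ← mul_assoc, mul_comm _ c, mul_assoc, card_mul_measure_lt_one hv hs, exp_zero]
  induction k using Int.induction_on with
  | zero => simpa using hμ
  | succ k ih => rw [hrec, ih, mul_comm, ENNReal.zpow_add hq (by simp), zpow_one]
  | pred k ih =>
    have := hrec (-k - 1)
    rw [sub_add_cancel, ih] at this
    rw [ENNReal.zpow_sub hq (by simp), this, zpow_one, mul_comm, ← mul_assoc,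
      ENNReal.inv_mul_cancel hq (by simp), one_mul]

lemma measure_lattice (hv : Function.Surjective (Valued.v : K → ℤᵐ⁰)) {κ : Type*} [Finite κ]
    {s : κ → K} (hs : IsResidueSystem s) (μ : Measure K) [μ.IsAddHaarMeasure]
    (hμ : μ {x | Valued.v x ≤ 1} = 1) (k : ℤ) :
    (Measure.pi fun _ : Fin n => μ) (lattice K n k) = ((Nat.card κ : ℝ≥0∞) ^ (-k)) ^ n := by
  rw [lattice_eq_pi, Measure.pi_pi]
  simp_rw [measure_le_exp hv hs μ hμ]
  simp

/-- An invertible matrix multiplies the Haar measure by the absolute value of its determinant. -/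
theorem measure_image_mulVec (hv : Function.Surjective (Valued.v : K → ℤᵐ⁰)) {κ : Type*} [Finite κ]
    {s : κ → K} (hs : IsResidueSystem s) (μ : Measure K) [μ.IsAddHaarMeasure]
    (hμ : μ {x | Valued.v x ≤ 1} = 1) (M : Matrix (Fin n) (Fin n) K) (hM : M.det ≠ 0)
    (A : Set (Fin n → K)) :
    (Measure.pi fun _ : Fin n => μ) (M.mulVec '' A) =
      (Nat.card κ : ℝ≥0∞) ^ log (Valued.v M.det) * (Measure.pi fun _ : Fin n => μ) A := by
  set ν := Measure.pi fun _ : Fin n => μ with hν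
  have hq := card_ne_zero_of_isResidueSystem hs
  have hL : ν (lattice K n 0) = 1 := by simp [hν, measure_lattice hv hs μ hμ]
  -- The unit lattice has measure one, so the scaling constant of a matrix is the measure of its
  -- image of the unit lattice.
  have hex (M : Matrix (Fin n) (Fin n) K) (hM : M.det ≠ 0) :
      ∀ A, ν (M.mulVec '' A) = ν (M.mulVec '' lattice K n 0) * ν A := by
    obtain ⟨c, hc⟩ := exists_measure_image_eq_mul ν (mulVecHomeo M hM)
    have hc' (A : Set (Fin n → K)) : ν (M.mulVec '' A) = c * ν A := hc A
    intro A
    rw [hc', hc', hL, mul_one]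
  have hmul (M N : Matrix (Fin n) (Fin n) K) (A : Set (Fin n → K)) :
      (M * N).mulVec '' A = M.mulVec '' (N.mulVec '' A) := by
    simp [Set.image_image, Matrix.mulVec_mulVec]
  have hdiag (D : Fin n → K) (hD : (Matrix.diagonal D).det ≠ 0) (A : Set (Fin n → K)) :
      ν ((Matrix.diagonal D).mulVec '' A) =
        (Nat.card κ : ℝ≥0∞) ^ log (Valued.v (Matrix.diagonal D).det) * ν A := by
    have hD' : ∀ i, D i ≠ 0 := by simpa [Matrix.det_diagonal, Finset.prod_ne_zero_iff] using hD
    rw [hex _ hD]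
    congr 1
    have : (Matrix.diagonal D).mulVec '' lattice K n 0 =
        Set.univ.pi fun i => {x | Valued.v x ≤ exp (log (Valued.v (D i)))} := by
      have hexp (i) : exp (log (Valued.v (D i))) = Valued.v (D i) := exp_log (by simpa using hD' i)
      simp_rw [hexp]
      ext w
      simp only [Set.mem_image, Set.mem_pi, Set.mem_univ, true_imp_iff, Set.mem_ofPred_eq]
      constructor
      · rintro ⟨u, hu, rfl⟩ i
        rw [Matrix.mulVec_diagonal, map_mul]
        exact mul_le_of_le_one_right' (by simpa using hu i)
      · refine fun hw => ⟨fun i => (D i)⁻¹ * w i, fun i => ?_, ?_⟩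
        · rw [map_mul, map_inv₀, neg_zero, exp_zero]
          exact inv_mul_le_one_of_le₀ (hw i) zero_le
        · ext i
          rw [Matrix.mulVec_diagonal, mul_inv_cancel_left₀ (hD' i)]
    rw [this, hν, Measure.pi_pi]
    simp_rw [measure_le_exp hv hs μ hμ]
    rw [Matrix.det_diagonal]
    have key (t : Finset (Fin n)) : ∏ i ∈ t, (Nat.card κ : ℝ≥0∞) ^ log (Valued.v (D i)) =
        (Nat.card κ : ℝ≥0∞) ^ log (Valued.v (∏ i ∈ t, D i)) := by
      induction t using Finset.induction_on with
      | empty => simp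
      | insert i t hi ih =>
        rw [Finset.prod_insert hi, Finset.prod_insert hi, ih, map_mul, log_mul
          (by simpa using hD' i) (by simpa [Finset.prod_eq_zero_iff] using fun j _ => hD' j),
          ENNReal.zpow_add hq (by simp)]
    exact key _
  -- Gaussian elimination: the claim is multiplicative, so it remains to treat transvections, which
  -- must preserve the measure.
  refine Matrix.diagonal_transvection_induction_of_det_ne_zero
    (fun M => ∀ A, ν (M.mulVec '' A) = (Nat.card κ : ℝ≥0∞) ^ log (Valued.v M.det) * ν A)
    M hM hdiag ?_ ?_ A
  · rintro ⟨i, j, hij, c⟩ A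
    have hdt (c : K) : (Matrix.transvection i j c).det = 1 := Matrix.det_transvection_of_ne i j hij c
    rw [Matrix.TransvectionStruct.toMatrix_mk, hdt, map_one, log_one, zpow_zero, one_mul]
    -- A transvection with integral coefficient and its inverse preserve the unit lattice. The
    -- general coefficient `c` becomes integral after conjugation by a diagonal matrix with entry
    -- `a` at `i`.
    obtain ⟨a, ha0, hac⟩ : ∃ a : K, a ≠ 0 ∧ Valued.v (a * c) ≤ 1 := by
      rcases eq_or_ne c 0 with rfl | hc
      · exact ⟨1, one_ne_zero, by simp⟩
      · exact ⟨c⁻¹, inv_ne_zero hc, by simp [hc]⟩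
    have hint (c : K) (hc : Valued.v c ≤ 1) :
        (Matrix.transvection i j c).mulVec '' lattice K n 0 ⊆ lattice K n 0 := by
      rintro _ ⟨w, hw, rfl⟩
      refine mulVec_mem_lattice (fun k l => ?_) hw
      rw [Matrix.transvection, Matrix.add_apply, Matrix.one_apply, Matrix.single_apply]
      refine (Valued.v.map_add _ _).trans (max_le ?_ ?_) <;> split_ifs <;> simp [hc]
    have hint' : (Matrix.transvection i j (a * c)).mulVec '' lattice K n 0 = lattice K n 0 := by
      refine subset_antisymm (hint _ hac) ?_
      have := Set.image_mono (f := (Matrix.transvection i j (a * c)).mulVec)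
        (hint (-(a * c)) (by simpa using hac))
      rw [← hmul, Matrix.transvection_mul_transvection_same _ _ hij] at this
      simpa using this
    let D : Fin n → K := Function.update 1 i a
    have hDdet : (Matrix.diagonal D).det ≠ 0 := by
      rw [Matrix.det_diagonal, Finset.prod_ne_zero_iff]
      intro k _
      by_cases hk : k = i
      · subst hk; simpa [D] using ha0
      · simp [D, hk]
    have hcomm : Matrix.diagonal D * Matrix.transvection i j c =
        Matrix.transvection i j (a * c) * Matrix.diagonal D := by
      ext k l
      rw [Matrix.diagonal_mul, Matrix.mul_diagonal]
      simp only [Matrix.transvection, Matrix.add_apply, Matrix.one_apply, Matrix.single_apply, D,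
        Function.update_apply, Pi.one_apply]
      by_cases h : i = k ∧ j = l
      · obtain ⟨rfl, rfl⟩ := h
        simp [hij, hij.symm]
      · simp only [h, if_false, add_zero]
        by_cases hkl : k = l
        · simp [hkl]
        · simp [hkl]
    -- Both sides of the conjugation identity contain the scaling factor of the same diagonal
    -- matrix, which is nonzero and finite and cancels.
    have h1 := congrArg (fun N => ν (N.mulVec '' A)) hcomm
    simp only [hmul] at h1
    rw [hdiag D hDdet, hex (Matrix.transvection i j (a * c)) (by rw [hdt]; exact one_ne_zero),
      hint', hL, one_mul, hdiag D hDdet] at h1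
    exact (ENNReal.mul_right_inj (ENNReal.zpow_pos hq (by simp) _).ne'
      (ENNReal.zpow_ne_top hq (by simp) _)).1 h1
  · intro M N hM hN h1 h2 A
    rw [hmul, h1, h2, Matrix.det_mul, map_mul, log_mul (by simpa using hM) (by simpa using hN),
      ENNReal.zpow_add hq (by simp), mul_assoc]

end Scaling

end Tamagawa

namespace Tamagawa

/-! ### Local compactness of complete discretely valued fields -/

section LocallyCompact

open WithZero Filter Topology
open scoped WithZero

variable {K : Type*} [Field K] [Valued K ℤᵐ⁰]

/-- Expansion in powers of a uniformizer with digits among the representatives `s r`: the first k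
digits determine an integral element up to `exp (-k)`, and there are finitely many choices. -/
lemma exists_finite_net (hv : Function.Surjective (Valued.v : K → ℤᵐ⁰)) {κ : Type*} [Finite κ]
    {s : κ → K} (hs : IsResidueSystem s) (k : ℕ) :
    ∃ t : Set K, t.Finite ∧ ∀ x : K, Valued.v x ≤ 1 → ∃ y ∈ t, Valued.v (x - y) ≤ exp (-(k : ℤ)) := by
  obtain ⟨π, hπ⟩ := hv (exp (-1))
  have hπ0 : π ≠ 0 := Valued.v.ne_zero_iff.1 (by rw [hπ]; exact exp_ne_zero)
  have hπk (k : ℕ) : Valued.v (π ^ k) = exp (-(k : ℤ)) := by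
    rw [map_pow, hπ, ← exp_nsmul]; simp
  induction k with
  | zero => exact ⟨{0}, Set.finite_singleton _, fun x hx => ⟨0, rfl, by simpa using hx⟩⟩
  | succ k ih =>
    obtain ⟨t, ht, hcov⟩ := ih
    refine ⟨Set.image2 (fun y r => y + π ^ k * s r) t Set.univ, ht.image2 _ Set.finite_univ,
      fun x hx => ?_⟩
    obtain ⟨y, hy, hxy⟩ := hcov x hx
    have hz : Valued.v ((π ^ k)⁻¹ * (x - y)) ≤ 1 := by
      rw [map_mul, map_inv₀]
      exact inv_mul_le_one_of_le₀ (by rwa [hπk]) zero_le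
    obtain ⟨r, hr, -⟩ := hs.existsUnique _ hz
    refine ⟨_, Set.mem_image2_of_mem hy (Set.mem_univ r), ?_⟩
    have : x - (y + π ^ k * s r) = π ^ k * ((π ^ k)⁻¹ * (x - y) - s r) := by
      field_simp
      ring
    rw [this, map_mul, hπk]
    rw [lt_one_iff_le_exp] at hr
    refine (mul_le_mul_right hr _).trans ?_
    rw [← exp_add]
    refine exp_le_exp.2 ?_
    push_cast
    lia

lemma isClosed_le_one : IsClosed {x : K | Valued.v x ≤ 1} := Valued.isClosed_integer K

lemma isCompact_le_one [CompleteSpace K] (hv : Function.Surjective (Valued.v : K → ℤᵐ⁰))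
    {κ : Type*} [Finite κ] {s : κ → K} (hs : IsResidueSystem s) :
    IsCompact {x : K | Valued.v x ≤ 1} := by
  refine isCompact_iff_totallyBounded_isComplete.2 ⟨?_, isClosed_le_one.isComplete⟩
  rw [totallyBounded_iff_subset_finite_iUnion_nhds_zero]
  intro U hU
  obtain ⟨k, hk⟩ := (mem_nhds_iff_valued hv).1 hU
  obtain ⟨t, ht, hcov⟩ := exists_finite_net hv hs k.toNat
  refine ⟨t, ht, fun x hx => ?_⟩
  obtain ⟨y, hy, hxy⟩ := hcov x hx
  refine Set.mem_biUnion hy ⟨x - y, hk ?_, by simp⟩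
  simp only [sub_zero, Set.mem_ofPred_eq]
  exact hxy.trans (exp_le_exp.2 (neg_le_neg (Int.self_le_toNat k)))

lemma locallyCompactSpace_of_isResidueSystem [CompleteSpace K]
    (hv : Function.Surjective (Valued.v : K → ℤᵐ⁰))
    {κ : Type*} [Finite κ] {s : κ → K} (hs : IsResidueSystem s) : LocallyCompactSpace K := by
  refine (isCompact_le_one hv hs).locallyCompactSpace_of_mem_nhds_of_addGroup (x := 0) ?_
  exact (mem_nhds_iff_valued hv).2 ⟨0, by simp⟩

/-- The balls of radius `exp (-k)` make the uniformity countably generated, and the finite nets of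
the unit ball, divided by powers of a uniformizer, form a countable dense set. -/
lemma secondCountableTopology_of_isResidueSystem
    (hv : Function.Surjective (Valued.v : K → ℤᵐ⁰))
    {κ : Type*} [Finite κ] {s : κ → K} (hs : IsResidueSystem s) : SecondCountableTopology K := by
  have hcg : (𝓝 (0 : K)).IsCountablyGenerated := by
    refine Filter.HasBasis.isCountablyGenerated (p := fun _ : ℕ => True)
      (s := fun k : ℕ => {y : K | Valued.v y ≤ exp (-(k : ℤ))}) ⟨fun S => ?_⟩
    rw [mem_nhds_iff_valued hv]
    simp only [sub_zero, true_and]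
    refine ⟨fun ⟨k, hk⟩ => ⟨k.toNat, fun y hy => hk ?_⟩, fun ⟨k, hk⟩ => ⟨k, hk⟩⟩
    exact le_trans hy (exp_le_exp.2 (neg_le_neg (Int.self_le_toNat k)))
  have : (uniformity K).IsCountablyGenerated := IsUniformAddGroup.uniformity_countably_generated
  obtain ⟨π, hπ⟩ := hv (exp (-1))
  have hπ0 : π ≠ 0 := Valued.v.ne_zero_iff.1 (by rw [hπ]; exact exp_ne_zero)
  have hπk (k : ℕ) : Valued.v (π ^ k) = exp (-(k : ℤ)) := by
    rw [map_pow, hπ, ← exp_nsmul]; simp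
  choose t ht hcov using exists_finite_net hv hs
  have : TopologicalSpace.SeparableSpace K := by
    refine ⟨⋃ m : ℕ, ⋃ k : ℕ, (fun y => (π ^ m)⁻¹ * y) '' t k, ?_, ?_⟩
    · exact Set.countable_iUnion fun m => Set.countable_iUnion fun k => (ht k).countable.image _
    · refine dense_iff_inter_open.2 fun U hU ⟨x, hx⟩ => ?_
      obtain ⟨k, hk⟩ := (mem_nhds_iff_valued hv).1 (hU.mem_nhds hx)
      have hm : Valued.v (π ^ (log (Valued.v x)).toNat * x) ≤ 1 := by
        rw [map_mul, hπk]
        rcases eq_or_ne x 0 with rfl | hx0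
        · simp
        · rw [← exp_log (by simpa using hx0 : Valued.v x ≠ 0), ← exp_add, ← exp_zero, exp_le_exp,
            log_exp]
          have := Int.self_le_toNat (log (Valued.v x))
          lia
      set m := (log (Valued.v x)).toNat
      -- Division by `π ^ m` loses m digits, hence the net of level `m + k.toNat`.
      obtain ⟨y, hy, hxy⟩ := hcov (m + k.toNat) _ hm
      refine ⟨(π ^ m)⁻¹ * y, hk ?_, Set.mem_iUnion.2 ⟨m, Set.mem_iUnion.2 ⟨_, y, hy, rfl⟩⟩⟩
      have : (π ^ m)⁻¹ * y - x = -((π ^ m)⁻¹ * (π ^ m * x - y)) := by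
        field_simp
        ring
      simp only [Set.mem_ofPred_eq]
      rw [this, Valuation.map_neg, map_mul, map_inv₀, hπk]
      refine (mul_le_mul_right hxy _).trans ?_
      rw [← exp_neg, ← exp_add, exp_le_exp]
      have := Int.self_le_toNat k
      push_cast
      lia
  exact UniformSpace.secondCountable_of_separable K

end LocallyCompact

/-! ### The completion of a discrete valuation ring -/

section Completion

open WithZero Filter Topology HeightOneSpectrum
open scoped WithZero

variable (A : Type*) [CommRing A] [IsDomain A] [IsDiscreteValuationRing A]
  (K : Type*) [Field K] [Algebra A K] [IsFractionRing A K]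

local notation "𝔭" => IsDiscreteValuationRing.maximalIdeal A

lemma valued_algebraMap (x : K) :
    Valued.v (algebraMap K ((𝔭).adicCompletion K) x) = (𝔭).valuation K x :=
  valuedAdicCompletion_eq_valuation' _ x

/-- Approximation in two stages: first by an element of K, which is dense in the completion, then by
an element of A, since the approximation in K is again integral. -/
lemma exists_algebraMap_sub_lt_one (x : (𝔭).adicCompletion K) (hx : Valued.v x ≤ 1) :
    ∃ a : A, Valued.v (x - algebraMap A ((𝔭).adicCompletion K) a) < 1 := by
  have hO : IsOpen {y : (𝔭).adicCompletion K | Valued.v (y - x) < 1} := by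
    refine isOpen_iff_mem_nhds.2 fun z hz =>
      (mem_nhds_iff_valued (valuedAdicCompletion_surjective K 𝔭)).2 ⟨1, fun y hy => ?_⟩
    have := (Valued.v.map_add (y - z) (z - x)).trans_lt (max_lt (lt_one_iff_le_exp.2 hy) hz)
    simpa using this
  obtain ⟨y, hy⟩ := (denseRange_algebraMap (K := K) 𝔭).exists_mem_open hO ⟨x, by simp⟩
  have hy1 : Valued.v (algebraMap K ((𝔭).adicCompletion K) y) ≤ 1 := by
    have := (Valued.v.map_add (algebraMap K ((𝔭).adicCompletion K) y - x) x).trans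
      (max_le hy.le hx)
    simpa using this
  rw [valued_algebraMap] at hy1
  obtain ⟨a, ha⟩ := exists_valuation_sub_lt_of_integer 𝔭 hy1 1
  refine ⟨a, ?_⟩
  rw [← valued_algebraMap] at ha
  have h1 : x - algebraMap A ((𝔭).adicCompletion K) a =
      -((algebraMap K ((𝔭).adicCompletion K) y - x) +
        algebraMap K ((𝔭).adicCompletion K) (algebraMap A K a - y)) := by
    rw [map_sub, ← IsScalarTower.algebraMap_apply]
    ring
  rw [h1, Valuation.map_neg]
  exact (Valued.v.map_add _ _).trans_lt (max_lt hy ha)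

/-- An element of value `exp (-1)` generates the maximal ideal, so the powers of this ideal are
balls. This translates congruences, the output of the étale lifting lemmas, into distances. -/
lemma mem_maximalIdeal_pow_iff (k : ℕ) (x : (𝔭).adicCompletionIntegers K) :
    x ∈ IsLocalRing.maximalIdeal ((𝔭).adicCompletionIntegers K) ^ k ↔
      Valued.v (x : (𝔭).adicCompletion K) ≤ exp (-(k : ℤ)) := by
  have hv := valuedAdicCompletion_surjective K 𝔭
  obtain ⟨π, hπ⟩ := hv (exp (-1))
  have hπ0 : π ≠ 0 := Valued.v.ne_zero_iff.1 (by rw [hπ]; exact exp_ne_zero)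
  have hπk (k : ℕ) : Valued.v (π ^ k) = exp (-(k : ℤ)) := by
    rw [map_pow, hπ, ← exp_nsmul]; simp
  have hπ1 : Valued.v π ≤ 1 := by rw [hπ, ← exp_zero]; exact exp_le_exp.2 (by simp)
  let ϖ : (𝔭).adicCompletionIntegers K := ⟨π, hπ1⟩
  have hmem (x : (𝔭).adicCompletionIntegers K) :
      x ∈ IsLocalRing.maximalIdeal ((𝔭).adicCompletionIntegers K) ↔ Valued.v x.1 < 1 := by
    rw [IsLocalRing.mem_maximalIdeal, mem_nonunits_iff,
      adicCompletionIntegers.isUnit_iff_valued_eq_one, lt_iff_le_and_ne]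
    exact ⟨fun h => ⟨x.2, h⟩, fun h => h.2⟩
  have hdvd (k : ℕ) (x : (𝔭).adicCompletionIntegers K) :
      ϖ ^ k ∣ x ↔ Valued.v x.1 ≤ exp (-(k : ℤ)) := by
    rw [← hπk]
    constructor
    · rintro ⟨y, rfl⟩
      change Valued.v (π ^ k * y.1) ≤ _
      rw [map_mul]
      exact mul_le_of_le_one_right' y.2
    · intro h
      refine ⟨⟨(π ^ k)⁻¹ * x.1, ?_⟩, ?_⟩
      · rw [mem_adicCompletionIntegers, map_mul, map_inv₀]
        exact inv_mul_le_one_of_le₀ h zero_le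
      · refine Subtype.ext ?_
        change x.1 = π ^ k * ((π ^ k)⁻¹ * x.1)
        field_simp
  have hspan : IsLocalRing.maximalIdeal ((𝔭).adicCompletionIntegers K) = Ideal.span {ϖ} := by
    ext x
    rw [hmem, Ideal.mem_span_singleton, ← pow_one ϖ, hdvd, lt_one_iff_le_exp]
    simp
  rw [hspan, Ideal.span_singleton_pow, Ideal.mem_span_singleton, hdvd]

lemma mem_maximalIdeal_iff_lt_one (x : (𝔭).adicCompletionIntegers K) :
    x ∈ IsLocalRing.maximalIdeal ((𝔭).adicCompletionIntegers K) ↔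
      Valued.v (x : (𝔭).adicCompletion K) < 1 := by
  rw [← pow_one (IsLocalRing.maximalIdeal _), mem_maximalIdeal_pow_iff, lt_one_iff_le_exp]
  simp

/-- The valuation topology on the ring of integers is the adic topology of its maximal ideal, and
this ring is closed in a complete field. Completeness is what makes lifting along étale coordinates
possible. -/
instance isAdicComplete_integers :
    IsAdicComplete (IsLocalRing.maximalIdeal ((𝔭).adicCompletionIntegers K))
      ((𝔭).adicCompletionIntegers K) := by
  have hv := valuedAdicCompletion_surjective K 𝔭
  have : IsUniformAddGroup ((𝔭).adicCompletionIntegers K) :=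
    ((𝔭).adicCompletionIntegers K).toSubring.toAddSubgroup.isUniformAddGroup
  have : IsTopologicalRing ((𝔭).adicCompletionIntegers K) :=
    inferInstanceAs (IsTopologicalRing ((𝔭).adicCompletionIntegers K).toSubring)
  refine (IsAdic.isAdicComplete_iff (isAdic_iff.2 ⟨fun k => ?_, fun s hs => ?_⟩)).2
    ⟨?_, inferInstance⟩
  · have : ((IsLocalRing.maximalIdeal ((𝔭).adicCompletionIntegers K) ^ k :
        Ideal _) : Set ((𝔭).adicCompletionIntegers K)) =
        Subtype.val ⁻¹' {x : (𝔭).adicCompletion K | Valued.v x ≤ exp (-(k : ℤ))} := by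
      ext x
      exact mem_maximalIdeal_pow_iff A K k x
    rw [this]
    refine IsOpen.preimage continuous_subtype_val ?_
    refine isOpen_iff_mem_nhds.2 fun z hz => (mem_nhds_iff_valued hv).2 ⟨k, fun y hy => ?_⟩
    have := (Valued.v.map_add (y - z) z).trans (max_le hy hz)
    simpa using this
  · obtain ⟨u, hu, hus⟩ := mem_nhds_subtype _ _ _ |>.1 hs
    obtain ⟨k, hk⟩ := (mem_nhds_iff_valued hv).1 hu
    refine ⟨k.toNat, fun x hx => hus (hk ?_)⟩
    have := (mem_maximalIdeal_pow_iff A K _ x).1 hx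
    refine le_trans (by simpa using this) (exp_le_exp.2 (neg_le_neg (Int.self_le_toNat k)))
  · exact (isClosed_le_one (K := (𝔭).adicCompletion K)).completeSpace_coe

instance isLocalHom_algebraMap_integers :
    IsLocalHom (algebraMap A ((𝔭).adicCompletionIntegers K)) := by
  refine ⟨fun a ha => ?_⟩
  by_contra hna
  rw [adicCompletionIntegers.isUnit_iff_valued_eq_one] at ha
  have h1 : Valued.v (algebraMap A ((𝔭).adicCompletionIntegers K) a : (𝔭).adicCompletion K) =
      (𝔭).valuation K (algebraMap A K a) := valuedAdicCompletion_eq_valuation' _ _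
  rw [h1] at ha
  exact (((𝔭).valuation_lt_one_iff_mem a).2 hna).ne ha

lemma residueFieldMap_integers_bijective :
    Function.Bijective
      (IsLocalRing.ResidueField.map (algebraMap A ((𝔭).adicCompletionIntegers K))) := by
  refine ⟨RingHom.injective _, fun y => ?_⟩
  obtain ⟨x, rfl⟩ := IsLocalRing.residue_surjective y
  obtain ⟨a, ha⟩ := exists_algebraMap_sub_lt_one A K x.1 x.2
  refine ⟨IsLocalRing.residue A a, ?_⟩
  rw [IsLocalRing.ResidueField.map_residue, eq_comm, ← sub_eq_zero, ← map_sub,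
    IsLocalRing.residue_eq_zero_iff, mem_maximalIdeal_iff_lt_one]
  exact ha

/-- The reduction map of the completion of a discrete valuation ring. -/
def completionReduction : (𝔭).adicCompletionIntegers K →+* IsLocalRing.ResidueField A :=
  (RingEquiv.ofBijective _ (residueFieldMap_integers_bijective A K)).symm.toRingHom.comp
    (IsLocalRing.residue _)

lemma completionReduction_algebraMap (a : A) :
    completionReduction A K (algebraMap A _ a) = IsLocalRing.residue A a := by
  simp only [completionReduction, RingEquiv.toRingHom_eq_coe, RingHom.coe_comp, RingHom.coe_coe,
    Function.comp_apply]
  rw [RingEquiv.symm_apply_eq]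
  rfl

lemma completionReduction_eq_zero_iff (x : (𝔭).adicCompletionIntegers K) :
    completionReduction A K x = 0 ↔ Valued.v (x : (𝔭).adicCompletion K) < 1 := by
  rw [← mem_maximalIdeal_iff_lt_one, ← IsLocalRing.residue_eq_zero_iff]
  simp [completionReduction]

/-- Being congruent to the representative of r modulo the maximal ideal means having reduction r, so
exactly one representative fits. -/
lemma isResidueSystem_completion :
    IsResidueSystem fun r : IsLocalRing.ResidueField A =>
      algebraMap A ((𝔭).adicCompletion K) (Function.surjInv (IsLocalRing.residue_surjective) r) where
  le_one r := coe_algebraMap_mem A K 𝔭 _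
  existsUnique x hx := by
    have key (r) : Valued.v (x - algebraMap A ((𝔭).adicCompletion K)
        (Function.surjInv (IsLocalRing.residue_surjective) r)) < 1 ↔
          completionReduction A K ⟨x, hx⟩ = r := by
      conv_rhs => rw [← Function.surjInv_eq IsLocalRing.residue_surjective r,
        ← completionReduction_algebraMap A K, ← sub_eq_zero, ← map_sub,
        completionReduction_eq_zero_iff]
      rfl
    exact ⟨_, (key _).2 rfl, fun r hr => ((key r).1 hr).symm⟩

end Completion

end Tamagawa

namespace Tamagawa

/-! ### The local fields attached to the places of a curve over a finite field -/

section Place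

open WithZero
open scoped WithZero

/-- The inclusion of a closed point is a closed immersion, so its residue field is a k-algebra of
finite type, hence a finite extension of k by Zariski's lemma. -/
lemma finite_residueField (k : Type u) [Field k] [Finite k] (C : Scheme.{u})
    [C.Over (Spec (.of k))] [LocallyOfFiniteType (C ↘ Spec (.of k))] (p : Place C) :
    Finite (C.residueField p.1) := by
  have : IsClosedImmersion (C.fromSpecResidueField p.1) :=
    .of_isPreimmersion _ (by rw [Scheme.range_fromSpecResidueField]; exact p.2)
  obtain ⟨ψ, hψ⟩ := Spec.map_surjective (C.fromSpecResidueField p.1 ≫ (C ↘ Spec (.of k)))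
  have h1 : LocallyOfFiniteType (Spec.map ψ) := by rw [hψ]; infer_instance
  have h2 : ψ.hom.FiniteType := (HasRingHomProperty.Spec_iff (P := @LocallyOfFiniteType)).1 h1
  algebraize [ψ.hom]
  have : Module.Finite k (C.residueField p.1) := finite_of_finite_type_of_isJacobsonRing _ _
  exact Module.finite_of_finite k

lemma Place.card_pos {C : Scheme.{u}} (p : Place C) [Finite (C.residueField p.1)] :
    0 < p.card :=
  Nat.card_pos

variable {C : Scheme.{u}} [IsIntegral C] [IsNonsingularCurve C] (p : Place C)

lemma Place.valued_surjective : Function.Surjective (Valued.v : p.completion → ℤᵐ⁰) :=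
  HeightOneSpectrum.valuedAdicCompletion_surjective _ _

/-- The reduction map from `O_p` to the residue field of `C` at `p`. -/
def Place.reduction : p.integers →+* C.residueField p.1 :=
  completionReduction (C.presheaf.stalk p.1) C.functionField

lemma Place.reduction_algebraMap (a : C.presheaf.stalk p.1) :
    p.reduction (algebraMap _ p.integers a) = C.residue p.1 a :=
  completionReduction_algebraMap _ _ a

lemma Place.reduction_eq_zero_iff (x : p.integers) :
    p.reduction x = 0 ↔ Valued.v (x : p.completion) < 1 :=
  completionReduction_eq_zero_iff _ _ x

lemma Place.reduction_surjective : Function.Surjective p.reduction := fun r => by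
  obtain ⟨a, rfl⟩ := C.residue_surjective p.1 r
  exact ⟨_, p.reduction_algebraMap a⟩

instance : IsLocalHom p.reduction := by
  refine ⟨fun x hx => ?_⟩
  rw [HeightOneSpectrum.adicCompletionIntegers.isUnit_iff_valued_eq_one]
  refine le_antisymm x.2 (not_lt.1 fun h => ?_)
  rw [(p.reduction_eq_zero_iff x).2 h] at hx
  exact not_isUnit_zero hx

lemma Place.exists_isResidueSystem :
    ∃ s : C.residueField p.1 → p.completion, IsResidueSystem s :=
  ⟨_, isResidueSystem_completion (C.presheaf.stalk p.1) C.functionField⟩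

lemma Place.abs_eq {x : p.completion} (hx : x ≠ 0) : p.abs x = (p.card : ℝ) ^ log (Valued.v x) :=
  if_neg hx

lemma Place.abs_eq_one {x : p.completion} (hx : Valued.v x = 1) : p.abs x = 1 := by
  rw [p.abs_eq (by rintro rfl; simp at hx), hx, log_one, zpow_zero]

variable [Finite (C.residueField p.1)]

lemma Place.ofReal_abs {x : p.completion} (hx : x ≠ 0) :
    ENNReal.ofReal (p.abs x) = (p.card : ℝ≥0∞) ^ log (Valued.v x) := by
  have h := p.card_pos
  rw [p.abs_eq hx, show (p.card : ℝ) = ((p.card : NNReal) : ℝ) by simp, ← NNReal.coe_zpow,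
    ENNReal.ofReal_coe_nnreal, ENNReal.coe_zpow (by simpa using h.ne')]
  simp

lemma Place.abs_mul (x y : p.completion) : p.abs (x * y) = p.abs x * p.abs y := by
  rcases eq_or_ne x 0 with rfl | hx
  · simp [Place.abs]
  rcases eq_or_ne y 0 with rfl | hy
  · simp [Place.abs]
  have h : (p.card : ℝ) ≠ 0 := by exact_mod_cast p.card_pos.ne'
  rw [p.abs_eq hx, p.abs_eq hy, p.abs_eq (mul_ne_zero hx hy), map_mul, log_mul (by simpa using hx)
    (by simpa using hy), zpow_add₀ h]

instance : LocallyCompactSpace p.completion :=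
  locallyCompactSpace_of_isResidueSystem p.valued_surjective p.exists_isResidueSystem.choose_spec

instance : SecondCountableTopology p.completion :=
  secondCountableTopology_of_isResidueSystem p.valued_surjective
    p.exists_isResidueSystem.choose_spec

/-- O_p is compact with nonempty interior, so Haar measure can be normalized on it; the default
value 0 in `Place.haar` therefore does not occur when the residue field is finite. -/
lemma Place.exists_haar : ∃ μ : Measure p.completion,
    μ.IsAddHaarMeasure ∧ μ (p.integers : Set p.completion) = 1 := by
  let K₀ : TopologicalSpace.PositiveCompacts p.completion :=
    ⟨⟨(p.integers : Set p.completion),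
      isCompact_le_one p.valued_surjective p.exists_isResidueSystem.choose_spec⟩,
      ⟨0, mem_interior_iff_mem_nhds.2 ((mem_nhds_iff_valued p.valued_surjective).2
        ⟨0, fun x hx => by
          change Valued.v x ≤ 1
          simpa using hx⟩)⟩⟩
  exact ⟨Measure.addHaarMeasure K₀, inferInstance, Measure.addHaarMeasure_self⟩

instance : p.haar.IsAddHaarMeasure := by
  rw [Place.haar, dif_pos p.exists_haar]
  exact p.exists_haar.choose_spec.1

lemma Place.haar_integers : p.haar {x | Valued.v x ≤ 1} = 1 := by
  rw [Place.haar, dif_pos p.exists_haar]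
  exact p.exists_haar.choose_spec.2

/-- The Haar measure on `F_p ^ n`. -/
abbrev Place.haarPi (n : ℕ) : Measure (Fin n → p.completion) := Measure.pi fun _ => p.haar

lemma Place.haarPi_lattice (n : ℕ) (k : ℤ) :
    p.haarPi n (lattice p.completion n k) = ((p.card : ℝ≥0∞) ^ (-k)) ^ n :=
  measure_lattice p.valued_surjective p.exists_isResidueSystem.choose_spec _ p.haar_integers k

lemma Place.haarPi_image_mulVec {n : ℕ} (J : Matrix (Fin n) (Fin n) p.completion)
    (hJ : J.det ≠ 0) (A : Set (Fin n → p.completion)) :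
    p.haarPi n (J.mulVec '' A) = ENNReal.ofReal (p.abs J.det) * p.haarPi n A := by
  rw [p.ofReal_abs hJ]
  exact measure_image_mulVec p.valued_surjective p.exists_isResidueSystem.choose_spec _
    p.haar_integers J hJ A

end Place

end Tamagawa

namespace Tamagawa

/-! ### Étale coordinates -/

section Etale

variable {n : ℕ} {R A O κ : Type*} [CommRing R] [CommRing A] [CommRing O] [CommRing κ]

/-- Points of an algebra with étale coordinates lift along the reduction of a complete ring, with
prescribed coordinates. -/
lemma exists_lift_of_etale (φ : MvPolynomial (Fin n) R →+* A) (hφ : φ.Etale)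
    (ψ : R →+* O) (θ : O →+* κ) (hθ : Function.Surjective θ)
    [IsAdicComplete (RingHom.ker θ) O] (a : Fin n → O) (g : A →+* κ)
    (hg : ∀ r, g (φ (MvPolynomial.C r)) = θ (ψ r))
    (hga : ∀ j, g (φ (MvPolynomial.X j)) = θ (a j)) :
    ∃ P : A →+* O, (∀ r, P (φ (MvPolynomial.C r)) = ψ r) ∧
      (∀ j, P (φ (MvPolynomial.X j)) = a j) ∧ ∀ t, θ (P t) = g t := by
  let S := MvPolynomial (Fin n) R
  algebraize [φ, MvPolynomial.eval₂Hom ψ a]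
  let e : O ⧸ RingHom.ker θ ≃+* κ := RingHom.quotientKerEquivOfSurjective hθ
  have hcomm : g.comp φ = θ.comp (MvPolynomial.eval₂Hom ψ a) :=
    MvPolynomial.ringHom_ext (fun r => by simp [hg]) (fun j => by simp [hga])
  let f : A →ₐ[S] O ⧸ RingHom.ker θ :=
    { e.symm.toRingHom.comp g with
      commutes' := fun s => by
        change e.symm (g (φ s)) = Ideal.Quotient.mk _ (MvPolynomial.eval₂Hom ψ a s)
        rw [RingEquiv.symm_apply_eq]
        exact RingHom.congr_fun hcomm s }
  -- The polynomial ring acts on `O` through `ψ` and `X j ↦ a j`. A lift that is linear over it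
  -- automatically has the prescribed constants and coordinates.
  obtain ⟨P, hP⟩ := Algebra.FormallySmooth.exists_mkₐ_comp_eq_of_isAdicComplete f
  have hPφ (s : S) : P (φ s) = MvPolynomial.eval₂Hom ψ a s := P.commutes s
  refine ⟨P.toRingHom, fun r => ?_, fun j => ?_, fun t => ?_⟩
  · exact (hPφ _).trans (by simp)
  · exact (hPφ _).trans (by simp)
  · have := congrArg e (DFunLike.congr_fun hP t)
    exact this.trans (e.apply_symm_apply (g t))

/-- Two points of an algebra with étale coordinates that have the same reduction are as close as
their coordinates are. -/
lemma sub_mem_pow_of_etale (φ : MvPolynomial (Fin n) R →+* A) (hφ : φ.Etale) (I : Ideal O)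
    (P Q : A →+* O) (hPQ : ∀ t, P t - Q t ∈ I)
    (hC : ∀ r, P (φ (MvPolynomial.C r)) = Q (φ (MvPolynomial.C r))) {k : ℕ}
    (hX : ∀ j, P (φ (MvPolynomial.X j)) - Q (φ (MvPolynomial.X j)) ∈ I ^ k) (t : A) :
    P t - Q t ∈ I ^ k := by
  let S := MvPolynomial (Fin n) R
  let π : O →+* O ⧸ I ^ k := Ideal.Quotient.mk _
  algebraize [φ, π.comp (P.comp φ)]
  have hcomm : (π.comp Q).comp φ = π.comp (P.comp φ) := by
    refine MvPolynomial.ringHom_ext (fun r => by simp [hC]) (fun j => ?_)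
    exact ((Ideal.Quotient.mk_eq_mk_iff_sub_mem _ _).2 (hX j)).symm
  let P' : A →ₐ[S] O ⧸ I ^ k := { π.comp P with commutes' := fun _ => rfl }
  let Q' : A →ₐ[S] O ⧸ I ^ k := { π.comp Q with commutes' := RingHom.congr_fun hcomm }
  -- The two homomorphisms to `O ⧸ I ^ k` agree on the polynomial ring and differ by elements of a
  -- nilpotent ideal; formal unramifiedness leaves only one such homomorphism.
  have : P' = Q' := by
    refine Algebra.FormallyUnramified.ext (I.map π) ⟨k, ?_⟩ fun x => ?_
    · rw [← Ideal.map_pow]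
      exact Ideal.map_quotient_self _
    · rw [Ideal.Quotient.mk_eq_mk_iff_sub_mem]
      change π (P x) - π (Q x) ∈ _
      rw [← map_sub]
      exact Ideal.mem_map_of_mem _ (hPQ x)
  exact (Ideal.Quotient.mk_eq_mk_iff_sub_mem _ _).1 (DFunLike.congr_fun this t)

end Etale

/-! ### Differentials of étale coordinates -/

section Kaehler

open scoped TensorProduct

variable {n : ℕ} (R F B : Type*) [CommRing R] [CommRing F] [CommRing B]
  [Algebra R F] [Algebra F B] [Algebra R B] [IsScalarTower R F B] [Algebra.FormallyUnramified R F]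

/-- If `F` is unramified over `R`, then differentials over `F` and over `R` are the same. -/
lemma kaehlerMap_bijective : Function.Bijective (KaehlerDifferential.map R F B B) := by
  refine ⟨?_, KaehlerDifferential.map_surjective R F B⟩
  rw [← LinearMap.ker_eq_bot, eq_bot_iff]
  intro x hx
  obtain ⟨y, rfl⟩ := (KaehlerDifferential.exact_mapBaseChange_map R F B x).1 hx
  -- The kernel comes from the differentials of `F` over `R`, which vanish.
  rw [Subsingleton.elim y 0, map_zero]
  exact zero_mem _

/-- The differentials of étale coordinates form a basis. -/
lemma exists_basis_kaehlerDifferential [Algebra (MvPolynomial (Fin n) R) B]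
    [IsScalarTower R (MvPolynomial (Fin n) R) B]
    [Algebra.FormallyEtale (MvPolynomial (Fin n) R) B] :
    ∃ b : Module.Basis (Fin n) B (KaehlerDifferential F B), ∀ j, b j =
      KaehlerDifferential.D F B (algebraMap (MvPolynomial (Fin n) R) B (MvPolynomial.X j)) := by
  let S := MvPolynomial (Fin n) R
  let b₀ := ((KaehlerDifferential.mvPolynomialBasis R (Fin n)).baseChange B).map
    (KaehlerDifferential.tensorKaehlerEquivOfFormallyEtale R S B)
  refine ⟨b₀.map (LinearEquiv.ofBijective _ (kaehlerMap_bijective R F B)), fun j => ?_⟩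
  have h (x : B ⊗[S] KaehlerDifferential R S) :
      KaehlerDifferential.tensorKaehlerEquivOfFormallyEtale R S B x =
        KaehlerDifferential.mapBaseChange R S B x := rfl
  simp [b₀, S, h]

end Kaehler

end Tamagawa

namespace Tamagawa

/-! ### Points with values in local rings -/

section EvalAt

open IsLocalRing

variable {X Y : Scheme.{u}} {R : CommRingCat.{u}} [IsLocalRing R]

/-- The value at a point with values in a local ring of the functions on an open set that contains
the image of the closed point. -/
def evalAt (f : Spec R ⟶ X) (U : X.Opens) (h : f (closedPoint R) ∈ U) : Γ(X, U) ⟶ R :=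
  X.presheaf.germ U _ h ≫ Scheme.stalkClosedPointTo f

lemma SpecMap_evalAt (f : Spec R ⟶ X) {U : X.Opens} (hU : IsAffineOpen U)
    (h : f (closedPoint R) ∈ U) : Spec.map (evalAt f U h) ≫ hU.fromSpec = f := by
  rw [evalAt, Spec.map_comp, Category.assoc]
  change _ ≫ hU.fromSpecStalk h = _
  rw [hU.fromSpecStalk_eq_fromSpecStalk, Scheme.Spec_stalkClosedPointTo_fromSpecStalk]

lemma closedPoint_mem_of_eq {f : Spec R ⟶ X} {U : X.Opens} (hU : IsAffineOpen U)
    {g : Γ(X, U) ⟶ R} (hf : f = Spec.map g ≫ hU.fromSpec) : f (closedPoint R) ∈ U := by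
  subst hf
  have h : hU.fromSpec (Spec.map g (closedPoint R)) ∈ (U : Set X) :=
    hU.range_fromSpec ▸ Set.mem_range_self _
  exact h

lemma eq_evalAt {f : Spec R ⟶ X} {U : X.Opens} (hU : IsAffineOpen U)
    {g : Γ(X, U) ⟶ R} (hf : f = Spec.map g ≫ hU.fromSpec) (h : f (closedPoint R) ∈ U) :
    evalAt f U h = g := by
  apply Spec.map_injective
  rw [← cancel_mono hU.fromSpec, SpecMap_evalAt, hf]

lemma evalAt_comp (f : Spec R ⟶ X) (g : X ⟶ Y) (U : Y.Opens)
    (h : (f ≫ g) (closedPoint R) ∈ U) (h' : f (closedPoint R) ∈ g ⁻¹ᵁ U) :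
    evalAt (f ≫ g) U h = g.app U ≫ evalAt f (g ⁻¹ᵁ U) h' := by
  rw [evalAt, evalAt, Scheme.stalkClosedPointTo_comp]
  exact Scheme.Hom.germ_stalkMap_assoc g U _ h' _

lemma evalAt_appLE (f : Spec R ⟶ X) (g : X ⟶ Y) {U : X.Opens} {W : Y.Opens} (e : U ≤ g ⁻¹ᵁ W)
    (h : f (closedPoint R) ∈ U) (h' : (f ≫ g) (closedPoint R) ∈ W) :
    g.appLE W U e ≫ evalAt f U h = evalAt (f ≫ g) W h' := by
  rw [evalAt_comp f g W h' (e h), Scheme.Hom.appLE, Category.assoc, evalAt, evalAt,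
    X.presheaf.germ_res_assoc]

lemma evalAt_SpecMap {R' : CommRingCat.{u}} [IsLocalRing R'] (ψ : R ⟶ R') (f : Spec R ⟶ X)
    {U : X.Opens} (hU : IsAffineOpen U) (h : f (closedPoint R) ∈ U)
    (h' : (Spec.map ψ ≫ f) (closedPoint R') ∈ U) :
    evalAt (Spec.map ψ ≫ f) U h' = evalAt f U h ≫ ψ :=
  eq_evalAt hU (by rw [Spec.map_comp, Category.assoc, SpecMap_evalAt]) h'

lemma mem_of_SpecMap {R' : CommRingCat.{u}} [IsLocalRing R'] (ψ : R ⟶ R') (f : Spec R ⟶ X)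
    {U : X.Opens} (h : f (closedPoint R) ∈ U) :
    (Spec.map ψ ≫ f) (closedPoint R') ∈ U := by
  have h' : Spec.map ψ (closedPoint R') ∈ f ⁻¹ᵁ U :=
    Scheme.preimage_eq_top_of_closedPoint_mem f h ▸ trivial
  exact h'

lemma evalAt_basicOpen (f : Spec R ⟶ X) {U : X.Opens} (h : f (closedPoint R) ∈ U) (s : Γ(X, U)) :
    f (closedPoint R) ∈ X.basicOpen s ↔ IsUnit (evalAt f U h s) := by
  refine (X.mem_basicOpen s (f (closedPoint R)) h).trans ?_
  exact (isUnit_map_iff (Scheme.stalkClosedPointTo f).hom _).symm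

end EvalAt

/-! ### Extension of local points to integral points of a model -/

section Model

open IsLocalRing

variable {C : Scheme.{u}} [IsIntegral C] [IsNonsingularCurve C] (p : Place C)

/-- The homomorphism from the local ring of the curve at a place to the ring of integers of the
completion. -/
def Place.stalkHom : C.presheaf.stalk p.1 ⟶ .of p.integers :=
  CommRingCat.ofHom (algebraMap (C.presheaf.stalk p.1) p.integers)

instance : IsLocalHom p.stalkHom.hom :=
  isLocalHom_algebraMap_integers (C.presheaf.stalk p.1) C.functionField

lemma Place.specIntegers_def : p.specIntegers = Spec.map p.stalkHom ≫ C.fromSpecStalk p.1 := rfl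

lemma Place.specIntegers_eq {W : C.Opens} (hW : IsAffineOpen W) (hp : p.1 ∈ W) :
    p.specIntegers = Spec.map (C.presheaf.germ W p.1 hp ≫ p.stalkHom) ≫ hW.fromSpec := by
  rw [Place.specIntegers_def, Spec.map_comp, Category.assoc, ← hW.fromSpecStalk_eq_fromSpecStalk hp]
  rfl

lemma Place.specIntegers_closedPoint : p.specIntegers (closedPoint p.integers) = p.1 := by
  exact (congrArg (C.fromSpecStalk p.1) (Spec_closedPoint (f := p.stalkHom))).trans
    Scheme.fromSpecStalk_closedPoint

/-- The reduction map as a morphism of schemes. -/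
def Place.specReduction : Spec (C.residueField p.1) ⟶ Spec (.of p.integers) :=
  Spec.map (CommRingCat.ofHom p.reduction)

lemma Place.specReduction_specIntegers :
    p.specReduction ≫ p.specIntegers = C.fromSpecResidueField p.1 := by
  have h : p.stalkHom ≫ CommRingCat.ofHom p.reduction = C.residue p.1 := by
    ext a
    exact p.reduction_algebraMap a
  rw [Scheme.fromSpecResidueField, ← h, Spec.map_comp, Category.assoc]
  rfl

lemma Place.specCompletion_specIntegers :
    p.specCompletion ≫ p.specIntegers =
      Spec.map (CommRingCat.ofHom (algebraMap C.functionField p.completion)) ≫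
        C.fromSpecStalk (genericPoint C) := by
  rw [Place.specCompletion, Place.specIntegers, ← Scheme.SpecMap_stalkSpecializes_fromSpecStalk
    ((genericPoint_spec C).specializes (Set.mem_univ p.1)), ← Spec.map_comp_assoc,
    ← Spec.map_comp_assoc]
  congr 2

variable {V : Scheme.{u}} [V.Over (Spec C.functionField)] {p}

/-- The structure morphism of a model over the curve. -/
abbrev Model.toCurve (M : Model C V) : M.space ⟶ C := M.proj ≫ M.base.ι

lemma LocalPoints.incl_toCurve (M : Model C V) (x : LocalPoints V p) :
    (x.1 ≫ M.incl) ≫ M.proj ≫ M.base.ι = p.specCompletion ≫ p.specIntegers := by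
  rw [Category.assoc, M.isPullback.w, ← Category.assoc, x.2, p.specCompletion_specIntegers]

/-- This is the existence part of the valuative criterion for the proper morphism `M.proj`. -/
lemma Model.exists_extends (M : Model C V) (hp : p.1 ∈ M.base) (x : LocalPoints V p) :
    ∃ xt, M.Extends x xt := by
  -- An open set that contains the image of the closed point of a local scheme contains the image of
  -- the whole scheme.
  have hrange : Set.range p.specIntegers ⊆ Set.range M.base.ι := by
    have := Scheme.preimage_eq_top_of_closedPoint_mem p.specIntegers (U := M.base)
      (by erw [p.specIntegers_closedPoint]; exact hp)
    rw [Scheme.Opens.range_ι]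
    rintro _ ⟨z, rfl⟩
    have hz : z ∈ p.specIntegers ⁻¹ᵁ M.base := this ▸ trivial
    exact hz
  let i₂ := IsOpenImmersion.lift M.base.ι p.specIntegers hrange
  have hi₂ : i₂ ≫ M.base.ι = p.specIntegers := IsOpenImmersion.lift_fac _ _ _
  have hsq : CommSq (x.1 ≫ M.incl)
      (Spec.map (CommRingCat.ofHom (algebraMap p.integers p.completion))) M.proj i₂ := by
    refine ⟨?_⟩
    rw [← cancel_mono M.base.ι]
    refine (LocalPoints.incl_toCurve M x).trans ?_
    rw [← hi₂]
    rfl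
  have hvc : ValuativeCriterion.Existence M.proj := by
    have := M.isProper
    have h : ValuativeCriterion M.proj := by
      rw [IsProper.eq_valuativeCriterion] at this
      exact this.1.1.1
    exact h.existence
  obtain ⟨⟨l⟩⟩ := hvc ⟨p.integers, p.completion, _, i₂, hsq⟩
  refine ⟨l.l, ?_, l.fac_left⟩
  rw [← hi₂, ← Category.assoc]
  exact congrArg (· ≫ M.base.ι) l.fac_right

/-- Uniqueness in the valuative criterion, from separatedness; it makes the reduction of a local
point well defined. -/
lemma Model.extends_unique (M : Model C V) (x : LocalPoints V p)
    {xt xt' : Spec (.of p.integers) ⟶ M.space} (h : M.Extends x xt) (h' : M.Extends x xt') :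
    xt = xt' := by
  have := M.isProper
  have hsq : CommSq (x.1 ≫ M.incl)
      (Spec.map (CommRingCat.ofHom (algebraMap p.integers p.completion)))
      M.proj (xt ≫ M.proj) := ⟨by rw [← Category.assoc]; exact congrArg (· ≫ M.proj) h.2.symm⟩
  have hsub := IsSeparated.valuativeCriterion M.proj ⟨p.integers, p.completion, _, _, hsq⟩
  have heq : xt' ≫ M.proj = xt ≫ M.proj := by
    rw [← cancel_mono M.base.ι, Category.assoc, Category.assoc, h.1, h'.1]
  exact congrArg CommSq.LiftStruct.l
    (hsub.elim ⟨xt, h.2, rfl⟩ ⟨xt', h'.2, heq⟩)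

lemma Model.exists_point (M : Model C V) (xt : Spec (.of p.integers) ⟶ M.space)
    (h : xt ≫ M.toCurve = p.specIntegers) : ∃ x : LocalPoints V p, M.Extends x xt := by
  have hw : (p.specCompletion ≫ xt) ≫ M.toCurve =
      Spec.map (CommRingCat.ofHom (algebraMap C.functionField p.completion)) ≫
        C.fromSpecStalk (genericPoint C) := by
    rw [Category.assoc, h, p.specCompletion_specIntegers]
  exact ⟨⟨M.isPullback.lift _ _ hw, M.isPullback.lift_snd _ _ hw⟩, h,
    (M.isPullback.lift_fst _ _ hw).symm⟩

lemma Model.point_unique (M : Model C V) {x x' : LocalPoints V p}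
    (h : x.1 ≫ M.incl = x'.1 ≫ M.incl) : x = x' :=
  Subtype.ext (M.isPullback.hom_ext h (x.2.trans x'.2.symm))

end Model

end Tamagawa

namespace Tamagawa

/-! ### The inclusion of the generic fibre -/

lemma exists_opens_germ_eq {X : Scheme.{u}} {U₁ U₂ : X.Opens} {v : X} (h₁ : v ∈ U₁) (h₂ : v ∈ U₂)
    {f : Γ(X, U₁)} {g : Γ(X, U₂)} (h : X.presheaf.germ U₁ v h₁ f = X.presheaf.germ U₂ v h₂ g) :
    ∃ N : X.Opens, v ∈ N ∧ N ≤ U₁ ∧ N ≤ U₂ ∧ ∀ w (hw₁ : w ∈ U₁) (hw₂ : w ∈ U₂), w ∈ N →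
      X.presheaf.germ U₁ w hw₁ f = X.presheaf.germ U₂ w hw₂ g := by
  obtain ⟨N, hv, i₁, i₂, e⟩ := X.presheaf.germ_eq v h₁ h₂ f g h
  refine ⟨N, hv, i₁.le, i₂.le, fun w hw₁ hw₂ hw => ?_⟩
  rw [← X.presheaf.germ_res_apply i₁ w hw, ← X.presheaf.germ_res_apply i₂ w hw, e]

lemma res_app_germ {X Y : Scheme.{u}} (g : X ⟶ Y) (N : Y.Opens) (v : X) (hv : v ∈ g ⁻¹ᵁ N) :
    Y.presheaf.map (homOfLE (le_top : N ≤ ⊤)).op ≫ g.app N ≫ X.presheaf.germ (g ⁻¹ᵁ N) v hv =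
      g.appTop ≫ X.presheaf.germ ⊤ v trivial := by
  rw [← Category.assoc, Scheme.Hom.naturality, Category.assoc]
  exact congrArg _ (X.presheaf.germ_res _ _ _)

section Incl

variable {C : Scheme.{u}} [IsIntegral C] {V : Scheme.{u}} [V.Over (Spec C.functionField)]
  (M : Model C V)

instance flat_fromSpecStalk (X : Scheme.{u}) (x : X) : Flat (X.fromSpecStalk x) := by
  obtain ⟨U, hU, hx, -⟩ := exists_isAffineOpen_mem_and_subset (U := ⊤) (x := x) trivial
  rw [← hU.fromSpecStalk_eq_fromSpecStalk hx, IsAffineOpen.fromSpecStalk]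
  have : Flat (Spec.map (X.presheaf.germ U x hx)) := by
    rw [Flat.SpecMap_iff]
    algebraize [(X.presheaf.germ U x hx).hom]
    have := hU.isLocalization_stalk ⟨x, hx⟩
    exact IsLocalization.flat _ (hU.primeIdealOf ⟨x, hx⟩).asIdeal.primeCompl
  infer_instance

instance : IsPreimmersion M.incl :=
  MorphismProperty.of_isPullback (P := @IsPreimmersion) M.isPullback.flip inferInstance

instance : Flat M.incl :=
  MorphismProperty.of_isPullback (P := @Flat) M.isPullback.flip inferInstance

/-- The inclusion of the generic fibre is a base change of the spectrum of a local ring of C, so it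
is a flat preimmersion. Its stalk maps are surjective, and injective because a flat local
homomorphism is faithfully flat. -/
lemma Model.stalkMap_bijective (v : V) : Function.Bijective (M.incl.stalkMap v).hom := by
  refine ⟨?_, M.incl.stalkMap_surjective v⟩
  have h := Flat.stalkMap M.incl v
  algebraize [(M.incl.stalkMap v).hom]
  have : IsLocalHom (algebraMap (M.space.presheaf.stalk (M.incl v)) (V.presheaf.stalk v)) :=
    inferInstanceAs (IsLocalHom (M.incl.stalkMap v).hom)
  have := Module.FaithfullyFlat.of_flat_of_isLocalHom
    (A := M.space.presheaf.stalk (M.incl v)) (B := V.presheaf.stalk v)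
  exact FaithfulSMul.algebraMap_injective _ _

instance (v : V) : IsIso (M.incl.stalkMap v) :=
  (ConcreteCategory.isIso_iff_bijective _).2 (M.stalkMap_bijective v)

lemma Model.exists_opens (v : V) {N : V.Opens} (hv : v ∈ N) :
    ∃ N' : M.space.Opens, M.incl v ∈ N' ∧ M.incl ⁻¹ᵁ N' ≤ N := by
  obtain ⟨t, ht, hts⟩ := (M.incl.isEmbedding.isInducing.isOpen_iff).1 N.2
  exact ⟨⟨t, ht⟩, by change v ∈ M.incl ⁻¹' t; rw [hts]; exact hv, fun w hw => by
    change w ∈ M.incl ⁻¹' t at hw; rw [hts] at hw; exact hw⟩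

lemma Model.exists_basicOpen {U : M.space.Opens} (hU : IsAffineOpen U) (v : V)
    (hv : v ∈ M.incl ⁻¹ᵁ U) {N : V.Opens} (hN : v ∈ N) :
    ∃ s : Γ(M.space, U), M.incl v ∈ M.space.basicOpen s ∧
      M.incl ⁻¹ᵁ (M.space.basicOpen s) ≤ N := by
  obtain ⟨N', h1, h2⟩ := M.exists_opens v hN
  obtain ⟨s, hs, hs'⟩ := hU.exists_basicOpen_le ⟨M.incl v, h1⟩ hv
  exact ⟨s, hs', (M.incl.preimage_mono hs).trans h2⟩

/-- Locally, a function on the generic fibre is a fraction of functions on the model. -/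
lemma Model.exists_fraction {U : M.space.Opens} (hU : IsAffineOpen U) (v : V)
    (hv : v ∈ M.incl ⁻¹ᵁ U) (N : V.Opens) (hN : v ∈ N) (f : Γ(V, N)) :
    ∃ a s : Γ(M.space, U), M.incl v ∈ M.space.basicOpen s ∧
      M.incl ⁻¹ᵁ (M.space.basicOpen s) ≤ N ∧
      ∀ (w : V) (hw : w ∈ N) (hw' : w ∈ M.incl ⁻¹ᵁ U), w ∈ M.incl ⁻¹ᵁ (M.space.basicOpen s) →
        V.presheaf.germ N w hw f * V.presheaf.germ _ w hw' (M.incl.app U s) =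
          V.presheaf.germ _ w hw' (M.incl.app U a) := by
  obtain ⟨t, ht⟩ := M.incl.stalkMap_surjective v (V.presheaf.germ N v hN f)
  let := (M.space.presheaf.germ U (M.incl v) hv).hom.toAlgebra
  have := hU.isLocalization_stalk ⟨M.incl v, hv⟩
  obtain ⟨⟨a, s⟩, hs⟩ := IsLocalization.surj
    (hU.primeIdealOf ⟨M.incl v, hv⟩).asIdeal.primeCompl t
  have hs' := congrArg (M.incl.stalkMap v) hs
  have hgerm (x) : M.incl.stalkMap v (algebraMap Γ(M.space, U)
      (M.space.presheaf.stalk (M.incl v)) x) = V.presheaf.germ _ v hv (M.incl.app U x) :=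
    Scheme.Hom.germ_stalkMap_apply M.incl U v hv x
  rw [map_mul, ht, hgerm, hgerm] at hs'
  let N₁ : V.Opens := N ⊓ M.incl ⁻¹ᵁ U
  have hs₀ : M.incl v ∈ M.space.basicOpen s.1 := by
    rw [M.space.mem_basicOpen _ _ hv]
    exact IsLocalization.map_units (M.space.presheaf.stalk (M.incl v)) s
  let f₁ : Γ(V, N₁) := V.presheaf.map (homOfLE inf_le_left).op f *
    V.presheaf.map (homOfLE inf_le_right).op (M.incl.app U s.1)
  have hf₁ (w : V) (hw : w ∈ N₁) : V.presheaf.germ N₁ w hw f₁ =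
      V.presheaf.germ N w hw.1 f * V.presheaf.germ _ w hw.2 (M.incl.app U s.1) := by
    rw [map_mul, V.presheaf.germ_res_apply, V.presheaf.germ_res_apply]
  obtain ⟨N₂, hv₂, hle, -, hN₂⟩ := exists_opens_germ_eq (X := V) (U₁ := N₁) (f := f₁) ⟨hN, hv⟩ hv
    ((hf₁ v ⟨hN, hv⟩).trans hs')
  -- The identity of germs at `v` holds only near `v`. Multiplying numerator and denominator by `s₁`
  -- shrinks the basic open set into that neighbourhood.
  obtain ⟨s₁, hs₁, hs₁'⟩ := M.exists_basicOpen hU v hv hv₂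
  have hb : M.incl ⁻¹ᵁ (M.space.basicOpen (s.1 * s₁)) ≤ N₂ := by
    rw [Scheme.basicOpen_mul]
    exact (M.incl.preimage_mono inf_le_right).trans hs₁'
  refine ⟨a * s₁, s.1 * s₁, ?_, hb.trans (hle.trans inf_le_left), fun w hw hw' hw'' => ?_⟩
  · rw [Scheme.basicOpen_mul]
    exact ⟨hs₀, hs₁⟩
  · rw [map_mul, map_mul, map_mul, map_mul, ← mul_assoc, ← hf₁ w ⟨hw, hw'⟩,
      hN₂ w ⟨hw, hw'⟩ hw' (hb hw'')]

end Incl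

/-! ### Étale coordinates on a model -/

/-- Differentials of étale coordinates form a basis of the differentials of the local ring. -/
lemma exists_basis_of_etale {R A F B : Type u} [CommRing R] [CommRing A] [CommRing F] [CommRing B]
    [Algebra F B] {n : ℕ} (φ : MvPolynomial (Fin n) R →+* A) (hφ : φ.Etale) (ι : A →+* B)
    (hι : ι.FormallyEtale) (ρ : R →+* F) (hρ : ρ.FormallyUnramified)
    (h : ∀ r, ι (φ (MvPolynomial.C r)) = algebraMap F B (ρ r)) :
    ∃ b : Module.Basis (Fin n) B (KaehlerDifferential F B), ∀ j, b j =
      KaehlerDifferential.D F B (ι (φ (MvPolynomial.X j))) := by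
  have hφ' : φ.FormallyEtale := by algebraize [φ]; exact inferInstanceAs (Algebra.FormallyEtale _ _)
  have hc := hφ'.comp hι
  algebraize [φ, ι, ρ, ι.comp φ, (algebraMap F B).comp ρ]
  have : IsScalarTower R (MvPolynomial (Fin n) R) B := .of_algebraMap_eq fun r => (h r).symm
  exact exists_basis_kaehlerDifferential R F B

section CoordSystem

variable {C : Scheme.{u}} [IsIntegral C] {V : Scheme.{u}} [V.Over (Spec C.functionField)]

/-- Étale coordinates on an affine open subset of a model, over an affine open subset
of the curve. -/
structure CoordSystem (M : Model C V) (n : ℕ) where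
  /-- The affine open subset of the model. -/
  U : M.space.Opens
  isAffineOpen_U : IsAffineOpen U
  /-- The affine open subset of the curve. -/
  W : C.Opens
  isAffineOpen_W : IsAffineOpen W
  le : U ≤ M.toCurve ⁻¹ᵁ W
  /-- The étale homomorphism given by the coordinates. -/
  hom : MvPolynomial (Fin n) Γ(C, W) →+* Γ(M.space, U)
  etale : hom.Etale
  hom_C : ∀ r, hom (MvPolynomial.C r) = M.toCurve.appLE W U le r

variable {M : Model C V} {n : ℕ}

lemma Model.toCurve_incl (v : V) : M.toCurve (M.incl v) = genericPoint C := by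
  have h : M.toCurve (M.incl v) = C.fromSpecStalk (genericPoint C) ((V ↘ Spec C.functionField) v) :=
    congrArg (fun f : V ⟶ C => f v) M.isPullback.w
  have : Subsingleton (Spec C.functionField) :=
    inferInstanceAs (Subsingleton (PrimeSpectrum C.functionField))
  rw [h, Subsingleton.elim ((V ↘ Spec C.functionField) v) (IsLocalRing.closedPoint C.functionField)]
  exact Scheme.fromSpecStalk_closedPoint

/-- Commutativity of the generic fibre square, read on functions: functions on C act on the stalks
of V through the function field. -/
lemma Model.appLE_incl_germ (M : Model C V) {U : M.space.Opens} {W : C.Opens}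
    (le : U ≤ M.toCurve ⁻¹ᵁ W) (v : V) (hv : v ∈ M.incl ⁻¹ᵁ U) (hη : genericPoint C ∈ W) :
    M.toCurve.appLE W U le ≫ M.incl.app U ≫ V.presheaf.germ _ v hv =
      C.presheaf.germ W (genericPoint C) hη ≫ (Scheme.ΓSpecIso C.functionField).inv ≫
        (V ↘ Spec C.functionField).appTop ≫ V.presheaf.germ ⊤ v trivial := by
  have e : M.incl ⁻¹ᵁ U ≤ (M.incl ≫ M.toCurve) ⁻¹ᵁ W := fun w hw => le hw
  have h : M.toCurve.appLE W U le ≫ M.incl.app U = (M.incl ≫ M.toCurve).appLE W _ e := by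
    rw [Scheme.Hom.app_eq_appLE, Scheme.Hom.appLE_comp_appLE]
  have key (g : V ⟶ C) (hg : g = (V ↘ Spec C.functionField) ≫ C.fromSpecStalk (genericPoint C))
      (e : M.incl ⁻¹ᵁ U ≤ g ⁻¹ᵁ W) : g.appLE W _ e ≫ V.presheaf.germ _ v hv =
      C.presheaf.germ W (genericPoint C) hη ≫ (Scheme.ΓSpecIso C.functionField).inv ≫
        (V ↘ Spec C.functionField).appTop ≫ V.presheaf.germ ⊤ v trivial := by
    subst hg
    rw [Scheme.Hom.appLE, Category.assoc, V.presheaf.germ_res, Scheme.Hom.comp_app]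
    refine (Category.assoc _ _ _).trans ?_
    rw [Scheme.fromSpecStalk_app hη, Category.assoc, Category.assoc]
    congr 2
    exact res_app_germ _ _ _ _
  rw [← Category.assoc, h, key _ M.isPullback.w]

/-- The coordinates, as functions on the generic fibre. -/
def CoordSystem.coord (Φ : CoordSystem M n) (j : Fin n) : Γ(V, M.incl ⁻¹ᵁ Φ.U) :=
  M.incl.app Φ.U (Φ.hom (MvPolynomial.X j))

/-- Restriction of a system of coordinates to a basic open set. -/
def CoordSystem.basicOpen (Φ : CoordSystem M n) (s : Γ(M.space, Φ.U)) : CoordSystem M n where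
  U := M.space.basicOpen s
  isAffineOpen_U := Φ.isAffineOpen_U.basicOpen s
  W := Φ.W
  isAffineOpen_W := Φ.isAffineOpen_W
  le := (M.space.basicOpen_le s).trans Φ.le
  hom := (M.space.presheaf.map (homOfLE (M.space.basicOpen_le s)).op).hom.comp Φ.hom
  etale := by
    refine RingHom.Etale.stableUnderComposition _ _ Φ.etale ?_
    have := Φ.isAffineOpen_U.isLocalization_basicOpen s
    exact Algebra.Etale.of_isLocalizationAway s
  hom_C r := by
    rw [RingHom.comp_apply, Φ.hom_C]
    exact ConcreteCategory.congr_hom (M.toCurve.appLE_map Φ.le (homOfLE (M.space.basicOpen_le s)).op) r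

lemma formallyEtale_germ {X : Scheme.{u}} {U : X.Opens} (hU : IsAffineOpen U) {x : X} (hx : x ∈ U) :
    (X.presheaf.germ U x hx).hom.FormallyEtale := by
  algebraize [(X.presheaf.germ U x hx).hom]
  have := hU.isLocalization_stalk ⟨x, hx⟩
  exact Algebra.FormallyEtale.of_isLocalization (hU.primeIdealOf ⟨x, hx⟩).asIdeal.primeCompl

lemma formallyUnramified_germ {X : Scheme.{u}} {U : X.Opens} (hU : IsAffineOpen U) {x : X}
    (hx : x ∈ U) : (X.presheaf.germ U x hx).hom.FormallyUnramified := by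
  have := formallyEtale_germ hU hx
  algebraize [(X.presheaf.germ U x hx).hom]
  exact inferInstanceAs (Algebra.FormallyUnramified _ _)

/-- The stalk of V is a stalk of the model, hence a localization of an algebra étale over the
polynomial ring. The function field is a localization of the functions on `Φ.W`, so it contributes
no differentials. -/
lemma CoordSystem.exists_basis (Φ : CoordSystem M n) (v : V) (hv : v ∈ M.incl ⁻¹ᵁ Φ.U) :
    ∃ b : Module.Basis (Fin n) (V.presheaf.stalk v)
      (KaehlerDifferential C.functionField (V.presheaf.stalk v)), ∀ j, b j =
        KaehlerDifferential.D C.functionField (V.presheaf.stalk v)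
          (V.presheaf.germ _ v hv (Φ.coord j)) := by
  have hη : genericPoint C ∈ Φ.W := M.toCurve_incl v ▸ Φ.le hv
  refine exists_basis_of_etale (R := Γ(C, Φ.W)) (A := Γ(M.space, Φ.U)) Φ.hom Φ.etale
    (M.incl.app Φ.U ≫ V.presheaf.germ _ v hv).hom ?_
    (C.presheaf.germ Φ.W (genericPoint C) hη).hom ?_ ?_
  · rw [← Scheme.Hom.germ_stalkMap M.incl Φ.U v hv]
    exact (formallyEtale_germ Φ.isAffineOpen_U hv).comp
      (RingHom.Etale.of_bijective (M.stalkMap_bijective v)).formallyEtale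
  · exact formallyUnramified_germ Φ.isAffineOpen_W hη
  · intro r
    rw [Φ.hom_C]
    exact ConcreteCategory.congr_hom (M.appLE_incl_germ Φ.le v hv hη) r

/-- `Model` does not record a relative dimension. This basis is what fixes the number of étale
coordinates on a model near the generic fibre. -/
lemma exists_basis_of_smoothOfRelativeDimension
    [SmoothOfRelativeDimension n (V ↘ Spec C.functionField)] (v : V) :
    Nonempty (Module.Basis (Fin n) (V.presheaf.stalk v)
      (KaehlerDifferential C.functionField (V.presheaf.stalk v))) := by
  obtain ⟨U, hU, V', hV', hv, e, h⟩ :=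
    SmoothOfRelativeDimension.exists_isStandardSmoothOfRelativeDimension (n := n)
      (f := V ↘ Spec C.functionField) v
  obtain ⟨φ, hφ, hφ'⟩ := h.exists_etale_mvPolynomial
  have : Subsingleton (Spec C.functionField) :=
    inferInstanceAs (Subsingleton (PrimeSpectrum C.functionField))
  obtain rfl : U = ⊤ := by
    ext x
    simpa [Subsingleton.elim x ((V ↘ Spec C.functionField) v)] using e hv
  obtain ⟨b, -⟩ := exists_basis_of_etale (F := C.functionField) φ hφ' (V.presheaf.germ V' v hv).hom
    (formallyEtale_germ hV' hv) (Scheme.ΓSpecIso C.functionField).hom.hom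
    (.of_surjective (ConcreteCategory.bijective_of_isIso
      (Scheme.ΓSpecIso C.functionField).hom).2) fun r => by
      have := RingHom.congr_fun hφ r
      rw [RingHom.comp_apply] at this
      rw [this]
      change (Scheme.Hom.appLE _ _ _ _ ≫ V.presheaf.germ V' v hv) r =
        ((Scheme.ΓSpecIso C.functionField).hom ≫ (Scheme.ΓSpecIso C.functionField).inv ≫
          (V ↘ Spec C.functionField).appTop ≫ V.presheaf.germ ⊤ v trivial) r
      rw [Iso.hom_inv_id_assoc, Scheme.Hom.appLE, Category.assoc, V.presheaf.germ_res]
      rfl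
  exact ⟨b⟩

/-- Every point of the generic fibre has a neighbourhood in the model with étale coordinates,
as many as the dimension of the generic fibre. -/
lemma CoordSystem.exists [SmoothOfRelativeDimension n (V ↘ Spec C.functionField)] (M : Model C V)
    (v : V) : ∃ Φ : CoordSystem M n, M.incl v ∈ Φ.U := by
  have := M.smooth
  obtain ⟨W, hW, U, hU, hv, e, h⟩ := Smooth.exists_isStandardSmooth M.toCurve (M.incl v)
  obtain ⟨d, φ, hφ, hφ'⟩ := h.exists_etale_mvPolynomial
  let Φ : CoordSystem M d := ⟨U, hU, W, hW, e, φ, hφ', RingHom.congr_fun hφ⟩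
  obtain ⟨b, -⟩ := Φ.exists_basis v hv
  obtain ⟨b'⟩ := exists_basis_of_smoothOfRelativeDimension (C := C) (n := n) v
  -- The differentials at `v` have a basis of size `d` from the model and one of size `n` from V.
  obtain rfl : d = n := by
    simpa using Fintype.card_congr (b.indexEquiv b')
  exact ⟨Φ, hv⟩

end CoordSystem

end Tamagawa

namespace Tamagawa

/-! ### Residue disks -/

section Disk

open IsLocalRing

variable {C : Scheme.{u}} [IsIntegral C] {p : Place C}
  {V : Scheme.{u}} [V.Over (Spec C.functionField)] {M : Model C V} {n : ℕ}

/-- The point of the special fibre underlying a point with values in the residue field. -/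
def Model.ResiduePoints.pt (y : M.ResiduePoints p) : M.space :=
  y.1 (closedPoint (C.residueField p.1))

lemma Model.ResiduePoints.toCurve_pt (y : M.ResiduePoints p) : M.toCurve y.pt = p.1 := by
  have h : M.toCurve y.pt = C.fromSpecResidueField p.1 (closedPoint (C.residueField p.1)) :=
    congrArg (fun f : Spec (C.residueField p.1) ⟶ C => f (closedPoint (C.residueField p.1))) y.2
  rw [h]
  exact C.fromSpecResidueField_apply p.1 _

/-- The homomorphism of evaluation at a point with values in the residue field. -/
def Model.ResiduePoints.hom (y : M.ResiduePoints p) {U : M.space.Opens} (hy : y.pt ∈ U) :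
    Γ(M.space, U) →+* C.residueField p.1 :=
  (evalAt y.1 U hy).hom

lemma Model.ResiduePoints.hom_appLE (y : M.ResiduePoints p) {U : M.space.Opens} (hy : y.pt ∈ U)
    {W : C.Opens} (le : U ≤ M.toCurve ⁻¹ᵁ W) (hp : p.1 ∈ W) (hW : IsAffineOpen W) (r : Γ(C, W)) :
    y.hom hy (M.toCurve.appLE W U le r) = C.residue p.1 (C.presheaf.germ W p.1 hp r) := by
  have h := evalAt_appLE y.1 M.toCurve le hy (le hy)
  refine (ConcreteCategory.congr_hom h r).trans ?_
  have h2 : y.1 ≫ M.toCurve =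
      Spec.map (C.presheaf.germ W p.1 hp ≫ C.residue p.1) ≫ hW.fromSpec := by
    refine y.2.trans ?_
    rw [Scheme.fromSpecResidueField, Spec.map_comp, Category.assoc,
      ← hW.fromSpecStalk_eq_fromSpecStalk hp]
    rfl
  exact ConcreteCategory.congr_hom (eq_evalAt hW h2 _) r

/-- The functions on `Φ.U` are finitely generated over those on `Φ.W`. Stated with subrings, this
reduces to finitely many functions both the equality of two residue points and the condition of
lying in a given disk. -/
lemma CoordSystem.exists_finset (Φ : CoordSystem M n) : ∃ S : Finset Γ(M.space, Φ.U),
    ∀ D : Subring Γ(M.space, Φ.U), (∀ r, M.toCurve.appLE Φ.W Φ.U Φ.le r ∈ D) →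
      (∀ s ∈ S, s ∈ D) → ∀ t, t ∈ D := by
  have h1 : (Φ.hom.comp MvPolynomial.C).FiniteType := by
    refine RingHom.FiniteType.comp ?_ ?_
    · have := Φ.etale
      algebraize [Φ.hom]
      exact inferInstanceAs (Algebra.FiniteType _ _)
    · exact RingHom.finiteType_algebraMap.2 inferInstance
  algebraize [Φ.hom.comp MvPolynomial.C]
  obtain ⟨S, hS⟩ := (inferInstance : Algebra.FiniteType Γ(C, Φ.W) Γ(M.space, Φ.U)).out
  refine ⟨S, fun D hC hD t => ?_⟩
  have ht : t ∈ Algebra.adjoin Γ(C, Φ.W) (S : Set Γ(M.space, Φ.U)) := hS ▸ trivial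
  induction ht using Algebra.adjoin_induction with
  | mem x hx => exact hD x hx
  | algebraMap r => exact (Φ.hom_C r).symm ▸ hC r
  | add x y _ _ hx hy => exact D.add_mem hx hy
  | mul x y _ _ hx hy => exact D.mul_mem hx hy

/-- A residue point in `Φ.U` is determined by its values on a finite set of generators, and these
lie in a finite field. -/
lemma CoordSystem.finite_setOf_pt_mem [Finite (C.residueField p.1)] (Φ : CoordSystem M n) :
    {y : M.ResiduePoints p | y.pt ∈ Φ.U}.Finite := by
  obtain ⟨S, hS⟩ := Φ.exists_finset
  rw [Set.finite_def]
  refine ⟨@Fintype.ofFinite _ (Finite.of_injective (β := S → C.residueField p.1)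
    (fun y s => y.1.hom y.2 s.1) fun y y' h => ?_)⟩
  have hp : p.1 ∈ Φ.W := y.1.toCurve_pt ▸ Φ.le y.2
  have h (t) : t ∈ (y.1.hom y.2).eqLocus (y'.1.hom y'.2) := by
    refine hS _ (fun r => ?_) (fun s hs => congrFun h ⟨s, hs⟩) t
    exact (y.1.hom_appLE y.2 Φ.le hp Φ.isAffineOpen_W r).trans
      (y'.1.hom_appLE y'.2 Φ.le hp Φ.isAffineOpen_W r).symm
  refine Subtype.ext (Subtype.ext ?_)
  rw [← SpecMap_evalAt y.1.1 Φ.isAffineOpen_U y.2, ← SpecMap_evalAt y'.1.1 Φ.isAffineOpen_U y'.2]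
  congr 2
  exact CommRingCat.hom_ext (RingHom.ext h)

variable [IsNonsingularCurve C]

/-- The set of points of `V(F_p)` whose reduction is the given point of the model. -/
def Model.disk (M : Model C V) (y : M.ResiduePoints p) : Set (LocalPoints V p) :=
  {x | ∃ xt, M.Extends x xt ∧ p.specReduction ≫ xt = y.1}

/-- The value at a local point of functions on a model. -/
def Model.valHom (M : Model C V) (x : LocalPoints V p) {U : M.space.Opens}
    (hx : x.pt ∈ M.incl ⁻¹ᵁ U) : Γ(M.space, U) →+* p.completion :=
  (M.incl.app U ≫ evalAt x.1 (M.incl ⁻¹ᵁ U) hx).hom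

lemma Model.valHom_eq_evalAt (x : LocalPoints V p) {U : M.space.Opens}
    (hx : x.pt ∈ M.incl ⁻¹ᵁ U) : M.valHom x hx = (evalAt (x.1 ≫ M.incl) U hx).hom := by
  rw [evalAt_comp x.1 M.incl U hx hx]
  rfl

lemma Model.valHom_appLE (x : LocalPoints V p) {U : M.space.Opens}
    (hx : x.pt ∈ M.incl ⁻¹ᵁ U) {W : C.Opens} (le : U ≤ M.toCurve ⁻¹ᵁ W) (hp : p.1 ∈ W)
    (hW : IsAffineOpen W) (r : Γ(C, W)) :
    M.valHom x hx (M.toCurve.appLE W U le r) =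
      (p.stalkHom (C.presheaf.germ W p.1 hp r) : p.integers) := by
  rw [Model.valHom_eq_evalAt]
  have h := evalAt_appLE (x.1 ≫ M.incl) M.toCurve le hx (le hx)
  refine (ConcreteCategory.congr_hom h r).trans ?_
  have h2 : (x.1 ≫ M.incl) ≫ M.toCurve = Spec.map ((C.presheaf.germ W p.1 hp ≫ p.stalkHom) ≫
      CommRingCat.ofHom (algebraMap p.integers p.completion)) ≫ hW.fromSpec := by
    refine (LocalPoints.incl_toCurve M x).trans ?_
    rw [p.specIntegers_eq hW hp, Spec.map_comp (C.presheaf.germ W p.1 hp ≫ p.stalkHom),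
      Category.assoc]
    rfl
  exact ConcreteCategory.congr_hom (eq_evalAt hW h2 _) r

lemma Place.specReduction_closedPoint :
    p.specReduction (closedPoint (C.residueField p.1)) = closedPoint p.integers :=
  have : IsLocalHom (CommRingCat.ofHom p.reduction).hom :=
    inferInstanceAs (IsLocalHom p.reduction)
  Spec_closedPoint (f := CommRingCat.ofHom p.reduction)

/-- Points of the residue disk give homomorphisms to the ring of integers. -/
lemma Model.exists_hom_of_mem_disk {y : M.ResiduePoints p} {x : LocalPoints V p}
    (h : x ∈ M.disk y) {U : M.space.Opens} (hU : IsAffineOpen U) (hy : y.pt ∈ U) :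
    ∃ hx : x.pt ∈ M.incl ⁻¹ᵁ U, ∃ P : Γ(M.space, U) →+* p.integers,
      (∀ t, M.valHom x hx t = P t) ∧ ∀ t, p.reduction (P t) = y.hom hy t := by
  obtain ⟨xt, ⟨-, hxt⟩, hred⟩ := h
  have hcl : xt (closedPoint p.integers) ∈ U := by
    have : xt (closedPoint p.integers) = y.pt := by
      rw [← p.specReduction_closedPoint]
      exact congrArg (fun f : Spec (C.residueField p.1) ⟶ M.space =>
        f (closedPoint (C.residueField p.1))) hred
    rwa [this]
  have hx : (p.specCompletion ≫ xt) (closedPoint p.completion) ∈ U :=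
    mem_of_SpecMap (CommRingCat.ofHom (algebraMap p.integers p.completion)) xt hcl
  have hx' : x.pt ∈ M.incl ⁻¹ᵁ U := by
    rw [hxt] at hx
    exact hx
  refine ⟨hx', (evalAt xt U hcl).hom, fun t => ?_, fun t => ?_⟩
  · rw [Model.valHom_eq_evalAt]
    have := evalAt_SpecMap (CommRingCat.ofHom (algebraMap p.integers p.completion)) xt hU hcl hx
    have h2 : evalAt (x.1 ≫ M.incl) U hx' = evalAt (p.specCompletion ≫ xt) U hx := by
      congr 1
      exact hxt.symm
    rw [h2]
    exact ConcreteCategory.congr_hom this t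
  · have hy' : (p.specReduction ≫ xt) (closedPoint (C.residueField p.1)) ∈ U := by
      rw [hred]; exact hy
    have := evalAt_SpecMap (CommRingCat.ofHom p.reduction) xt hU hcl hy'
    have h2 : evalAt y.1 U hy = evalAt (p.specReduction ≫ xt) U hy' := by
      congr 1
      exact hred.symm
    change _ = (evalAt y.1 U hy).hom t
    rw [h2]
    exact (ConcreteCategory.congr_hom this t).symm

lemma Model.extends_of_hom {U : M.space.Opens} (hU : IsAffineOpen U) {W : C.Opens}
    (le : U ≤ M.toCurve ⁻¹ᵁ W) (hp : p.1 ∈ W) (hW : IsAffineOpen W)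
    (P : Γ(M.space, U) →+* p.integers)
    (hP : ∀ r, P (M.toCurve.appLE W U le r) = p.stalkHom (C.presheaf.germ W p.1 hp r)) :
    (Spec.map (CommRingCat.ofHom P) ≫ hU.fromSpec) ≫ M.toCurve = p.specIntegers := by
  have h : M.toCurve.appLE W U le ≫ CommRingCat.ofHom P =
      C.presheaf.germ W p.1 hp ≫ p.stalkHom :=
    CommRingCat.hom_ext (RingHom.ext hP)
  rw [p.specIntegers_eq hW hp, ← h, Spec.map_comp, Category.assoc, Category.assoc,
    IsAffineOpen.SpecMap_appLE_fromSpec _ hW hU]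

/-- A homomorphism to the ring of integers gives a point of the residue disk. -/
lemma Model.exists_mem_disk {y : M.ResiduePoints p} {U : M.space.Opens} (hU : IsAffineOpen U)
    (hy : y.pt ∈ U) {W : C.Opens}
    (le : U ≤ M.toCurve ⁻¹ᵁ W) (hp : p.1 ∈ W) (hW : IsAffineOpen W)
    (P : Γ(M.space, U) →+* p.integers)
    (hP : ∀ r, P (M.toCurve.appLE W U le r) = p.stalkHom (C.presheaf.germ W p.1 hp r))
    (hred : ∀ t, p.reduction (P t) = y.hom hy t) :
    ∃ x ∈ M.disk y, ∃ hx : x.pt ∈ M.incl ⁻¹ᵁ U, ∀ t, M.valHom x hx t = P t := by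
  obtain ⟨x, hx⟩ := M.exists_point _ (M.extends_of_hom hU le hp hW P hP)
  have hd : x ∈ M.disk y := by
    refine ⟨_, hx, ?_⟩
    have h : CommRingCat.ofHom P ≫ CommRingCat.ofHom p.reduction = evalAt y.1 U hy := by
      ext t
      exact hred t
    rw [← SpecMap_evalAt y.1 hU hy, ← h, Spec.map_comp, Category.assoc]
    rfl
  refine ⟨x, hd, ?_⟩
  have h : x.1 ≫ M.incl = Spec.map (CommRingCat.ofHom P ≫
      CommRingCat.ofHom (algebraMap p.integers p.completion)) ≫ hU.fromSpec := by
    rw [← hx.2, Spec.map_comp, Category.assoc]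
    rfl
  have hx' : x.pt ∈ M.incl ⁻¹ᵁ U := closedPoint_mem_of_eq (f := x.1 ≫ M.incl) hU h
  refine ⟨hx', fun t => ?_⟩
  rw [Model.valHom_eq_evalAt]
  exact ConcreteCategory.congr_hom (eq_evalAt hU h hx') t

lemma Model.eq_of_valHom_eq {U : M.space.Opens} (hU : IsAffineOpen U) {x x' : LocalPoints V p}
    (hx : x.pt ∈ M.incl ⁻¹ᵁ U) (hx' : x'.pt ∈ M.incl ⁻¹ᵁ U)
    (h : ∀ t, M.valHom x hx t = M.valHom x' hx' t) : x = x' := by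
  refine M.point_unique ?_
  rw [← SpecMap_evalAt (x.1 ≫ M.incl) hU hx, ← SpecMap_evalAt (x'.1 ≫ M.incl) hU hx']
  congr 2
  refine CommRingCat.hom_ext (RingHom.ext fun t => ?_)
  have := h t
  rwa [Model.valHom_eq_evalAt, Model.valHom_eq_evalAt] at this

/-- O_p embeds in F_p, so the integral values of functions at x form a ring homomorphism. It defines
a point of the disk with the same values as x, which is therefore x. -/
lemma Model.mem_disk_of_forall {y : M.ResiduePoints p} {U : M.space.Opens} (hU : IsAffineOpen U)
    (hy : y.pt ∈ U) {W : C.Opens} (le : U ≤ M.toCurve ⁻¹ᵁ W) (hW : IsAffineOpen W)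
    {x : LocalPoints V p} (hx : x.pt ∈ M.incl ⁻¹ᵁ U)
    (h : ∀ t, ∃ o : p.integers, M.valHom x hx t = o ∧ p.reduction o = y.hom hy t) :
    x ∈ M.disk y := by
  choose P hP hred using h
  have hinj : Function.Injective (algebraMap p.integers p.completion) := Subtype.val_injective
  let P' : Γ(M.space, U) →+* p.integers :=
    { toFun := P
      map_one' := hinj (by rw [map_one]; exact (hP 1).symm.trans (map_one _))
      map_zero' := hinj (by rw [map_zero]; exact (hP 0).symm.trans (map_zero _))
      map_add' := fun a b => hinj ((hP _).symm.trans (by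
        rw [map_add, map_add, hP, hP]; rfl))
      map_mul' := fun a b => hinj ((hP _).symm.trans (by
        rw [map_mul, map_mul, hP, hP]; rfl)) }
  have hp : p.1 ∈ W := y.toCurve_pt ▸ le hy
  obtain ⟨x', hx', hx'', hval⟩ := M.exists_mem_disk hU hy le hp hW P'
    (fun r => hinj ((hP _).symm.trans (M.valHom_appLE x hx le hp hW r))) hred
  rwa [M.eq_of_valHom_eq hU hx hx'' fun t => (hP t).trans (hval t).symm]

lemma continuousOn_eval {N : V.Opens} (f : Γ(V, N)) :
    Continuous fun x : {x : LocalPoints V p // x.pt ∈ N} => x.1.eval x.2 f := by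
  refine continuous_def.2 fun O hO => ?_
  refine ⟨{x | ∃ hx : x.pt ∈ N, x.eval hx f ∈ O}, .basic _ ⟨N, f, O, hO, rfl⟩, ?_⟩
  ext x
  exact ⟨fun ⟨_, h⟩ => h, fun h => ⟨x.2, h⟩⟩

lemma isOpen_setOf_pt_mem (N : V.Opens) : IsOpen {x : LocalPoints V p | x.pt ∈ N} :=
  .basic _ ⟨N, 0, Set.univ, isOpen_univ, by ext; simp⟩

lemma Place.exists_reduction_eq_iff (o : p.integers) (z : p.completion) :
    (∃ o' : p.integers, z = o' ∧ p.reduction o' = p.reduction o) ↔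
      Valued.v (z - o) ≤ WithZero.exp (-1) := by
  rw [← lt_one_iff_le_exp]
  constructor
  · rintro ⟨o', rfl, h⟩
    rw [← sub_eq_zero, ← map_sub, p.reduction_eq_zero_iff] at h
    exact h
  · intro h
    let d : p.integers := ⟨z - o, h.le⟩
    refine ⟨d + o, (sub_add_cancel z (o : p.completion)).symm, ?_⟩
    rw [map_add, (p.reduction_eq_zero_iff d).2 h, zero_add]

lemma Place.isOpen_setOf_reduction (c : C.residueField p.1) :
    IsOpen {z : p.completion | ∃ o : p.integers, z = o ∧ p.reduction o = c} := by
  rw [isOpen_iff_mem_nhds]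
  rintro _ ⟨o, rfl, rfl⟩
  refine (mem_nhds_iff_valued p.valued_surjective).2 ⟨1, fun y hy => ?_⟩
  exact (p.exists_reduction_eq_iff o y).2 hy

/-- Finitely many conditions cut out the disk inside the points of `Φ.U`: the generators must have
integral values with the right reductions. Each condition is open. -/
lemma CoordSystem.isOpen_disk (Φ : CoordSystem M n) {y : M.ResiduePoints p} (hy : y.pt ∈ Φ.U) :
    IsOpen (M.disk y) := by
  obtain ⟨S, hS⟩ := Φ.exists_finset
  have hp : p.1 ∈ Φ.W := y.toCurve_pt ▸ Φ.le hy
  have : M.disk y = {x | x.pt ∈ M.incl ⁻¹ᵁ Φ.U} ∩ ⋂ s ∈ S, {x | ∃ hx : x.pt ∈ M.incl ⁻¹ᵁ Φ.U,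
      x.eval hx (M.incl.app Φ.U s) ∈
        {z : p.completion | ∃ o : p.integers, z = o ∧ p.reduction o = y.hom hy s}} := by
    ext x
    constructor
    · intro h
      obtain ⟨hx, P, hP, hred⟩ := M.exists_hom_of_mem_disk h Φ.isAffineOpen_U hy
      exact ⟨hx, Set.mem_iInter₂.2 fun s _ => ⟨hx, P s, hP s, hred s⟩⟩
    · rintro ⟨hx, h⟩
      -- The functions whose value at `x` is integral with the expected reduction form a subring; it
      -- contains the functions from the base and the generators, hence everything.
      let D : Subring Γ(M.space, Φ.U) :=
        { carrier := {t | ∃ o : p.integers, M.valHom x hx t = o ∧ p.reduction o = y.hom hy t}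
          mul_mem' := by
            rintro a b ⟨o, h1, h2⟩ ⟨o', h3, h4⟩
            exact ⟨o * o', by rw [map_mul, h1, h3]; rfl, by rw [map_mul, map_mul, h2, h4]⟩
          one_mem' := ⟨1, map_one _, by rw [map_one, map_one]⟩
          add_mem' := by
            rintro a b ⟨o, h1, h2⟩ ⟨o', h3, h4⟩
            exact ⟨o + o', by rw [map_add, h1, h3]; rfl, by rw [map_add, map_add, h2, h4]⟩
          zero_mem' := ⟨0, map_zero _, by rw [map_zero, map_zero]⟩
          neg_mem' := by
            rintro a ⟨o, h1, h2⟩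
            exact ⟨-o, by rw [map_neg, h1]; rfl, by rw [map_neg, map_neg, h2]⟩ }
      refine M.mem_disk_of_forall Φ.isAffineOpen_U hy Φ.le Φ.isAffineOpen_W hx
        (hS D (fun r => ?_) fun s hs => ?_)
      · exact ⟨_, M.valHom_appLE x hx Φ.le hp Φ.isAffineOpen_W r,
          (p.reduction_algebraMap _).trans (y.hom_appLE hy Φ.le hp Φ.isAffineOpen_W r).symm⟩
      · obtain ⟨_, h⟩ := Set.mem_iInter₂.1 h s hs
        exact h
  rw [this]
  exact (isOpen_setOf_pt_mem _).inter (isOpen_biInter_finset fun s _ =>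
    .basic _ ⟨_, _, _, p.isOpen_setOf_reduction _, rfl⟩)

/-- The coordinates of a local point. -/
def CoordSystem.coordVec (Φ : CoordSystem M n) (x : LocalPoints V p)
    (hx : x.pt ∈ M.incl ⁻¹ᵁ Φ.U) : Fin n → p.completion :=
  fun j => x.eval hx (Φ.coord j)

lemma CoordSystem.coordVec_apply (Φ : CoordSystem M n) (x : LocalPoints V p)
    (hx : x.pt ∈ M.incl ⁻¹ᵁ Φ.U) (j : Fin n) :
    Φ.coordVec x hx j = M.valHom x hx (Φ.hom (MvPolynomial.X j)) := rfl

/-- On a residue disk, functions on the model do not expand distances. -/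
lemma CoordSystem.valHom_sub_le (Φ : CoordSystem M n) {y : M.ResiduePoints p} (hy : y.pt ∈ Φ.U)
    {x x' : LocalPoints V p} (h : x ∈ M.disk y) (h' : x' ∈ M.disk y)
    (hx : x.pt ∈ M.incl ⁻¹ᵁ Φ.U) (hx' : x'.pt ∈ M.incl ⁻¹ᵁ Φ.U) {k : ℤ}
    (hk : Φ.coordVec x hx - Φ.coordVec x' hx' ∈ lattice p.completion n k) (t : Γ(M.space, Φ.U)) :
    Valued.v (M.valHom x hx t - M.valHom x' hx' t) ≤ WithZero.exp (-k) := by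
  obtain ⟨_, P, hP, hred⟩ := M.exists_hom_of_mem_disk h Φ.isAffineOpen_U hy
  obtain ⟨_, P', hP', hred'⟩ := M.exists_hom_of_mem_disk h' Φ.isAffineOpen_U hy
  have hp : p.1 ∈ Φ.W := y.toCurve_pt ▸ Φ.le hy
  have h1 (t) : P t - P' t ∈ maximalIdeal p.integers := by
    have : p.reduction (P t - P' t) = 0 := by rw [map_sub, hred, hred', sub_self]
    rw [p.reduction_eq_zero_iff] at this
    exact (mem_maximalIdeal_iff_lt_one _ _ _).2 this
  rw [hP, hP']
  -- For `k ≤ 1` equality of the reductions already gives the bound; for larger `k` it comes from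
  -- étaleness of the coordinates.
  obtain hk1 | hk1 := le_total k 1
  · refine le_trans ?_ (WithZero.exp_le_exp.2 (neg_le_neg hk1))
    have := (mem_maximalIdeal_iff_lt_one (C.presheaf.stalk p.1) C.functionField _).1 (h1 t)
    exact lt_one_iff_le_exp.1 this
  · lift k to ℕ using by lia
    refine (mem_maximalIdeal_pow_iff (C.presheaf.stalk p.1) C.functionField k (P t - P' t)).1 ?_
    refine sub_mem_pow_of_etale Φ.hom Φ.etale _ P P' h1 (fun r => ?_) (fun j => ?_) t
    · refine Subtype.ext ?_
      rw [← hP, ← hP', Φ.hom_C, M.valHom_appLE x hx Φ.le hp Φ.isAffineOpen_W,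
        M.valHom_appLE x' hx' Φ.le hp Φ.isAffineOpen_W]
    · refine (mem_maximalIdeal_pow_iff (C.presheaf.stalk p.1) C.functionField k _).2 ?_
      have := mem_lattice.1 hk j
      rw [Pi.sub_apply, Φ.coordVec_apply, Φ.coordVec_apply, hP, hP'] at this
      exact this

/-- The coordinates map a residue disk onto a polydisk. -/
lemma CoordSystem.exists_mem_disk (Φ : CoordSystem M n) {y : M.ResiduePoints p} (hy : y.pt ∈ Φ.U)
    (a : Fin n → p.integers) (ha : ∀ j, p.reduction (a j) = y.hom hy (Φ.hom (MvPolynomial.X j))) :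
    ∃ x ∈ M.disk y, ∃ hx : x.pt ∈ M.incl ⁻¹ᵁ Φ.U, ∀ j, Φ.coordVec x hx j = a j := by
  have hp : p.1 ∈ Φ.W := y.toCurve_pt ▸ Φ.le hy
  have hker : RingHom.ker p.reduction = maximalIdeal p.integers := by
    ext z
    exact (p.reduction_eq_zero_iff z).trans (mem_maximalIdeal_iff_lt_one _ _ _).symm
  have : IsAdicComplete (RingHom.ker p.reduction) p.integers := by
    rw [hker]
    exact isAdicComplete_integers (C.presheaf.stalk p.1) C.functionField
  have hg (r) : y.hom hy (Φ.hom (MvPolynomial.C r)) =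
      p.reduction ((C.presheaf.germ Φ.W p.1 hp ≫ p.stalkHom).hom r) := by
    rw [Φ.hom_C]
    exact (y.hom_appLE hy Φ.le hp Φ.isAffineOpen_W r).trans (p.reduction_algebraMap _).symm
  obtain ⟨P, hP1, hP2, hP3⟩ := exists_lift_of_etale Φ.hom Φ.etale
    (C.presheaf.germ Φ.W p.1 hp ≫ p.stalkHom).hom p.reduction p.reduction_surjective a
    (y.hom hy) hg (fun j => (ha j).symm)
  obtain ⟨x, h, hx, hval⟩ := M.exists_mem_disk Φ.isAffineOpen_U hy Φ.le hp Φ.isAffineOpen_W P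
    (fun r => by rw [← Φ.hom_C, hP1]; rfl) hP3
  exact ⟨x, h, hx, fun j => by rw [Φ.coordVec_apply, hval, hP2]⟩

lemma Model.pt_mem_of_mem_disk {y : M.ResiduePoints p} {x : LocalPoints V p}
    (h : x ∈ M.disk y) {U : M.space.Opens} (hU : IsAffineOpen U) (hy : y.pt ∈ U) :
    x.pt ∈ M.incl ⁻¹ᵁ U :=
  (M.exists_hom_of_mem_disk h hU hy).1

/-- The coordinates on a residue disk. -/
def CoordSystem.diskMap (Φ : CoordSystem M n) {y : M.ResiduePoints p} (hy : y.pt ∈ Φ.U)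
    (x : M.disk y) : Fin n → p.completion :=
  Φ.coordVec x.1 (M.pt_mem_of_mem_disk x.2 Φ.isAffineOpen_U hy)

/-- The reductions of the coordinates are those of the residue point, and by étale lifting this is
the only constraint. Any lift of that reduction serves as the centre `a`. -/
lemma CoordSystem.exists_range_diskMap (Φ : CoordSystem M n) {y : M.ResiduePoints p}
    (hy : y.pt ∈ Φ.U) : ∃ a : Fin n → p.completion,
      Set.range (Φ.diskMap hy) = {w | w - a ∈ lattice p.completion n 1} := by
  choose a ha using fun j => p.reduction_surjective (y.hom hy (Φ.hom (MvPolynomial.X j)))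
  refine ⟨fun j => a j, Set.ext fun w => ?_⟩
  have key : w - (fun j => (a j : p.completion)) ∈ lattice p.completion n 1 ↔ ∀ j, ∃ o : p.integers,
      w j = o ∧ p.reduction o = y.hom hy (Φ.hom (MvPolynomial.X j)) := by
    refine mem_lattice.trans (forall_congr' fun j => ?_)
    rw [← ha j]
    exact (p.exists_reduction_eq_iff (a j) (w j)).symm
  rw [Set.mem_ofPred_eq, key]
  constructor
  · rintro ⟨x, rfl⟩ j
    obtain ⟨_, P, hP, hred⟩ := M.exists_hom_of_mem_disk x.2 Φ.isAffineOpen_U hy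
    exact ⟨P _, hP _, hred _⟩
  · intro h
    choose o ho hred using h
    obtain ⟨x, hx, hx', hval⟩ := Φ.exists_mem_disk hy o hred
    exact ⟨⟨x, hx⟩, funext fun j => (hval j).trans (ho j).symm⟩

lemma CoordSystem.diskMap_injective (Φ : CoordSystem M n) {y : M.ResiduePoints p}
    (hy : y.pt ∈ Φ.U) : Function.Injective (Φ.diskMap hy) := by
  intro x x' h
  refine Subtype.ext (M.eq_of_valHom_eq Φ.isAffineOpen_U
    (M.pt_mem_of_mem_disk x.2 Φ.isAffineOpen_U hy)
    (M.pt_mem_of_mem_disk x'.2 Φ.isAffineOpen_U hy) fun t => ?_)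
  rw [← sub_eq_zero]
  by_contra h0
  have hv : Valued.v (M.valHom x.1 (M.pt_mem_of_mem_disk x.2 Φ.isAffineOpen_U hy) t -
    M.valHom x'.1 (M.pt_mem_of_mem_disk x'.2 Φ.isAffineOpen_U hy) t) ≠ 0 := by simpa using h0
  -- Equal coordinates allow every level `k`. The chosen one makes the bound strictly smaller than
  -- the value of the difference, a contradiction.
  have := Φ.valHom_sub_le hy x.2 x'.2 (M.pt_mem_of_mem_disk x.2 Φ.isAffineOpen_U hy)
    (M.pt_mem_of_mem_disk x'.2 Φ.isAffineOpen_U hy) (k := 1 - WithZero.log (Valued.v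
      (M.valHom x.1 (M.pt_mem_of_mem_disk x.2 Φ.isAffineOpen_U hy) t -
        M.valHom x'.1 (M.pt_mem_of_mem_disk x'.2 Φ.isAffineOpen_U hy) t))) ?_ t
  · rw [← WithZero.log_le_iff_le_exp hv] at this
    lia
  · have h' : Φ.coordVec x.1 (M.pt_mem_of_mem_disk x.2 Φ.isAffineOpen_U hy) -
        Φ.coordVec x'.1 (M.pt_mem_of_mem_disk x'.2 Φ.isAffineOpen_U hy) = 0 := sub_eq_zero.2 h
    rw [h']
    exact zero_mem _

end Disk

end Tamagawa

namespace Tamagawa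

/-! ### Charts on residue disks -/

section DiskChart

open IsLocalRing Filter Topology

variable {C : Scheme.{u}} [IsIntegral C] [IsNonsingularCurve C] {p : Place C}
  {V : Scheme.{u}} [V.Over (Spec C.functionField)] {M : Model C V} {n : ℕ}

lemma Model.valHom_ne_zero_iff (x : LocalPoints V p) {U : M.space.Opens}
    (hx : x.pt ∈ M.incl ⁻¹ᵁ U) (s : Γ(M.space, U)) :
    M.valHom x hx s ≠ 0 ↔ x.pt ∈ M.incl ⁻¹ᵁ (M.space.basicOpen s) := by
  rw [Model.valHom_eq_evalAt, ← isUnit_iff_ne_zero]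
  exact (evalAt_basicOpen (x.1 ≫ M.incl) hx s).symm

lemma Model.exists_fraction_eval (M : Model C V) {U : M.space.Opens} (hU : IsAffineOpen U)
    (x₀ : LocalPoints V p) (hx₀ : x₀.pt ∈ M.incl ⁻¹ᵁ U) (N : V.Opens) (hN : x₀.pt ∈ N)
    (f : Γ(V, N)) : ∃ a s : Γ(M.space, U), M.valHom x₀ hx₀ s ≠ 0 ∧
      ∀ (x : LocalPoints V p) (hx : x.pt ∈ M.incl ⁻¹ᵁ U), M.valHom x hx s ≠ 0 →
        ∃ hN : x.pt ∈ N, x.eval hN f = M.valHom x hx a / M.valHom x hx s := by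
  obtain ⟨a, s, hs, hle, h⟩ := M.exists_fraction hU x₀.pt hx₀ N hN f
  refine ⟨a, s, (Model.valHom_ne_zero_iff x₀ hx₀ s).2 hs, fun x hx hxs => ?_⟩
  have hxs' := (Model.valHom_ne_zero_iff x hx s).1 hxs
  refine ⟨hle hxs', ?_⟩
  rw [eq_div_iff hxs]
  have := congrArg x.hom (h x.pt (hle hxs') hx hxs')
  rw [map_mul] at this
  exact this

variable (Φ : CoordSystem M n) {y : M.ResiduePoints p} (hy : y.pt ∈ Φ.U)

lemma CoordSystem.tendsto_valHom (x₀ : M.disk y) (t : Γ(M.space, Φ.U)) :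
    Tendsto (fun x : M.disk y => M.valHom x.1 (M.pt_mem_of_mem_disk x.2 Φ.isAffineOpen_U hy) t)
      (comap (Φ.diskMap hy) (𝓝 (Φ.diskMap hy x₀)))
      (𝓝 (M.valHom x₀.1 (M.pt_mem_of_mem_disk x₀.2 Φ.isAffineOpen_U hy) t)) := by
  intro s hs
  obtain ⟨k, hk⟩ := (mem_nhds_iff_valued p.valued_surjective).1 hs
  refine ⟨{w | w - Φ.diskMap hy x₀ ∈ lattice p.completion n k},
    (mem_nhds_iff_lattice p.valued_surjective).2 ⟨k, fun _ h => h⟩, fun x hx => hk ?_⟩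
  exact Φ.valHom_sub_le hy x.2 x₀.2 _ _ hx t

/-- The coordinates are continuous by definition of the topology. Conversely any function on V is
near `x₀` a fraction of functions on the model, and these are continuous in the coordinates because
they do not expand distances. -/
lemma CoordSystem.nhds_disk (x₀ : M.disk y) :
    𝓝 x₀ = comap (Φ.diskMap hy) (𝓝 (Φ.diskMap hy x₀)) := by
  apply le_antisymm
  · rw [← tendsto_iff_comap, tendsto_pi_nhds]
    intro j
    let g (x : M.disk y) : {x : LocalPoints V p // x.pt ∈ M.incl ⁻¹ᵁ Φ.U} :=
      ⟨x.1, M.pt_mem_of_mem_disk x.2 Φ.isAffineOpen_U hy⟩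
    have hg : Continuous g := continuous_subtype_val.subtype_mk _
    exact ((continuousOn_eval (Φ.coord j)).comp hg).tendsto x₀
  · rw [nhds_subtype, ← tendsto_iff_comap, TopologicalSpace.tendsto_nhds_generateFrom_iff]
    rintro _ ⟨N, f, O, hO, rfl⟩ ⟨hN, hf⟩
    have hx₀ := M.pt_mem_of_mem_disk x₀.2 Φ.isAffineOpen_U hy
    obtain ⟨a, s, hs, h⟩ := M.exists_fraction_eval Φ.isAffineOpen_U x₀.1 hx₀ N hN f
    have h1 := (Φ.tendsto_valHom hy x₀ a).div (Φ.tendsto_valHom hy x₀ s) hs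
    obtain ⟨_, h0⟩ := h _ hx₀ hs
    rw [h0] at hf
    filter_upwards [h1 (hO.mem_nhds hf), (Φ.tendsto_valHom hy x₀ s).eventually_ne hs] with x hx hxs
    obtain ⟨hxN, hxf⟩ := h x.1 _ hxs
    exact ⟨hxN, hxf ▸ hx⟩

lemma CoordSystem.isOpenEmbedding_diskMap : IsOpenEmbedding (Φ.diskMap hy) := by
  refine ⟨⟨isInducing_iff_nhds.2 (Φ.nhds_disk hy), Φ.diskMap_injective hy⟩, ?_⟩
  obtain ⟨a, ha⟩ := Φ.exists_range_diskMap hy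
  rw [ha]
  exact (isOpen_lattice p.valued_surjective 1).preimage (continuous_sub_right a)

/-- The chart given by étale coordinates on a residue disk. -/
def CoordSystem.diskChart : Chart V n p where
  dom := M.incl ⁻¹ᵁ Φ.U
  coord := Φ.coord
  linearIndependent v hv := by
    obtain ⟨b, hb⟩ := Φ.exists_basis v hv
    exact (funext hb : ⇑b = _) ▸ b.linearIndependent
  span_eq_top v hv := by
    obtain ⟨b, hb⟩ := Φ.exists_basis v hv
    exact (funext hb : ⇑b = _) ▸ b.span_eq.ge
  source := M.disk y
  isOpen_source := Φ.isOpen_disk hy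
  pt_mem x hx := M.pt_mem_of_mem_disk hx Φ.isAffineOpen_U hy
  isOpenEmbedding := Φ.isOpenEmbedding_diskMap hy

variable [Finite (C.residueField p.1)]

lemma CoordSystem.haarPi_range_diskMap :
    p.haarPi n (Set.range (Φ.diskMap hy)) = ((p.card : ℝ≥0∞) ^ n)⁻¹ := by
  obtain ⟨a, ha⟩ := Φ.exists_range_diskMap hy
  have : {w | w - a ∈ lattice p.completion n 1} =
      (fun w => w + -a) ⁻¹' (lattice p.completion n 1 : Set (Fin n → p.completion)) := by
    ext w
    simp [sub_eq_add_neg]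
  rw [ha, this, measure_preimage_add_right, p.haarPi_lattice]
  rw [zpow_neg_one, ENNReal.inv_pow]

end DiskChart

end Tamagawa

namespace Tamagawa

/-! ### Strict differentiability over a discretely valued field -/

section Strict

open Filter Topology WithZero
open scoped WithZero

variable {K : Type*} [Field K] [Valued K ℤᵐ⁰] {D : Type*} [TopologicalSpace D] {n : ℕ}

lemma exists_valued_le_exp (c : K) : ∃ l : ℤ, Valued.v c ≤ exp l := by
  rcases eq_or_ne (Valued.v c) 0 with h | h
  · exact ⟨0, by simp [h]⟩
  · exact ⟨log (Valued.v c), by rw [exp_log h]⟩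

/-- Functions of pairs of points near `P₀` that are negligible compared to the distance of the two
points, as measured by `X`. -/
def smallAt (X : D → Fin n → K) (P₀ : D) : Submodule K (D × D → K) where
  carrier := {h | ∀ m : ℤ, ∀ᶠ z in 𝓝 P₀ ×ˢ 𝓝 P₀, ∀ k : ℤ, X z.1 - X z.2 ∈ lattice K n k →
    Valued.v (h z) ≤ exp (-(k + m))}
  zero_mem' m := by simp
  add_mem' ha hb m := by
    filter_upwards [ha m, hb m] with z h1 h2 k hk
    exact (Valued.v.map_add _ _).trans (max_le (h1 k hk) (h2 k hk))
  smul_mem' c h hh m := by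
    obtain ⟨l, hl⟩ := exists_valued_le_exp c
    filter_upwards [hh (m + l)] with z h1 k hk
    rw [Pi.smul_apply, smul_eq_mul, map_mul]
    refine (mul_le_mul' hl (h1 k hk)).trans ?_
    rw [← exp_add]
    exact exp_le_exp.2 (by lia)

variable {X : D → Fin n → K} {P₀ : D}

lemma mem_smallAt_of_eventually_eq_zero {h : D × D → K} (hh : ∀ᶠ z in 𝓝 P₀ ×ˢ 𝓝 P₀, h z = 0) :
    h ∈ smallAt X P₀ := fun m => by
  filter_upwards [hh] with z hz k _
  simp [hz]

/-- Functions of pairs of points near `P₀` bounded by a multiple of the distance. -/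
def IsLipAt (X : D → Fin n → K) (P₀ : D) (h : D × D → K) : Prop :=
  ∃ m : ℤ, ∀ᶠ z in 𝓝 P₀ ×ˢ 𝓝 P₀, ∀ k : ℤ, X z.1 - X z.2 ∈ lattice K n k →
    Valued.v (h z) ≤ exp (-(k + m))

lemma IsLipAt.mul_mem_smallAt (hv : Function.Surjective (Valued.v : K → ℤᵐ⁰)) {g h : D × D → K}
    (hh : IsLipAt X P₀ h) (hg : Tendsto g (𝓝 P₀ ×ˢ 𝓝 P₀) (𝓝 0)) : g * h ∈ smallAt X P₀ := by
  obtain ⟨l, hl⟩ := hh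
  intro m
  have : {y : K | Valued.v (y - 0) ≤ exp (-(m - l))} ∈ 𝓝 0 :=
    (mem_nhds_iff_valued hv).2 ⟨m - l, subset_rfl⟩
  filter_upwards [hl, hg this] with z h1 h2 k hk
  rw [Set.mem_preimage, Set.mem_ofPred_eq, sub_zero] at h2
  rw [Pi.mul_apply, map_mul]
  refine (mul_le_mul' h2 (h1 k hk)).trans ?_
  rw [← exp_add]
  exact exp_le_exp.2 (by lia)

/-- A relation between the differentials of functions gives a relation between their increments. -/
lemma sub_sum_mem_smallAt (hv : Function.Surjective (Valued.v : K → ℤᵐ⁰))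
    {F B : Type*} [CommRing F] [CommRing B] [Algebra F B] (e : B → D → K) (e₀ : B →+* K)
    (hadd : ∀ b b', ∀ᶠ P in 𝓝 P₀, e (b + b') P = e b P + e b' P)
    (hmul : ∀ b b', ∀ᶠ P in 𝓝 P₀, e (b * b') P = e b P * e b' P)
    (hconst : ∀ c : F, ∀ᶠ P in 𝓝 P₀, e (algebraMap F B c) P = e₀ (algebraMap F B c))
    (htend : ∀ b, Tendsto (e b) (𝓝 P₀) (𝓝 (e₀ b)))
    (hlip : ∀ b, IsLipAt X P₀ fun z => e b z.1 - e b z.2)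
    {ι : Type*} [Fintype ι] (f : B) (c x : ι → B)
    (hf : KaehlerDifferential.D F B f = ∑ j, c j • KaehlerDifferential.D F B (x j)) :
    (fun z => (e f z.1 - e f z.2) - ∑ j, e₀ (c j) * (e (x j) z.1 - e (x j) z.2)) ∈
      smallAt X P₀ := by
  -- Increments are considered modulo negligible functions; `B` acts on this quotient through the
  -- values at `P₀`.
  let E := (D × D → K) ⧸ smallAt X P₀
  let : Module B E := Module.compHom E e₀
  let : Module F E := Module.compHom E (e₀.comp (algebraMap F B))
  have hsmulB (b : B) (q : E) : b • q = e₀ b • q := rfl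
  have hsmulF (a : F) (q : E) : a • q = e₀ (algebraMap F B a) • q := rfl
  have : IsScalarTower F B E := ⟨fun a b q => by
    rw [hsmulF, hsmulB, hsmulB, Algebra.smul_def, map_mul, mul_smul]⟩
  let π : (D × D → K) →ₗ[K] E := (smallAt X P₀).mkQ
  have hπ {g h : D × D → K} : π g = π h ↔ g - h ∈ smallAt X P₀ := Submodule.Quotient.eq _
  let d (b : B) : D × D → K := fun z => e b z.1 - e b z.2
  have hd (b b') : π (d (b + b')) = π (d b) + π (d b') := by
    rw [← map_add, hπ]
    refine mem_smallAt_of_eventually_eq_zero ?_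
    filter_upwards [(hadd b b').prod_inl (𝓝 P₀), (hadd b b').prod_inr (𝓝 P₀)] with z h1 h2
    simp only [d, Pi.sub_apply, Pi.add_apply, h1, h2]
    ring
  -- The increment of a product differs from the Leibniz expression by two terms, each the product
  -- of a factor tending to zero and a Lipschitz increment.
  have hleib (b b') : π (d (b * b')) = b • π (d b') + b' • π (d b) := by
    rw [hsmulB, hsmulB, ← map_smul, ← map_smul, ← map_add, hπ]
    have h1 : (fun z : D × D => e b z.1 - e₀ b) * d b' ∈ smallAt X P₀ :=
      (hlip b').mul_mem_smallAt hv (by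
        simpa using ((htend b).comp (tendsto_fst (f := 𝓝 P₀) (g := 𝓝 P₀))).sub_const (e₀ b))
    have h2 : (fun z : D × D => e b' z.2 - e₀ b') * d b ∈ smallAt X P₀ :=
      (hlip b).mul_mem_smallAt hv (by
        simpa using ((htend b').comp (tendsto_snd (f := 𝓝 P₀) (g := 𝓝 P₀))).sub_const (e₀ b'))
    have h3 : d (b * b') - (e₀ b • d b' + e₀ b' • d b) -
        ((fun z : D × D => e b z.1 - e₀ b) * d b' + (fun z : D × D => e b' z.2 - e₀ b') * d b) ∈
        smallAt X P₀ := by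
      refine mem_smallAt_of_eventually_eq_zero ?_
      filter_upwards [(hmul b b').prod_inl (𝓝 P₀), (hmul b b').prod_inr (𝓝 P₀)] with z h1 h2
      simp only [d, Pi.sub_apply, Pi.add_apply, Pi.smul_apply, Pi.mul_apply, smul_eq_mul, h1, h2]
      ring
    simpa using add_mem h3 (add_mem h1 h2)
  have hzero (a : F) : π (d (algebraMap F B a)) = 0 := by
    rw [← map_zero π, hπ]
    refine mem_smallAt_of_eventually_eq_zero ?_
    filter_upwards [(hconst a).prod_inl (𝓝 P₀), (hconst a).prod_inr (𝓝 P₀)] with z h1 h2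
    simp [d, h1, h2]
  -- The increment modulo negligible functions is a derivation, so it factors through the Kähler
  -- differentials and carries the relation `hf` to the asserted one.
  let δ : Derivation F B E := Derivation.mk'
    { toFun := fun b => π (d b)
      map_add' := hd
      map_smul' := fun a b => by
        rw [Algebra.smul_def, hleib, hzero, smul_zero, add_zero]
        rfl } hleib
  have h := congrArg δ.liftKaehlerDifferential hf
  rw [map_sum, Derivation.liftKaehlerDifferential_comp_D] at h
  simp only [map_smul, Derivation.liftKaehlerDifferential_comp_D] at h
  have h' : π (d f) = π (∑ j, e₀ (c j) • d (x j)) := by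
    rw [map_sum]
    exact h
  rw [hπ] at h'
  convert h' using 1
  ext z
  simp [d]

/-- `J` is the strict derivative at `P₀` of the vector-valued function `G` with respect
to the coordinates `X`. -/
def HasStrictJacobian (X G : D → Fin n → K) (J : Matrix (Fin n) (Fin n) K) (P₀ : D) : Prop :=
  ∀ i, (fun z => (G z.1 i - G z.2 i) - ∑ j, J i j * (X z.1 j - X z.2 j)) ∈ smallAt X P₀

lemma HasStrictJacobian.mulVec {G : D → Fin n → K} {J : Matrix (Fin n) (Fin n) K}
    (h : HasStrictJacobian X G J P₀) (T : Matrix (Fin n) (Fin n) K) :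
    HasStrictJacobian X (fun P => T.mulVec (G P)) (T * J) P₀ := by
  intro i
  convert (smallAt X P₀).sum_mem (t := Finset.univ) fun l _ =>
    (smallAt X P₀).smul_mem (T i l) (h l) using 1
  ext z
  simp only [Matrix.mulVec_apply_eq_sum, Finset.sum_apply, Pi.smul_apply, smul_eq_mul, mul_sub,
    Finset.sum_sub_distrib, Matrix.mul_apply, Finset.mul_sum, Finset.sum_mul, mul_assoc]
  congr 2 <;> exact Finset.sum_comm

lemma HasStrictJacobian.exists_nhds {G : D → Fin n → K} {J : Matrix (Fin n) (Fin n) K}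
    (h : HasStrictJacobian X G J P₀) : ∃ A ∈ 𝓝 P₀, ∀ P ∈ A, ∀ Q ∈ A, ∀ k : ℤ,
      X P - X Q ∈ lattice K n k → G P - G Q - J.mulVec (X P - X Q) ∈ lattice K n (k + 1) := by
  -- The level `m = 1` suffices: the error is smaller than the distance by at least one step of the
  -- valuation.
  have : ∀ᶠ z in 𝓝 P₀ ×ˢ 𝓝 P₀, ∀ i, ∀ k : ℤ, X z.1 - X z.2 ∈ lattice K n k →
      Valued.v ((G z.1 i - G z.2 i) - ∑ j, J i j * (X z.1 j - X z.2 j)) ≤ exp (-(k + 1)) :=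
    eventually_all.2 fun i => h i 1
  obtain ⟨A, hA, hsub⟩ := mem_prod_self_iff.1 this
  refine ⟨A, hA, fun P hP Q hQ k hk i => ?_⟩
  have := hsub (Set.mk_mem_prod hP hQ) i k hk
  simpa [Matrix.mulVec_apply_eq_sum] using this

/-- The matrix is integral and reduces to the identity over the residue field, so its determinant
reduces to 1. -/
lemma valued_det_eq_one {T : Matrix (Fin n) (Fin n) K}
    (hT : ∀ i j, Valued.v (T i j - (1 : Matrix (Fin n) (Fin n) K) i j) < 1) :
    Valued.v T.det = 1 := by
  let O := (Valued.v : Valuation K ℤᵐ⁰).valuationSubring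
  have hmem (i j) : T i j ∈ O := by
    have h1 : Valued.v ((1 : Matrix (Fin n) (Fin n) K) i j) ≤ 1 := by
      rw [Matrix.one_apply]; split_ifs <;> simp
    have := (Valued.v.map_add (T i j - (1 : Matrix (Fin n) (Fin n) K) i j)
      ((1 : Matrix (Fin n) (Fin n) K) i j)).trans (max_le (hT i j).le h1)
    rwa [sub_add_cancel] at this
  let T' : Matrix (Fin n) (Fin n) O := Matrix.of fun i j => ⟨T i j, hmem i j⟩
  have hdet : (T'.det : K) = T.det := by
    have := RingHom.map_det O.subtype T'
    exact this
  have hres : T'.map (IsLocalRing.residue O) = 1 := by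
    ext i j
    have h0 : T' i j - (1 : Matrix (Fin n) (Fin n) O) i j ∈ IsLocalRing.maximalIdeal O := by
      rw [Valuation.mem_maximalIdeal_iff]
      have h1 : ((1 : Matrix (Fin n) (Fin n) O) i j : K) = (1 : Matrix (Fin n) (Fin n) K) i j := by
        rw [Matrix.one_apply, Matrix.one_apply]; split_ifs <;> rfl
      rw [AddSubgroupClass.coe_sub, h1]
      exact hT i j
    rw [← IsLocalRing.residue_eq_zero_iff, map_sub, sub_eq_zero] at h0
    rw [Matrix.map_apply, h0, Matrix.one_apply, Matrix.one_apply]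
    split_ifs <;> simp
  have hunit : IsLocalRing.residue O T'.det = 1 := by
    rw [RingHom.map_det, RingHom.mapMatrix_apply, hres, Matrix.det_one]
  have hnot : T'.det ∉ IsLocalRing.maximalIdeal O := by
    rw [← IsLocalRing.residue_eq_zero_iff, hunit]
    exact one_ne_zero
  rw [Valuation.mem_maximalIdeal_iff, hdet, not_lt] at hnot
  exact le_antisymm (hdet ▸ T'.det.2) hnot

/-- The Jacobian is locally constant up to integral matrices of unit determinant. -/
lemma HasStrictJacobian.valued_det_eq_one (hv : Function.Surjective (Valued.v : K → ℤᵐ⁰))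
    {G : D → Fin n → K} {T : Matrix (Fin n) (Fin n) K} {P : D} (h : HasStrictJacobian X G T P)
    (hX : map X (𝓝 P) = 𝓝 (X P)) {A : Set D} (hA : A ∈ 𝓝 P)
    (hAX : ∀ P ∈ A, ∀ Q ∈ A, ∀ k : ℤ, X P - X Q ∈ lattice K n k →
      G P - G Q - (X P - X Q) ∈ lattice K n (k + 1)) :
    Valued.v T.det = 1 := by
  obtain ⟨B, hB, hBX⟩ := h.exists_nhds
  -- Since `X` is open at `P`, some `Q` in `A ∩ B` satisfies `X Q - X P = c • e_j` for a small `c`.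
  -- Comparing the two approximations of `G Q - G P` and dividing by `c` bounds column j of `T - 1`
  -- by `exp (-1)`.
  have himg : X '' (A ∩ B) ∈ 𝓝 (X P) := hX ▸ image_mem_map (inter_mem hA hB)
  obtain ⟨k, hk⟩ := (mem_nhds_iff_lattice hv).1 himg
  obtain ⟨c, hc⟩ := hv (exp (-k))
  refine Tamagawa.valued_det_eq_one fun i j => ?_
  have hsing : (Pi.single j c : Fin n → K) ∈ lattice K n k := fun l => by
    rcases eq_or_ne l j with rfl | hl
    · simp [hc]
    · simp [hl]
  obtain ⟨Q, hQ, hXQ⟩ := hk (X P + Pi.single j c) (by simpa using hsing)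
  have hdiff : X Q - X P = Pi.single j c := by rw [hXQ]; simp
  have hP : P ∈ A ∩ B := ⟨mem_of_mem_nhds hA, mem_of_mem_nhds hB⟩
  have h1 := hAX Q hQ.1 P hP.1 k (by rwa [hdiff])
  have h2 := hBX Q hQ.2 P hP.2 k (by rwa [hdiff])
  have h3 := sub_mem h1 h2 i
  rw [hdiff] at h3
  have h4 : (T i j - (1 : Matrix (Fin n) (Fin n) K) i j) * c =
      ((G Q - G P - (Pi.single j c : Fin n → K)) - (G Q - G P - T.mulVec (Pi.single j c))) i := by
    have h5 : (Pi.single j c : Fin n → K) i = (1 : Matrix (Fin n) (Fin n) K) i j * c := by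
      rw [Matrix.one_apply, Pi.single_apply]; split_ifs <;> simp
    simp only [Pi.sub_apply, h5, Matrix.mulVec_single, op_smul_eq_smul, Pi.smul_apply,
      Matrix.col_apply, smul_eq_mul]
    ring
  rw [← h4, map_mul, hc, neg_add, exp_add, mul_comm] at h3
  rw [lt_one_iff_le_exp]
  exact le_of_mul_le_mul_left h3 (by simp)

end Strict

end Tamagawa

namespace Tamagawa

/-! ### Values of germs near a local point -/

section EvalGerm

open IsLocalRing Filter Topology

variable {C : Scheme.{u}} [IsIntegral C] [IsNonsingularCurve C] {p : Place C}
  {V : Scheme.{u}} [V.Over (Spec C.functionField)]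

lemma LocalPoints.hom_algebraMap (x : LocalPoints V p) (c : C.functionField) :
    Points.hom x (algebraMap C.functionField (V.presheaf.stalk (Points.pt x)) c) =
      algebraMap C.functionField p.completion c := by
  have h := evalAt_comp x.1 (V ↘ Spec C.functionField) ⊤ trivial trivial
  have h2 (f : Spec (.of p.completion) ⟶ Spec C.functionField)
      (hf : f = Spec.map (CommRingCat.ofHom (algebraMap C.functionField p.completion))) :
      evalAt f ⊤ trivial = (Scheme.ΓSpecIso C.functionField).hom ≫
        CommRingCat.ofHom (algebraMap C.functionField p.completion) := by
    subst hf
    exact Scheme.germ_stalkClosedPointTo_Spec _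
  rw [h2 _ x.2] at h
  have h3 := ConcreteCategory.congr_hom h ((Scheme.ΓSpecIso C.functionField).inv c)
  refine Eq.trans ?_ (h3.symm.trans ?_)
  · rfl
  · exact congrArg (algebraMap C.functionField p.completion)
      (ConcreteCategory.congr_hom (Scheme.ΓSpecIso C.functionField).inv_hom_id c)

open Classical in
/-- The value near `x₀` of a germ of functions at `x₀`, by means of a representative. -/
def evalGerm (x₀ : LocalPoints V p) (b : V.presheaf.stalk (Points.pt x₀)) (x : LocalPoints V p) :
    p.completion :=
  if h : x.pt ∈ (V.presheaf.exists_germ_eq b).choose then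
    x.eval h (V.presheaf.exists_germ_eq b).choose_spec.choose_spec.choose else 0

/-- Two representatives of a germ agree near the point, so the choice made in `evalGerm` is
immaterial there. -/
lemma evalGerm_germ (x₀ : LocalPoints V p) {N : V.Opens} (hN : x₀.pt ∈ N) (f : Γ(V, N)) :
    ∀ᶠ x : LocalPoints V p in 𝓝 x₀, ∃ hx : x.pt ∈ N,
      evalGerm x₀ (V.presheaf.germ N _ hN f) x = x.eval hx f := by
  set b := V.presheaf.germ N _ hN f with hb
  have h := (V.presheaf.exists_germ_eq b).choose_spec
  obtain ⟨N', hv, h1, h2, h3⟩ := exists_opens_germ_eq h.choose hN h.choose_spec.choose_spec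
  filter_upwards [(isOpen_setOf_pt_mem N').mem_nhds hv] with x hx
  refine ⟨h2 hx, ?_⟩
  rw [evalGerm, dif_pos (h1 hx)]
  exact congrArg x.hom (h3 x.pt (h1 hx) (h2 hx) hx)

lemma tendsto_evalGerm (x₀ : LocalPoints V p) (b : V.presheaf.stalk (Points.pt x₀)) :
    Tendsto (evalGerm x₀ b) (𝓝 x₀) (𝓝 (Points.hom x₀ b)) := by
  obtain ⟨N, hN, f, rfl⟩ := V.presheaf.exists_germ_eq b
  have hc := (continuousOn_eval (p := p) f).tendsto ⟨x₀, hN⟩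
  have h2 : Tendsto (fun x => evalGerm x₀ (V.presheaf.germ N _ hN f) x)
      (map Subtype.val (𝓝 (⟨x₀, hN⟩ : {x : LocalPoints V p // x.pt ∈ N})))
      (𝓝 (Points.hom x₀ (V.presheaf.germ N _ hN f))) := by
    rw [tendsto_map'_iff]
    refine hc.congr' ?_
    filter_upwards [continuous_subtype_val.continuousAt.eventually (evalGerm_germ x₀ hN f)] with x hx
    exact hx.2.symm
  rwa [(isOpen_setOf_pt_mem N).isOpenEmbedding_subtypeVal.map_nhds_eq] at h2

lemma evalGerm_map₂ (x₀ : LocalPoints V p) (b b' : V.presheaf.stalk (Points.pt x₀)) :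
    ∀ᶠ x in 𝓝 x₀, evalGerm x₀ (b + b') x = evalGerm x₀ b x + evalGerm x₀ b' x ∧
      evalGerm x₀ (b * b') x = evalGerm x₀ b x * evalGerm x₀ b' x := by
  obtain ⟨N, hN, f, rfl⟩ := V.presheaf.exists_germ_eq b
  obtain ⟨N', hN', f', rfl⟩ := V.presheaf.exists_germ_eq b'
  let r : Γ(V, N ⊓ N') := V.presheaf.map (homOfLE inf_le_left).op f
  let r' : Γ(V, N ⊓ N') := V.presheaf.map (homOfLE inf_le_right).op f'
  have hm : Points.pt x₀ ∈ N ⊓ N' := ⟨hN, hN'⟩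
  have h1 (v) (hv : v ∈ N ⊓ N') : V.presheaf.germ _ v hv r = V.presheaf.germ N v hv.1 f :=
    V.presheaf.germ_res_apply _ _ _ _
  have h2 (v) (hv : v ∈ N ⊓ N') : V.presheaf.germ _ v hv r' = V.presheaf.germ N' v hv.2 f' :=
    V.presheaf.germ_res_apply _ _ _ _
  rw [← h1 _ hm, ← h2 _ hm, ← map_add, ← map_mul]
  filter_upwards [evalGerm_germ x₀ hm r, evalGerm_germ x₀ hm r', evalGerm_germ x₀ hm (r + r'),
    evalGerm_germ x₀ hm (r * r')] with x ha hb hc hd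
  obtain ⟨hx, ha⟩ := ha
  rw [ha, hb.2, hc.2, hd.2]
  simp only [Points.eval, map_add, map_mul, and_self]

lemma evalGerm_algebraMap (x₀ : LocalPoints V p) (c : C.functionField) :
    ∀ᶠ x in 𝓝 x₀, evalGerm x₀ (algebraMap C.functionField _ c) x =
      Points.hom x₀ (algebraMap C.functionField _ c) := by
  filter_upwards [evalGerm_germ x₀ (N := ⊤) trivial ((V ↘ Spec C.functionField).appTop
    ((Scheme.ΓSpecIso C.functionField).inv c))] with x hx
  refine hx.2.trans ?_
  rw [LocalPoints.hom_algebraMap]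
  exact LocalPoints.hom_algebraMap x c

end EvalGerm

end Tamagawa

namespace Tamagawa

/-! ### Comparison of charts -/

section Comparison

open IsLocalRing Filter Topology

variable {C : Scheme.{u}} [IsIntegral C] [IsNonsingularCurve C] {p : Place C}
  {V : Scheme.{u}} [V.Over (Spec C.functionField)] {M : Model C V} {n : ℕ}
  (Φ : CoordSystem M n) {y : M.ResiduePoints p} (hy : y.pt ∈ Φ.U)

lemma Model.valued_valHom_le_one {x : LocalPoints V p} (h : x ∈ M.disk y) {U : M.space.Opens}
    (hU : IsAffineOpen U) (hy : y.pt ∈ U) (hx : x.pt ∈ M.incl ⁻¹ᵁ U) (t : Γ(M.space, U)) :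
    Valued.v (M.valHom x hx t) ≤ 1 := by
  obtain ⟨_, P, hP, -⟩ := M.exists_hom_of_mem_disk h hU hy
  rw [hP]
  exact (P t).2

/-- The germ is a fraction a/s of functions on the model, which do not expand distances and are
integral on the disk, and the absolute value of s is constant near `P₀`. -/
lemma CoordSystem.isLipAt_evalGerm (P₀ : M.disk y) (b : V.presheaf.stalk (Points.pt P₀.1)) :
    IsLipAt (Φ.diskMap hy) P₀ fun z => evalGerm P₀.1 b z.1.1 - evalGerm P₀.1 b z.2.1 := by
  obtain ⟨N, hN, f, rfl⟩ := V.presheaf.exists_germ_eq b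
  have hU (P : M.disk y) := M.pt_mem_of_mem_disk P.2 Φ.isAffineOpen_U hy
  obtain ⟨a, s, hs, h⟩ := M.exists_fraction_eval Φ.isAffineOpen_U P₀.1 (hU P₀) N hN f
  have hvs : Valued.v (M.valHom P₀.1 (hU P₀) s) ≠ 0 := by simpa using hs
  have hs₀ : ∀ᶠ P in 𝓝 P₀, Valued.v (M.valHom P.1 (hU P) s) =
      Valued.v (M.valHom P₀.1 (hU P₀) s) := by
    have := Φ.tendsto_valHom hy P₀ s
    rw [← Φ.nhds_disk hy] at this
    have hnhds : {z : p.completion | Valued.v z = Valued.v (M.valHom P₀.1 (hU P₀) s)} ∈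
        𝓝 (M.valHom P₀.1 (hU P₀) s) := by
      refine (mem_nhds_iff_valued p.valued_surjective).2
        ⟨1 - WithZero.log (Valued.v (M.valHom P₀.1 (hU P₀) s)), fun z hz => ?_⟩
      refine Valued.v.map_eq_of_sub_lt (hz.trans_lt ?_)
      rw [← WithZero.lt_log_iff_exp_lt hvs]
      lia
    exact this hnhds
  have hev : ∀ᶠ P in 𝓝 P₀, Valued.v (M.valHom P.1 (hU P) s) =
      Valued.v (M.valHom P₀.1 (hU P₀) s) ∧ evalGerm P₀.1 (V.presheaf.germ N _ hN f) P.1 =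
        M.valHom P.1 (hU P) a / M.valHom P.1 (hU P) s := by
    filter_upwards [hs₀, continuous_subtype_val.continuousAt.eventually
      (evalGerm_germ P₀.1 hN f)] with P h1 h2
    have hP : M.valHom P.1 (hU P) s ≠ 0 := by
      intro h0
      rw [h0, map_zero] at h1
      exact hvs h1.symm
    exact ⟨h1, h2.2.trans (h P.1 (hU P) hP).2⟩
  set l := WithZero.log (Valued.v (M.valHom P₀.1 (hU P₀) s)) with hl
  -- The difference of two fractions has denominator of value `exp (2 * l)`, while its numerator is
  -- bounded by `exp (-k)`.
  refine ⟨2 * l, ?_⟩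
  filter_upwards [hev.prod_inl (𝓝 P₀), hev.prod_inr (𝓝 P₀)] with z h1 h2 k hk
  have hvl : Valued.v (M.valHom P₀.1 (hU P₀) s) = WithZero.exp l := (WithZero.exp_log hvs).symm
  rw [h1.2, h2.2]
  have hne (P : M.disk y) (hP : Valued.v (M.valHom P.1 (hU P) s) =
      Valued.v (M.valHom P₀.1 (hU P₀) s)) : M.valHom P.1 (hU P) s ≠ 0 := by
    intro h0
    rw [h0, map_zero] at hP
    exact hvs hP.symm
  have ha := Φ.valHom_sub_le hy z.1.2 z.2.2 (hU z.1) (hU z.2) hk a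
  have hb := Φ.valHom_sub_le hy z.1.2 z.2.2 (hU z.1) (hU z.2) hk s
  have ha1 := M.valued_valHom_le_one z.2.2 Φ.isAffineOpen_U hy (hU z.2) a
  have hs1 := M.valued_valHom_le_one z.2.2 Φ.isAffineOpen_U hy (hU z.2) s
  have hnum : Valued.v ((M.valHom z.1.1 (hU z.1) a - M.valHom z.2.1 (hU z.2) a) *
      M.valHom z.2.1 (hU z.2) s - M.valHom z.2.1 (hU z.2) a *
      (M.valHom z.1.1 (hU z.1) s - M.valHom z.2.1 (hU z.2) s)) ≤ WithZero.exp (-k) := by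
    refine (Valued.v.map_sub _ _).trans (max_le ?_ ?_)
    · rw [map_mul]
      exact (mul_le_mul' ha hs1).trans (mul_one _).le
    · rw [map_mul]
      exact (mul_le_mul' ha1 hb).trans (one_mul _).le
  have heq : M.valHom z.1.1 (hU z.1) a / M.valHom z.1.1 (hU z.1) s -
      M.valHom z.2.1 (hU z.2) a / M.valHom z.2.1 (hU z.2) s =
      ((M.valHom z.1.1 (hU z.1) a - M.valHom z.2.1 (hU z.2) a) *
      M.valHom z.2.1 (hU z.2) s - M.valHom z.2.1 (hU z.2) a *
      (M.valHom z.1.1 (hU z.1) s - M.valHom z.2.1 (hU z.2) s)) /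
      (M.valHom z.1.1 (hU z.1) s * M.valHom z.2.1 (hU z.2) s) := by
    have h3 := hne z.1 h1.1
    have h4 := hne z.2 h2.1
    rw [div_sub_div _ _ h3 h4]
    congr 1
    ring
  rw [heq, map_div₀, map_mul, h1.1, h2.1, hvl, ← WithZero.exp_add, div_eq_mul_inv,
    ← WithZero.exp_neg]
  refine (mul_le_mul' hnum le_rfl).trans ?_
  rw [← WithZero.exp_add]
  exact WithZero.exp_le_exp.2 (by lia)

open Classical in
/-- The coordinates of a chart, extended by zero to all local points. -/
def Chart.coordMap (c : Chart V n p) (x : LocalPoints V p) (i : Fin n) : p.completion :=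
  if h : x.pt ∈ c.dom then x.eval h (c.coord i) else 0

/-- The basis of the differentials given by a chart. -/
def Chart.basis (c : Chart V n p) (v : V) (hv : v ∈ c.dom) :
    Module.Basis (Fin n) (V.presheaf.stalk v)
      (KaehlerDifferential C.functionField (V.presheaf.stalk v)) :=
  Module.Basis.mk (c.linearIndependent v hv) (c.span_eq_top v hv)

lemma Chart.basis_apply (c : Chart V n p) (v : V) (hv : v ∈ c.dom) (i : Fin n) :
    c.basis v hv i = KaehlerDifferential.D C.functionField (V.presheaf.stalk v)
      (V.presheaf.germ c.dom v hv (c.coord i)) :=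
  Module.Basis.mk_apply _ _ _

/-- The Jacobian matrix at a local point of the coordinates of one chart with respect
to another one. -/
def Chart.jacobian (c c' : Chart V n p) (x : LocalPoints V p) (hx : x.pt ∈ c.dom)
    (hx' : x.pt ∈ c'.dom) : Matrix (Fin n) (Fin n) p.completion :=
  Matrix.of fun i j => Points.hom x ((c.basis _ hx).toMatrix (c'.basis _ hx') j i)

lemma Chart.det_jacobian (c c' : Chart V n p) (x : LocalPoints V p) (hx : x.pt ∈ c.dom)
    (hx' : x.pt ∈ c'.dom) : (c.jacobian c' x hx hx').det =
      Points.hom x ((c.basis _ hx).det (c'.basis _ hx')) := by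
  rw [Module.Basis.det_apply, RingHom.map_det, ← Matrix.det_transpose]
  rfl

/-- Both forms are determinants with respect to bases of differentials, so they differ by the
determinant of the change of basis, whose value at `x` is the determinant of the Jacobian. -/
lemma Chart.norm_partials (c c' : Chart V n p) (m : PadicMetric V n p) (x : LocalPoints V p)
    (hx : x.pt ∈ c.dom) (hx' : x.pt ∈ c'.dom) :
    m.norm x ((c.partials _ hx).toFibre x) =
      p.abs (c.jacobian c' x hx hx').det * m.norm x ((c'.partials _ hx').toFibre x) := by
  rw [c.det_jacobian c' x hx hx']
  refine Eq.trans (congrArg (m.norm x) ?_) (m.norm_smul x _ _)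
  have h := (c.basis _ hx).det.eq_smul_basis_det (c'.basis _ hx')
  ext w
  have := congrArg (fun f => Points.hom x (f w)) h
  simp only [AlternatingMap.smul_apply, smul_eq_mul, map_mul] at this
  exact this

/-- The expansion of the differentials of the other chart in the basis given by the étale
coordinates passes to increments by `sub_sum_mem_smallAt`. -/
lemma hasStrictJacobian_diskMap (c' : Chart V n p) (P₀ : M.disk y) (hP₀ : P₀.1.pt ∈ c'.dom) :
    HasStrictJacobian (Φ.diskMap hy) (fun P => c'.coordMap P.1)
      ((Φ.diskChart hy).jacobian c' P₀.1 ((Φ.diskChart hy).pt_mem P₀.1 P₀.2) hP₀) P₀ := by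
  intro i
  have hval : Tendsto (Subtype.val : M.disk y → LocalPoints V p) (𝓝 P₀) (𝓝 P₀.1) :=
    continuous_subtype_val.continuousAt
  have hP := (Φ.diskChart hy).pt_mem P₀.1 P₀.2
  have hmain := sub_sum_mem_smallAt (X := Φ.diskMap hy) (P₀ := P₀) p.valued_surjective
    (F := C.functionField) (fun b P => evalGerm P₀.1 b P.1) (Points.hom P₀.1)
    (fun b b' => (hval.eventually (evalGerm_map₂ P₀.1 b b')).mono fun _ h => h.1)
    (fun b b' => (hval.eventually (evalGerm_map₂ P₀.1 b b')).mono fun _ h => h.2)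
    (fun c => hval.eventually (evalGerm_algebraMap P₀.1 c))
    (fun b => (tendsto_evalGerm P₀.1 b).comp hval)
    (Φ.isLipAt_evalGerm hy P₀)
    (V.presheaf.germ c'.dom _ hP₀ (c'.coord i))
    (fun j => ((Φ.diskChart hy).basis _ hP).toMatrix (c'.basis _ hP₀) j i)
    (fun j => V.presheaf.germ _ _ hP (Φ.coord j)) (by
      rw [← c'.basis_apply]
      refine (((Φ.diskChart hy).basis _ hP).sum_toMatrix_smul_self (c'.basis _ hP₀) i).symm.trans ?_
      exact Finset.sum_congr rfl fun j _ => congrArg _ ((Φ.diskChart hy).basis_apply _ hP j))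
  have hev : ∀ᶠ P in 𝓝 P₀, (∀ j, evalGerm P₀.1 (V.presheaf.germ _ _ hP (Φ.coord j)) P.1 =
      Φ.diskMap hy P j) ∧ evalGerm P₀.1 (V.presheaf.germ c'.dom _ hP₀ (c'.coord i)) P.1 =
      c'.coordMap P.1 i := by
    refine (eventually_all.2 fun j => ?_).and ?_
    · filter_upwards [hval.eventually (evalGerm_germ P₀.1 hP (Φ.coord j))] with P h
      exact h.2
    · filter_upwards [hval.eventually (evalGerm_germ P₀.1 hP₀ (c'.coord i))] with P h
      rw [h.2, Chart.coordMap, dif_pos h.1]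
  refine (Submodule.sub_mem_iff_left _ hmain).1 (mem_smallAt_of_eventually_eq_zero ?_)
  filter_upwards [hev.prod_inl (𝓝 P₀), hev.prod_inr (𝓝 P₀)] with z h1 h2
  simp only [Pi.sub_apply, h1.2, h2.2, h1.1, h2.1]
  exact sub_self _

end Comparison

end Tamagawa

namespace Tamagawa

/-! ### The local measure on the residue disks -/

section Measure

open IsLocalRing Filter Topology

/-- By the Lindelöf property countably many of the sets `A` cover `S`; a Borel set is cut into
disjoint pieces, each inside one of them. -/
lemma measure_le_of_forall_exists_isOpen {X : Type*} [TopologicalSpace X] [MeasurableSpace X]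
    [OpensMeasurableSpace X] {μ ν : Measure X} {S : Set X} [SecondCountableTopology S]
    (hS : ν Sᶜ = 0) (h : ∀ x ∈ S, ∃ A, IsOpen A ∧ x ∈ A ∧
      ∀ B ⊆ A, MeasurableSet B → ν B ≤ μ B) : ν ≤ μ := by
  choose! A hAo hA hle using h
  obtain ⟨t, ht, htS⟩ := TopologicalSpace.countable_cover_nhds
    (f := fun x : S => (Subtype.val ⁻¹' A x.1 : Set S))
    fun x => ((hAo x.1 x.2).preimage continuous_subtype_val).mem_nhds (hA x.1 x.2)
  have : Countable t := ht
  obtain ⟨g, hg⟩ : ∃ g : ℕ → Option t, Function.Surjective g := exists_surjective_nat _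
  let O : ℕ → Set X := fun i => (g i).elim ∅ fun x => A x.1.1
  have hO (i) : MeasurableSet (O i) := by
    simp only [O]
    rcases g i with _ | x
    · exact MeasurableSet.empty
    · exact (hAo _ x.1.2).measurableSet
  have hcov : S ⊆ ⋃ i, O i := by
    intro x hx
    have : (⟨x, hx⟩ : S) ∈ ⋃ z ∈ t, (Subtype.val ⁻¹' A z.1 : Set S) := htS ▸ trivial
    obtain ⟨z, hz, hxz⟩ := Set.mem_iUnion₂.1 this
    obtain ⟨i, hi⟩ := hg (some ⟨z, hz⟩)
    exact Set.mem_iUnion.2 ⟨i, by simpa [O, hi] using hxz⟩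
  refine Measure.le_iff.2 fun B hB => ?_
  have hdisj : Pairwise (Function.onFun Disjoint fun i => B ∩ disjointed O i) := fun i j hij =>
    (disjoint_disjointed O hij).mono Set.inter_subset_right Set.inter_subset_right
  have hmeas (i) : MeasurableSet (B ∩ disjointed O i) := hB.inter (.disjointed hO i)
  calc ν B ≤ ν (⋃ i, B ∩ disjointed O i) + ν Sᶜ := by
        refine (measure_mono fun x hx => ?_).trans (measure_union_le _ _)
        by_cases hxS : x ∈ S
        · refine Or.inl ?_
          rw [← Set.inter_iUnion, iUnion_disjointed]
          exact ⟨hx, hcov hxS⟩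
        · exact Or.inr hxS
    _ = ∑' i, ν (B ∩ disjointed O i) := by rw [hS, add_zero, measure_iUnion hdisj hmeas]
    _ ≤ ∑' i, μ (B ∩ disjointed O i) := by
        refine ENNReal.tsum_le_tsum fun i => ?_
        have hsub : B ∩ disjointed O i ⊆ O i :=
          Set.inter_subset_right.trans (disjointed_subset O i)
        have hm := hmeas i
        revert hsub hm
        generalize B ∩ disjointed O i = B'
        simp only [O]
        rcases g i with _ | x
        · intro hsub _
          rw [Set.subset_empty_iff.1 hsub]
          simp
        · exact hle _ x.1.2 B'
    _ = μ (⋃ i, B ∩ disjointed O i) := (measure_iUnion hdisj hmeas).symm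
    _ ≤ μ B := measure_mono (Set.iUnion_subset fun _ => Set.inter_subset_left)

variable {C : Scheme.{u}} [IsIntegral C] [IsNonsingularCurve C] {p : Place C}
  {V : Scheme.{u}} [V.Over (Spec C.functionField)] {M : Model C V} {n : ℕ}

lemma Chart.measure_compl_source (c : Chart V n p) (m : PadicMetric V n p) :
    c.measure m c.sourceᶜ = 0 := by
  rw [Chart.measure, Measure.map_apply measurable_subtype_coe
    c.isOpen_source.measurableSet.compl]
  have : (Subtype.val ⁻¹' c.sourceᶜ : Set c.source) = ∅ := by
    ext x
    simp
  rw [this, measure_empty]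

lemma Model.mem_disk_unique {y y' : M.ResiduePoints p} {x : LocalPoints V p}
    (h : x ∈ M.disk y) (h' : x ∈ M.disk y') : y = y' := by
  obtain ⟨xt, hxt, hy⟩ := h
  obtain ⟨xt', hxt', hy'⟩ := h'
  rw [M.extends_unique x hxt hxt'] at hy
  exact Subtype.ext (hy.symm.trans hy')

lemma Model.exists_mem_disk_of_mem_base (M : Model C V) (hp : p.1 ∈ M.base)
    (x : LocalPoints V p) : ∃ y, x ∈ M.disk y := by
  obtain ⟨xt, hxt⟩ := M.exists_extends hp x
  refine ⟨⟨p.specReduction ≫ xt, ?_⟩, xt, hxt, rfl⟩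
  rw [Category.assoc, hxt.1, p.specReduction_specIntegers]

variable [Finite (C.residueField p.1)]

/-- On sets where the density is constant no measurability of the norm is needed. -/
lemma Chart.measure_apply_of_const (c : Chart V n p) (m : PadicMetric V n p)
    {B : Set (LocalPoints V p)} (hB : MeasurableSet B) {r : ℝ≥0∞}
    (hr : ∀ x ∈ B, ∀ hx : x ∈ c.source,
      ENNReal.ofReal (m.norm x ((c.partials x.pt (c.pt_mem x hx)).toFibre x)) = r) :
    c.measure m B = r * p.haarPi n (c.toFun '' (Subtype.val ⁻¹' B)) := by
  have hB' : MeasurableSet (Subtype.val ⁻¹' B : Set c.source) := measurable_subtype_coe hB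
  have he : MeasurableEmbedding c.toFun := c.isOpenEmbedding.measurableEmbedding
  rw [Chart.measure, Measure.map_apply measurable_subtype_coe hB, withDensity_apply _ hB',
    setLIntegral_congr_fun hB' (g := fun _ => r) fun x hx => hr x.1 hx x.2, setLIntegral_const,
    he.comap_apply]

variable (Φ : CoordSystem M n) {y : M.ResiduePoints p} (hy : y.pt ∈ Φ.U)

lemma CoordSystem.measure_diskChart_univ (m : PadicMetric V n p)
    (hm : ∀ x (hx : x ∈ M.disk y), m.norm x (((Φ.diskChart hy).partials x.pt
      ((Φ.diskChart hy).pt_mem x hx)).toFibre x) = 1) :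
    (Φ.diskChart hy).measure m Set.univ = ((p.card : ℝ≥0∞) ^ n)⁻¹ := by
  rw [(Φ.diskChart hy).measure_apply_of_const m MeasurableSet.univ (r := 1)
    fun x _ hx => by rw [hm x hx, ENNReal.ofReal_one], Set.preimage_univ, Set.image_univ, one_mul]
  exact Φ.haarPi_range_diskMap hy

/-- This is the half of the change of variables formula needed to bound the supremum over all
charts. The metric has norm one on the disk chart, so the density of `c'` at a point is the inverse
absolute value of the Jacobian determinant. -/
lemma CoordSystem.exists_isOpen_measure_le (m : PadicMetric V n p)
    (hm : ∀ x (hx : x ∈ M.disk y), m.norm x (((Φ.diskChart hy).partials x.pt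
      ((Φ.diskChart hy).pt_mem x hx)).toFibre x) = 1) (c' : Chart V n p) (x₀ : LocalPoints V p)
    (hx₀ : x₀ ∈ M.disk y) (hx₀' : x₀ ∈ c'.source) :
    ∃ A, IsOpen A ∧ x₀ ∈ A ∧ ∀ B ⊆ A, MeasurableSet B →
      c'.measure m B ≤ (Φ.diskChart hy).measure m B := by
  let P₀ : M.disk y := ⟨x₀, hx₀⟩
  let J (P : M.disk y) (hP : P.1 ∈ c'.source) :=
    (Φ.diskChart hy).jacobian c' P.1 ((Φ.diskChart hy).pt_mem P.1 P.2) (c'.pt_mem P.1 hP)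
  have hnorm (P : M.disk y) (hP : P.1 ∈ c'.source) : p.abs (J P hP).det *
      m.norm P.1 ((c'.partials P.1.pt (c'.pt_mem P.1 hP)).toFibre P.1) = 1 := by
    rw [← hm P.1 P.2]
    exact ((Φ.diskChart hy).norm_partials c' m P.1 _ _).symm
  have hdet (P : M.disk y) (hP : P.1 ∈ c'.source) : (J P hP).det ≠ 0 := by
    intro h0
    have := hnorm P hP
    rw [h0] at this
    simp [Place.abs] at this
  -- After this linear correction the coordinates of `c'` have Jacobian 1 at `x₀` with respect to
  -- the étale coordinates.
  let T := (J P₀ hx₀')⁻¹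
  have hT : T * J P₀ hx₀' = 1 := Matrix.nonsing_inv_mul _ (isUnit_iff_ne_zero.2 (hdet P₀ hx₀'))
  have hTdet : T.det ≠ 0 := by
    intro h0
    have := congrArg Matrix.det hT
    rw [Matrix.det_mul, h0, zero_mul, Matrix.det_one] at this
    exact zero_ne_one this
  let X := Φ.diskMap hy
  let G : M.disk y → Fin n → p.completion := fun P => T.mulVec (c'.coordMap P.1)
  have hJac (P : M.disk y) (hP : P.1 ∈ c'.source) : HasStrictJacobian X G (T * J P hP) P :=
    (hasStrictJacobian_diskMap Φ hy c' P (c'.pt_mem P.1 hP)).mulVec T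
  obtain ⟨A₀, hA₀, hA₀'⟩ := (hJac P₀ hx₀').exists_nhds
  simp only [hT, Matrix.one_mulVec] at hA₀'
  obtain ⟨A₁, hA₁₀, hA₁, hP₀⟩ := mem_nhds_iff.1 hA₀
  have hnonexp (P) (hP : P ∈ A₁) (Q) (hQ : Q ∈ A₁) := hA₀' P (hA₁₀ hP) Q (hA₁₀ hQ)
  -- On all of `A₁` the increments of `G` approximate those of `X`, so the Jacobian `T * J P` has
  -- determinant of absolute value one at each `P`. Hence the density is constant there.
  have hdens (P : M.disk y) (hPA : P ∈ A₁) (hP : P.1 ∈ c'.source) :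
      m.norm P.1 ((c'.partials P.1.pt (c'.pt_mem P.1 hP)).toFibre P.1) = p.abs T.det := by
    have h1 := (hJac P hP).valued_det_eq_one p.valued_surjective
      ((Φ.isOpenEmbedding_diskMap hy).map_nhds_eq P) (hA₁.mem_nhds hPA) hnonexp
    have h2 := p.abs_eq_one h1
    rw [Matrix.det_mul, p.abs_mul] at h2
    have h3 := hnorm P hP
    have h4 : p.abs (J P hP).det ≠ 0 := by
      rintro h0
      rw [h0, zero_mul] at h3
      exact zero_ne_one h3
    rw [mul_comm] at h2
    exact mul_left_cancel₀ h4 (h3.trans h2.symm)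
  refine ⟨Subtype.val '' A₁ ∩ c'.source,
    ((Φ.isOpen_disk hy).isOpenMap_subtype_val _ hA₁).inter c'.isOpen_source,
    ⟨⟨P₀, hP₀, rfl⟩, hx₀'⟩, fun B hBA hB => ?_⟩
  -- The constant density is the scaling factor of `T`. The claim becomes that the image of `B`
  -- under `G` has at most the volume of its image under `X`, which holds because `G` does not
  -- expand distances.
  rw [(Φ.diskChart hy).measure_apply_of_const m hB (r := 1)
    fun x _ hx => by rw [hm x hx, ENNReal.ofReal_one],
    c'.measure_apply_of_const m hB (r := ENNReal.ofReal (p.abs T.det)) fun x hxB hx => by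
      obtain ⟨P, hP, rfl⟩ := (hBA hxB).1
      rw [hdens P hP hx], ← p.haarPi_image_mulVec T hTdet, one_mul]
  have himg : T.mulVec '' (c'.toFun '' (Subtype.val ⁻¹' B)) =
      G '' (Subtype.val ⁻¹' B : Set (M.disk y)) := by
    rw [Set.image_image]
    have hG (x : c'.source) (P : M.disk y) (h : x.1 = P.1) : T.mulVec (c'.toFun x) = G P := by
      have : c'.toFun x = c'.coordMap P.1 := by
        funext i
        rw [← h, Chart.coordMap, dif_pos (c'.pt_mem x.1 x.2)]
        rfl
      rw [this]
    ext w
    constructor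
    · rintro ⟨x, hx, rfl⟩
      obtain ⟨P, hP, hPx⟩ := (hBA hx).1
      exact ⟨P, by rw [Set.mem_preimage, hPx]; exact hx, (hG x P hPx.symm).symm⟩
    · rintro ⟨P, hP, rfl⟩
      exact ⟨⟨P.1, (hBA hP).2⟩, hP, hG _ P rfl⟩
  rw [himg]
  refine measure_image_le_of_nonexpanding p.valued_surjective (p.haarPi n) X G _
    fun P hP Q hQ k hk => ?_
  have hmem (P : M.disk y) (hP : P.1 ∈ B) : P ∈ A₁ := by
    obtain ⟨P', hP', h⟩ := (hBA hP).1
    rwa [← Subtype.ext h]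
  have := hnonexp P (hmem P hP) Q (hmem Q hQ) k hk
  simpa using add_mem (lattice_antitone (by lia : k ≤ k + 1) this) hk

/-- The volume of the set of local points, when every residue disk has étale coordinates with
respect to which the metric is trivial. -/
theorem localMeasure_univ_eq_density (hp : p.1 ∈ M.base) [Finite (M.ResiduePoints p)]
    (m : PadicMetric V n p) (Φ : M.ResiduePoints p → CoordSystem M n)
    (hy : ∀ y : M.ResiduePoints p, y.pt ∈ (Φ y).U)
    (hm : ∀ y x (hx : x ∈ M.disk y), m.norm x ((((Φ y).diskChart (hy y)).partials x.pt
      (((Φ y).diskChart (hy y)).pt_mem x hx)).toFibre x) = 1) :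
    localMeasure m Set.univ = M.density n p := by
  have := Fintype.ofFinite (M.ResiduePoints p)
  let μ := ∑ y, ((Φ y).diskChart (hy y)).measure m
  have htotal : μ Set.univ = M.density n p := by
    simp only [μ, Measure.coe_finsetSum, Finset.sum_apply]
    rw [Finset.sum_congr rfl fun y _ => (Φ y).measure_diskChart_univ (hy y) m (hm y)]
    simp [Model.density, div_eq_mul_inv]
  have hle (y) : ((Φ y).diskChart (hy y)).measure m ≤ μ :=
    Finset.single_le_sum (f := fun y => ((Φ y).diskChart (hy y)).measure m)
      (fun _ _ => Measure.zero_le _) (Finset.mem_univ y)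
  refine le_antisymm ?_ ?_
  · rw [← htotal]
    -- Upper bound: every chart measure is locally dominated by that of the disk chart around the
    -- point, hence by the sum `μ`.
    refine (iSup_le fun c' => ?_ : localMeasure m ≤ μ) Set.univ
    have : SecondCountableTopology c'.source :=
      c'.isOpenEmbedding.isEmbedding.secondCountableTopology
    refine measure_le_of_forall_exists_isOpen (S := c'.source) (c'.measure_compl_source m)
      fun x hx => ?_
    obtain ⟨y, hxy⟩ := M.exists_mem_disk_of_mem_base hp x
    obtain ⟨A, hA, hxA, h⟩ := (Φ y).exists_isOpen_measure_le (hy y) m (hm y) c' x hxy hx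
    exact ⟨A, hA, hxA, fun B hB hBm => (h B hB hBm).trans (hle y B)⟩
  · rw [← htotal]
    have hdisj : Pairwise (Function.onFun Disjoint fun y : M.ResiduePoints p => M.disk y) :=
      fun y y' hyy' => Set.disjoint_left.2 fun x hx hx' => hyy' (Model.mem_disk_unique hx hx')
    have hmeas (y : M.ResiduePoints p) : MeasurableSet (M.disk y) :=
      ((Φ y).isOpen_disk (hy y)).measurableSet
    calc μ Set.univ = ∑ y, ((Φ y).diskChart (hy y)).measure m Set.univ := by
          simp only [μ, Measure.coe_finsetSum, Finset.sum_apply]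
      _ ≤ ∑ y, localMeasure m (M.disk y) := by
          refine Finset.sum_le_sum fun y _ => ?_
          have h0 : ((Φ y).diskChart (hy y)).measure m Set.univ =
              ((Φ y).diskChart (hy y)).measure m (M.disk y) := by
            rw [← measure_add_measure_compl (hmeas y)]
            exact (congrArg _ (((Φ y).diskChart (hy y)).measure_compl_source m)).trans
              (add_zero _)
          rw [h0]
          exact (le_iSup (fun c : Chart V n p => c.measure m) ((Φ y).diskChart (hy y))) _
      _ = localMeasure m (⋃ y, M.disk y) := by
          rw [measure_iUnion hdisj hmeas, tsum_fintype]
      _ ≤ localMeasure m Set.univ := measure_mono (Set.subset_univ _)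

end Measure

end Tamagawa

namespace Tamagawa

/-! ### Comparison of two models near the generic fibre -/

section Spread

variable {C : Scheme.{u}} [IsIntegral C] {V : Scheme.{u}} [V.Over (Spec C.functionField)]

lemma Model.locallyOfFiniteType (M : Model C V) : LocallyOfFiniteType M.toCurve := by
  have := M.smooth
  infer_instance

/-- The identity of the generic fibre extends to a morphism between two models,
in a neighbourhood of a point of the generic fibre. -/
lemma Model.exists_spread [IsLocallyNoetherian C] (M M' : Model C V) (v : V) :
    ∃ (U : M.space.Opens) (f : U.toScheme ⟶ M'.space) (N : V.Opens), M.incl v ∈ U ∧ v ∈ N ∧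
      f ≫ M'.toCurve = U.ι ≫ M.toCurve ∧
      ∀ (T : Scheme.{u}) (t : T ⟶ U.toScheme) (w : T ⟶ V), (∀ z, w z ∈ N) →
        t ≫ U.ι = w ≫ M.incl → t ≫ f = w ≫ M'.incl := by
  have := M.locallyOfFiniteType
  have := M'.locallyOfFiniteType
  have : IsLocallyNoetherian M.space := LocallyOfFiniteType.isLocallyNoetherian M.toCurve
  have hsm : LocallyOfFiniteType (V ↘ Spec C.functionField) :=
    MorphismProperty.of_isPullback (P := @LocallyOfFiniteType) M.isPullback inferInstance
  have : IsLocallyNoetherian V := LocallyOfFiniteType.isLocallyNoetherian (V ↘ Spec C.functionField)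
  -- The stalks of M and V at `v` are isomorphic, so the inclusion of V in `M'` gives a morphism
  -- from the local scheme of M at `v`. It spreads out because M' is locally of finite type over C.
  let φ : Spec (M.space.presheaf.stalk (M.incl v)) ⟶ M'.space :=
    Spec.map (inv (M.incl.stalkMap v)) ≫ V.fromSpecStalk v ≫ M'.incl
  have hφ : Spec.map (M.incl.stalkMap v) ≫ φ = V.fromSpecStalk v ≫ M'.incl := by
    rw [← Spec.map_comp_assoc, IsIso.inv_hom_id, Spec.map_id, Category.id_comp]
  have hφ' : φ ≫ M'.toCurve = M.space.fromSpecStalk (M.incl v) ≫ M.toCurve := by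
    have : IsIso (Spec.map (M.incl.stalkMap v)) := inferInstance
    rw [← cancel_epi (Spec.map (M.incl.stalkMap v)), ← Category.assoc, hφ, Category.assoc,
      M'.isPullback.w, ← M.isPullback.w, Scheme.SpecMap_stalkMap_fromSpecStalk_assoc]
  obtain ⟨U, hU, f, hf, hfC⟩ := spread_out_of_isGermInjective' M.toCurve M'.toCurve φ hφ'
  let Q : V.Opens := M.incl ⁻¹ᵁ U
  let v' : Q.toScheme := ⟨v, hU⟩
  obtain ⟨q, hq⟩ : ∃ q : Spec (Q.toScheme.presheaf.stalk v') ⟶ Spec (V.presheaf.stalk v),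
      q ≫ V.fromSpecStalk v = Q.toScheme.fromSpecStalk v' ≫ Q.ι :=
    ⟨Spec.map (Q.ι.stalkMap v'), Scheme.SpecMap_stalkMap_fromSpecStalk Q.ι⟩
  have hres : Q.toScheme.fromSpecStalk v' ≫ (M.incl ∣_ U) =
      q ≫ Spec.map (M.incl.stalkMap v) ≫ U.fromSpecStalkOfMem _ hU := by
    rw [← cancel_mono U.ι]
    simp only [Category.assoc, morphismRestrict_ι, Scheme.Opens.fromSpecStalkOfMem_ι]
    rw [Scheme.SpecMap_stalkMap_fromSpecStalk, ← Category.assoc, ← Category.assoc, hq]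
  have hcomp : Q.toScheme.fromSpecStalk v' ≫ (M.incl ∣_ U) ≫ f =
      Q.toScheme.fromSpecStalk v' ≫ Q.ι ≫ M'.incl := by
    rw [← Category.assoc, hres, Category.assoc, Category.assoc, ← hf, hφ, ← Category.assoc, hq,
      Category.assoc]
  -- The spread-out morphism and the inclusion in `M'` agree on the local scheme of V at `v`, hence
  -- on an open neighbourhood of `v`, but not necessarily on the whole preimage of `U`.
  obtain ⟨N, hN, hNeq⟩ := spread_out_unique_of_isGermInjective' (x := v') _ _ hcomp
  refine ⟨U, f, Q.ι ''ᵁ N, hU, ⟨v', hN, rfl⟩, hfC, fun T t w hw ht => ?_⟩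
  have hrange : Set.range w ⊆ Set.range (N.ι ≫ Q.ι) := by
    rintro _ ⟨z, rfl⟩
    obtain ⟨q, hq, hqz⟩ := hw z
    exact ⟨⟨q, hq⟩, hqz⟩
  let w' := IsOpenImmersion.lift (N.ι ≫ Q.ι) w hrange
  have hw' : w' ≫ N.ι ≫ Q.ι = w := IsOpenImmersion.lift_fac _ _ _
  have ht' : t = w' ≫ N.ι ≫ (M.incl ∣_ U) := by
    rw [← cancel_mono U.ι, ht, Category.assoc, Category.assoc, morphismRestrict_ι, ← hw']
    simp only [Category.assoc]
    rfl
  rw [ht', Category.assoc, Category.assoc, hNeq, ← hw']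
  simp only [Category.assoc]

end Spread

end Tamagawa

namespace Tamagawa

/-! ### Coordinates adapted to a model of the anticanonical sheaf -/

section Adapted

open IsLocalRing

variable {C : Scheme.{u}} [IsIntegral C] {V : Scheme.{u}} [V.Over (Spec C.functionField)]
  {M M' : Model C V} {n : ℕ}

lemma CoordSystem.germ_coord_basicOpen (Φ : CoordSystem M n) (s : Γ(M.space, Φ.U)) (v : V)
    (hv : v ∈ M.incl ⁻¹ᵁ (Φ.basicOpen s).U) (hv' : v ∈ M.incl ⁻¹ᵁ Φ.U) (j : Fin n) :
    V.presheaf.germ _ v hv ((Φ.basicOpen s).coord j) = V.presheaf.germ _ v hv' (Φ.coord j) := by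
  refine (Scheme.Hom.germ_stalkMap_apply M.incl _ v hv _).symm.trans ?_
  refine Eq.trans (congrArg _ ?_) (Scheme.Hom.germ_stalkMap_apply M.incl _ v hv' _)
  exact M.space.presheaf.germ_res_apply _ _ _ _

/-- Near a point of the generic fibre there are étale coordinates such that the generator of
a model of the anticanonical sheaf is a quotient of two invertible functions, times the
dual of the differentials of the coordinates. -/
lemma CoordSystem.exists_adapted [IsLocallyNoetherian C]
    [SmoothOfRelativeDimension n (V ↘ Spec C.functionField)] (M : Model C V)
    (L : AnticanModel M' n) (v : V) :
    ∃ (U : M.space.Opens) (f : U.toScheme ⟶ M'.space) (N : V.Opens)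
      (Φ : CoordSystem M n) (i : L.ι) (a s : Γ(M.space, Φ.U)),
      M.incl v ∈ Φ.U ∧ f ≫ M'.toCurve = U.ι ≫ M.toCurve ∧
      (∀ (T : Scheme.{u}) (t : T ⟶ U.toScheme) (w : T ⟶ V), (∀ z, w z ∈ N) →
        t ≫ U.ι = w ≫ M.incl → t ≫ f = w ≫ M'.incl) ∧
      Φ.U ≤ U.ι ''ᵁ (f ⁻¹ᵁ L.cover i) ∧ M.incl ⁻¹ᵁ Φ.U ≤ N ∧ IsUnit a ∧ IsUnit s ∧
      ∀ (w : V) (hw : w ∈ M.incl ⁻¹ᵁ Φ.U), ∃ hw' : w ∈ M'.incl ⁻¹ᵁ L.cover i,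
        V.presheaf.germ _ w hw (M.incl.app Φ.U s) * (L.frame i).germ w hw'
          (fun j => KaehlerDifferential.D C.functionField (V.presheaf.stalk w)
            (V.presheaf.germ _ w hw (Φ.coord j))) =
        V.presheaf.germ _ w hw (M.incl.app Φ.U a) := by
  obtain ⟨U, f, N, hvU, hvN, hf, hT⟩ := M.exists_spread M' v
  obtain ⟨Φ₀, hv₀⟩ := CoordSystem.exists (n := n) M v
  obtain ⟨i, hi⟩ : ∃ i, f ⟨M.incl v, hvU⟩ ∈ L.cover i := by
    have : f ⟨M.incl v, hvU⟩ ∈ ⨆ i, L.cover i := L.iSup_cover ▸ trivial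
    simpa using this
  obtain ⟨N', hvN', hN'⟩ := M.exists_opens v hvN
  obtain ⟨s₁, hs₁, hvs₁⟩ := Φ₀.isAffineOpen_U.exists_basicOpen_le
    (V := N' ⊓ U.ι ''ᵁ (f ⁻¹ᵁ L.cover i)) ⟨M.incl v, hvN', ⟨M.incl v, hvU⟩, hi, rfl⟩ hv₀
  let Φ₁ := Φ₀.basicOpen s₁
  replace hvs₁ : M.incl v ∈ Φ₁.U := hvs₁
  have hN₁ : M.incl ⁻¹ᵁ Φ₁.U ≤ N := (M.incl.preimage_mono (hs₁.trans inf_le_left)).trans hN'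
  have hle : Φ₁.U ≤ U.ι ''ᵁ (f ⁻¹ᵁ L.cover i) := hs₁.trans inf_le_right
  have hcov : M.incl ⁻¹ᵁ Φ₁.U ≤ M'.incl ⁻¹ᵁ L.cover i := by
    let Q := M.incl ⁻¹ᵁ Φ₁.U
    have hrange : Set.range (Q.ι ≫ M.incl) ⊆ Set.range U.ι := by
      rintro _ ⟨q, rfl⟩
      obtain ⟨z, -, hz⟩ := hle q.2
      exact ⟨z, hz⟩
    let t := IsOpenImmersion.lift U.ι (Q.ι ≫ M.incl) hrange
    have ht : t ≫ U.ι = Q.ι ≫ M.incl := IsOpenImmersion.lift_fac _ _ _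
    have htf := hT _ t Q.ι (fun z => hN₁ z.2) ht
    intro w hw
    have h1 : U.ι (t ⟨w, hw⟩) = M.incl w := congrArg (fun g : Q.toScheme ⟶ M.space => g ⟨w, hw⟩) ht
    have h2 : f (t ⟨w, hw⟩) = M'.incl w :=
      congrArg (fun g : Q.toScheme ⟶ M'.space => g ⟨w, hw⟩) htf
    obtain ⟨z, hz, hz'⟩ := hle hw
    have h3 : z = t ⟨w, hw⟩ := U.ι.isOpenEmbedding.injective (hz'.trans h1.symm)
    change M'.incl w ∈ L.cover i
    rw [← h2, ← h3]
    exact hz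
  obtain ⟨b, hb⟩ := (L.frame i).isRegular (M.incl ⁻¹ᵁ Φ₁.U) hcov Φ₁.coord
  -- The determinant form takes the value 1 on the basis of differentials and is a multiple of the
  -- generator, so the value of the generator on that basis is a unit at `v`.
  have hunit : IsUnit (V.presheaf.germ _ v hvs₁ b) := by
    obtain ⟨β, hβ⟩ := Φ₁.exists_basis v hvs₁
    obtain ⟨α, hα⟩ := L.generates i v (hcov hvs₁) β.det
    have h1 := congrArg (fun g => g β) hα
    simp only [Module.Basis.det_self, AlternatingMap.smul_apply, smul_eq_mul] at h1
    have h2 := hb v hvs₁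
    rw [← (funext hβ : ⇑β = _)] at h2
    rw [h2] at h1
    exact IsUnit.of_mul_eq_one_right α h1.symm
  obtain ⟨a, s, hvs, -, hfrac⟩ := M.exists_fraction Φ₁.isAffineOpen_U v hvs₁ _ hvs₁ b
  have hva : M.incl v ∈ M.space.basicOpen a := by
    rw [M.space.mem_basicOpen _ _ hvs₁]
    refine (isUnit_map_iff (M.incl.stalkMap v).hom _).1 ?_
    have h1 := hfrac v hvs₁ hvs₁ hvs
    have h2 : IsUnit (V.presheaf.germ _ v hvs₁ (M.incl.app Φ₁.U s)) := by
      rw [M.space.mem_basicOpen _ _ hvs₁] at hvs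
      have := hvs.map (M.incl.stalkMap v).hom
      exact (Scheme.Hom.germ_stalkMap_apply M.incl Φ₁.U v hvs₁ s) ▸ this
    have h3 := hunit.mul h2
    rw [h1] at h3
    exact (Scheme.Hom.germ_stalkMap_apply M.incl Φ₁.U v hvs₁ a).symm ▸ h3
  -- Numerator and denominator are both invertible at `M.incl v`; restriction to the basic open set
  -- of their product makes them invertible functions.
  have hbas := M.space.basicOpen_mul a s
  let r := M.space.presheaf.map (homOfLE (M.space.basicOpen_le (a * s))).op
  have hr (t : Γ(M.space, Φ₁.U)) (w : V) (hw : w ∈ M.incl ⁻¹ᵁ M.space.basicOpen (a * s))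
      (hw' : w ∈ M.incl ⁻¹ᵁ Φ₁.U) :
      V.presheaf.germ _ w hw (M.incl.app (M.space.basicOpen (a * s)) (r t)) =
        V.presheaf.germ _ w hw' (M.incl.app Φ₁.U t) := by
    refine (Scheme.Hom.germ_stalkMap_apply M.incl _ w hw _).symm.trans ?_
    refine Eq.trans (congrArg _ ?_) (Scheme.Hom.germ_stalkMap_apply M.incl _ w hw' _)
    exact M.space.presheaf.germ_res_apply _ _ _ _
  have hru : IsUnit (r a * r s) := by
    rw [← map_mul]
    exact RingedSpace.isUnit_res_basicOpen M.space.toRingedSpace (a * s)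
  refine ⟨U, f, N, Φ₁.basicOpen (a * s), i, r a, r s, ?_, hf, hT,
    (M.space.basicOpen_le _).trans hle,
    (M.incl.preimage_mono (M.space.basicOpen_le _)).trans hN₁,
    isUnit_of_mul_isUnit_left hru, isUnit_of_mul_isUnit_right hru, fun w hw => ?_⟩
  · change _ ∈ M.space.basicOpen (a * s)
    rw [hbas]
    exact ⟨hva, hvs⟩
  · have hw₁ : w ∈ M.incl ⁻¹ᵁ Φ₁.U := M.space.basicOpen_le _ hw
    refine ⟨hcov hw₁, ?_⟩
    simp only [Φ₁.germ_coord_basicOpen (a * s) w hw hw₁]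
    rw [hb w hw₁]
    have hws : w ∈ M.incl ⁻¹ᵁ M.space.basicOpen s := (hbas.trans_le inf_le_right) hw
    have := hfrac w hw₁ hw₁ hws
    rw [mul_comm] at this
    exact (congrArg (· * _) (hr s w hw hw₁)).trans (this.trans (hr a w hw hw₁).symm)

variable [IsNonsingularCurve C]

lemma Model.valued_valHom_eq_one {p : Place C} {y : M.ResiduePoints p} {x : LocalPoints V p}
    (h : x ∈ M.disk y) {U : M.space.Opens} (hU : IsAffineOpen U) (hy : y.pt ∈ U)
    (hx : x.pt ∈ M.incl ⁻¹ᵁ U) {t : Γ(M.space, U)} (ht : IsUnit t) :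
    Valued.v (M.valHom x hx t) = 1 := by
  refine le_antisymm (M.valued_valHom_le_one h hU hy hx t) ?_
  obtain ⟨t', ht'⟩ := ht.exists_right_inv
  have h1 := congrArg (fun z => Valued.v (M.valHom x hx z)) ht'
  simp only [map_mul, map_one] at h1
  rw [← h1]
  exact (mul_le_mul' le_rfl (M.valued_valHom_le_one h hU hy hx t')).trans (mul_one _).le

/-- Near a point of the generic fibre there are étale coordinates with respect to which
the metrics defined by a model of the anticanonical sheaf are trivial. -/
theorem CoordSystem.exists_norm_eq_one [IsLocallyNoetherian C]
    [SmoothOfRelativeDimension n (V ↘ Spec C.functionField)] (M : Model C V)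
    (L : AnticanModel M' n) (v : V) :
    ∃ Φ : CoordSystem M n, M.incl v ∈ Φ.U ∧ ∀ (p : Place C) [Finite (C.residueField p.1)]
      (m : PadicMetric V n p), m.IsDefinedBy L →
      ∀ (y : M.ResiduePoints p) (hy : y.pt ∈ Φ.U) (x : LocalPoints V p) (hx : x ∈ M.disk y),
        m.norm x (((Φ.diskChart hy).partials x.pt
          ((Φ.diskChart hy).pt_mem x hx)).toFibre x) = 1 := by
  obtain ⟨U, f, N, Φ, i, a, s, hv, hf, hT, hle, hN, ha, hs, hframe⟩ :=
    CoordSystem.exists_adapted (n := n) M L v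
  refine ⟨Φ, hv, fun p _ m hm y hy x hx => ?_⟩
  have hxU : x.pt ∈ M.incl ⁻¹ᵁ Φ.U := (Φ.diskChart hy).pt_mem x hx
  obtain ⟨hxL, hfr⟩ := hframe x.pt hxU
  obtain ⟨xt, hxt, hred⟩ := id hx
  have hcl : xt (closedPoint p.integers) = y.pt := by
    rw [← p.specReduction_closedPoint]
    exact congrArg (fun f : Spec (C.residueField p.1) ⟶ M.space =>
      f (closedPoint (C.residueField p.1))) hred
  obtain ⟨z, hz, hzy⟩ := hle hy
  have hUtop : xt ⁻¹ᵁ U = ⊤ := Scheme.preimage_eq_top_of_closedPoint_mem xt (by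
    rw [hcl, ← hzy]; exact z.2)
  have hrange : Set.range xt ⊆ Set.range U.ι := by
    rw [Scheme.Opens.range_ι]
    rintro _ ⟨q, rfl⟩
    have hq : q ∈ xt ⁻¹ᵁ U := hUtop ▸ trivial
    exact hq
  let t := IsOpenImmersion.lift U.ι xt hrange
  have ht : t ≫ U.ι = xt := IsOpenImmersion.lift_fac _ _ _
  -- The integral point of `M` through `x` lies in the domain of `f`, so its composite with `f` is
  -- the integral point of `M'` through `x`, to which the definition of the metric applies.
  have hext : M'.Extends x (t ≫ f) := by
    constructor
    · rw [Category.assoc]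
      refine (congrArg (t ≫ ·) hf).trans ?_
      rw [← Category.assoc, ht]
      exact hxt.1
    · rw [← Category.assoc]
      refine hT _ _ x.1 (fun q => hN ?_) ?_
      · have : Subsingleton (Spec (CommRingCat.of p.completion)) :=
          inferInstanceAs (Subsingleton (PrimeSpectrum p.completion))
        rw [Subsingleton.elim q (closedPoint p.completion)]
        exact hxU
      · rw [Category.assoc, ht]
        exact hxt.2
  have hcov : (t ≫ f) (closedPoint p.integers) ∈ L.cover i := by
    have h1 : U.ι (t (closedPoint p.integers)) = y.pt :=
      (congrArg (fun g : Spec (.of p.integers) ⟶ M.space => g (closedPoint p.integers)) ht).trans hcl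
    have h2 : z = t (closedPoint p.integers) :=
      U.ι.isOpenEmbedding.injective (hzy.trans h1.symm)
    have h3 : f (t (closedPoint p.integers)) ∈ L.cover i := h2 ▸ hz
    exact h3
  have key := hm x _ hext i hcov hxL
  let β := (Φ.diskChart hy).basis x.pt hxU
  have hβ : ((L.frame i).germ x.pt hxL) = ((L.frame i).germ x.pt hxL β) • β.det :=
    ((L.frame i).germ x.pt hxL).eq_smul_basis_det β
  have hβ' : ⇑β = fun j => KaehlerDifferential.D C.functionField (V.presheaf.stalk x.pt)
      (V.presheaf.germ _ x.pt hxU (Φ.coord j)) :=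
    funext fun j => (Φ.diskChart hy).basis_apply x.pt hxU j
  rw [← hβ'] at hfr
  set b := (L.frame i).germ x.pt hxL β with hb
  have hbs : M.valHom x hxU s * x.hom b = M.valHom x hxU a := by
    have := congrArg x.hom hfr
    rw [map_mul] at this
    exact this
  -- Invertible functions on `Φ.U` take unit values on residue disks, so the generator and the dual
  -- of the differentials differ at `x` by a unit and have the same norm.
  have hvb : Valued.v (x.hom b) = 1 := by
    have := congrArg Valued.v hbs
    rwa [map_mul, M.valued_valHom_eq_one hx Φ.isAffineOpen_U hy hxU hs,
      M.valued_valHom_eq_one hx Φ.isAffineOpen_U hy hxU ha, one_mul] at this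
  have hval : (L.frame i).value x hxL = (show x.ValueField from x.hom b) •
      ((Φ.diskChart hy).partials x.pt hxU).toFibre x := by
    ext w
    have := congrArg (fun g => x.hom (g w)) hβ
    simp only [AlternatingMap.smul_apply, smul_eq_mul, map_mul] at this
    exact this
  have h2 := key (1 : x.ValueField)
  rw [one_smul, hval, m.norm_smul] at h2
  have h3 : p.abs (x.hom b) = 1 := p.abs_eq_one hvb
  have h4 : p.abs (1 : p.completion) = 1 := p.abs_eq_one (map_one _)
  replace h2 := h2.trans h4
  exact (one_mul _).symm.trans ((congrArg (· * _) h3.symm).trans h2)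

end Adapted

end Tamagawa

namespace Tamagawa

/-! ### Finiteness of the set of exceptional places -/

section Finiteness

variable {C : Scheme.{u}} [IsIntegral C]

/-- The only generizations of a closed point of a nonsingular curve are itself and the generic
point. -/
lemma Place.eq_or_eq_genericPoint [IsNonsingularCurve C] (p : Place C) {z : C} (hz : z ⤳ p.1) :
    z = p.1 ∨ z = genericPoint C := by
  have hz' : z ∈ Set.range (C.fromSpecStalk p.1) := by rwa [Scheme.range_fromSpecStalk]
  have hg : genericPoint C ∈ Set.range (C.fromSpecStalk p.1) := by
    rw [Scheme.range_fromSpecStalk]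
    exact genericPoint_specializes _
  obtain ⟨q, rfl⟩ := hz'
  obtain ⟨g, hg⟩ := hg
  by_cases hq : q.asIdeal = ⊥
  · right
    refine (Specializes.antisymm ?_ (genericPoint_specializes _)).eq
    rw [← hg]
    exact Specializes.map ((PrimeSpectrum.le_iff_specializes q g).1
      (show q.asIdeal ≤ g.asIdeal from hq ▸ bot_le)) (C.fromSpecStalk p.1).continuous
  · left
    have : q = IsLocalRing.closedPoint (C.presheaf.stalk p.1) :=
      PrimeSpectrum.ext (IsLocalRing.eq_maximalIdeal (q.isPrime.isMaximal hq))
    rw [this, Scheme.fromSpecStalk_closedPoint]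

/-- T is a finite union of irreducible closed sets. The generic point of one that contains the place
p specializes to p, so it is p itself or the excluded generic point of C; hence that set is {p}. -/
lemma finite_places_of_isClosed [IsNonsingularCurve C] [TopologicalSpace.NoetherianSpace C]
    {T : Set C} (hT : IsClosed T) (hgen : genericPoint C ∉ T) : {p : Place C | p.1 ∈ T}.Finite := by
  obtain ⟨S, hS, hcl, hirr, rfl⟩ :=
    TopologicalSpace.NoetherianSpace.exists_finite_set_isClosed_irreducible hT
  refine Set.Finite.of_finite_image (f := fun p : Place C => ({p.1} : Set C))
    (hS.subset ?_) fun p _ q _ h => Subtype.ext (Set.singleton_injective h)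
  rintro _ ⟨p, ⟨A, hA, hpA⟩, rfl⟩
  obtain ⟨ζ, hζ⟩ := QuasiSober.sober (hirr A hA) (hcl A hA)
  rcases p.eq_or_eq_genericPoint (hζ.specializes hpA) with h | h
  · change {p.1} ∈ S
    have hA' : A = {p.1} := by rw [← hζ.def, h, p.2.closure_eq]
    rwa [← hA']
  · exact absurd ⟨A, hA, h ▸ hζ.mem⟩ hgen

variable {V : Scheme.{u}} [V.Over (Spec C.functionField)] (M : Model C V)

lemma genericPoint_mem_of_nonempty {U : C.Opens} (hU : (U : Set C).Nonempty) :
    genericPoint C ∈ U :=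
  (genericPoint_spec C).mem_open_set_iff U.2 |>.2 (by simpa using hU)

lemma Model.exists_incl_eq {z : M.space} (hz : M.toCurve z = genericPoint C) :
    ∃ v, M.incl v = z := by
  have h : z ∈ Set.range (Limits.pullback.fst M.toCurve (C.fromSpecStalk (genericPoint C))) := by
    rw [Scheme.Pullback.range_fst]
    refine ⟨IsLocalRing.closedPoint _, ?_⟩
    rw [Scheme.fromSpecStalk_closedPoint, hz]
  obtain ⟨w, rfl⟩ := h
  refine ⟨M.isPullback.isoPullback.inv w, ?_⟩
  rw [← Scheme.Hom.comp_apply, M.isPullback.isoPullback_inv_fst]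

/-- The image in the curve of a closed subset of a model not meeting the generic fibre is contained
in a closed subset not containing the generic point. -/
lemma Model.exists_isClosed_toCurve_mem {Z : Set M.space} (hZ : IsClosed Z)
    (hV : ∀ v, M.incl v ∉ Z) :
    ∃ T : Set C, IsClosed T ∧ genericPoint C ∉ T ∧ ∀ z ∈ Z, M.toCurve z ∈ T := by
  have := M.isProper
  obtain ⟨T, hT, hT'⟩ := (Topology.IsInducing.isClosed_iff
    M.base.ι.isOpenEmbedding.isInducing).1 (M.proj.isClosedMap Z hZ)
  have hmem (z) (hz : z ∈ Z) : M.toCurve z ∈ T := by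
    have : M.proj z ∈ M.base.ι ⁻¹' T := hT' ▸ Set.mem_image_of_mem _ hz
    simpa using this
  refine ⟨T, hT, fun h => ?_, hmem⟩
  have h' : (⟨genericPoint C, genericPoint_mem_of_nonempty M.nonempty⟩ : M.base) ∈
      M.base.ι ⁻¹' T := h
  rw [hT'] at h'
  obtain ⟨z, hz, hz'⟩ := h'
  obtain ⟨v, rfl⟩ := M.exists_incl_eq (z := z) (congrArg M.base.ι hz')
  exact hV v hz

variable {M} {n : ℕ} [IsNonsingularCurve C]

theorem finite_localMeasure_univ_ne_density [IsNoetherian C] [CompactSpace V]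
    [∀ p : Place C, Finite (C.residueField p.1)]
    [SmoothOfRelativeDimension n (V ↘ Spec C.functionField)]
    {m : ∀ p : Place C, PadicMetric V n p} (hm : IsAdelicMetric m) (M : Model C V) :
    {p : Place C | p.1 ∈ M.base ∧ localMeasure (m p) Set.univ ≠ M.density n p}.Finite := by
  obtain ⟨M', L, hL⟩ := hm
  choose Φ hΦ hnorm using CoordSystem.exists_norm_eq_one (n := n) M L
  obtain ⟨t, ht⟩ := isCompact_univ.elim_finite_subcover
    (fun v => ((M.incl ⁻¹ᵁ (Φ v).U : V.Opens) : Set V)) (fun v => (M.incl ⁻¹ᵁ (Φ v).U).2)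
    fun v _ => Set.mem_iUnion.2 ⟨v, hΦ v⟩
  -- The part of the model outside the finitely many chosen neighbourhoods is closed and misses the
  -- generic fibre.
  obtain ⟨T, hT, hgT, hmem⟩ := M.exists_isClosed_toCurve_mem
    (Z := (⋃ v ∈ t, ((Φ v).U : Set M.space))ᶜ)
    (isOpen_biUnion fun v _ => (Φ v).U.2).isClosed_compl fun v hv => hv (by
      simpa using ht (Set.mem_univ v))
  -- The exceptional places are those over which the neighbourhoods fail to cover the model and
  -- those outside the base of the model that defines the metric.
  refine ((finite_places_of_isClosed hT hgT).union
    (finite_places_of_isClosed M'.base.2.isClosed_compl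
      (not_not.2 (genericPoint_mem_of_nonempty M'.nonempty)))).subset fun p hp => ?_
  by_contra hbad
  obtain ⟨hpT, hpM'⟩ := not_or.1 hbad
  have hcov (y : M.ResiduePoints p) : ∃ v ∈ t, y.pt ∈ (Φ v).U := by
    by_contra hy
    refine hpT ?_
    change p.1 ∈ T
    rw [← y.toCurve_pt]
    refine hmem _ fun hy' => hy ?_
    simpa using hy'
  have hfin : Finite (M.ResiduePoints p) := by
    refine Set.finite_univ_iff.1 ((t.finite_toSet.biUnion fun v _ =>
      (Φ v).finite_setOf_pt_mem (p := p)).subset fun y _ => ?_)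
    obtain ⟨v, hv, hy⟩ := hcov y
    exact Set.mem_biUnion hv hy
  choose v hv hy using hcov
  exact hp.2 (localMeasure_univ_eq_density hp.1 (m p) (fun y => Φ (v y)) hy
    fun y x hx => hnorm _ p (m p) (hL p (not_not.1 hpM')) y (hy y) x hx)

end Finiteness

end Tamagawa

end

theorem mainTheorem9 (k : Type u) [Field k] [Finite k]
    (C : Scheme.{u}) [C.Over (Spec (.of k))] [IsIntegral C]
    [IsProper (C ↘ Spec (.of k))] [Tamagawa.IsNonsingularCurve C]
    (V : Scheme.{u}) [V.Over (Spec C.functionField)]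
    [IsProper (V ↘ Spec C.functionField)] [GeometricallyIntegral (V ↘ Spec C.functionField)]
    (n : ℕ) [SmoothOfRelativeDimension n (V ↘ Spec C.functionField)]
    (m : ∀ p : Tamagawa.Place C, Tamagawa.PadicMetric V n p) (hm : Tamagawa.IsAdelicMetric m)
    (M : Tamagawa.Model C V) :
    {p : Tamagawa.Place C | p.1 ∈ M.base ∧
      Tamagawa.localMeasure (m p) Set.univ ≠ M.density n p}.Finite := by
  have : IsLocallyNoetherian C := LocallyOfFiniteType.isLocallyNoetherian (C ↘ Spec (.of k))
  have : CompactSpace C := QuasiCompact.compactSpace_of_compactSpace (C ↘ Spec (.of k))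
  have : CompactSpace V := QuasiCompact.compactSpace_of_compactSpace (V ↘ Spec C.functionField)
  have : IsNoetherian C := {}
  have := Tamagawa.finite_residueField k C
  exact Tamagawa.finite_localMeasure_univ_ne_density hm M
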